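/- Let $\lambda$ be an infinite cardinal with $\lambda^{<\lambda}=\lambda$. Write $\mathcal P_{<\lambda}(A)$ for the set of subsets of $A$ of cardinality less than $\lambda$. **The principle $\mathrm{Dl}_\lambda$.** There are sets $\mathcal A_\alpha\subseteq\mathcal P(\alpha)$ with $|\mathcal A_\alpha|<\lambda$, for $\alpha<\lambda$, such that for every $A\subseteq\lambda$ the set $\{\alpha<\lambda : A\cap\alpha\in\mathcal A_\alpha\}$ is stationary in $\lambda$. **Uniform partial orders.** A *standard $\lambda^+$-uniform partial order* is a partial order $\le$ on a set $\mathbb P\subseteq\lambda\times\mathcal P_{<\lambda}(\lambda^+)$ such that, writing $\operatorname{dom}(\xi,u)=u$, the following hold. Here $\alpha$ ranges over ordinals below $\lambda^+$. 1. If $p\le q$ then $\operatorname{dom}p\subseteq\operatorname{dom}q$. 2. If $p,q\le r$, there is $r'\in\mathbb P$ with $p,q\le r'\le r$ and $\operatorname{dom}r'=\operatorname{dom}p\cup\operatorname{dom}q$. 3. Every increasing sequence $(p_i)_{i<\delta}$ with $\delta<\lambda$ (including $\delta=0$) has a least upper bound $\bigcup_{i<\delta}p_i$, and its domain is $\bigcup_{i<\delta}\operatorname{dom}p_i$.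 4. For all $p$ and $\alpha$ there is $q\le p$ with $\operatorname{dom}q=\operatorname{dom}p\cap\alpha$, and there is a unique maximal such $q$, denoted $p\restriction\alpha$. 5. For every limit ordinal $\delta<\lambda^+$, $p\restriction\delta$ is the least upper bound of $\{p\restriction\alpha:\alpha<\delta\}$. 6. For every increasing sequence $(p_i)_{i<\delta}$ with $\delta<\lambda$, $(\bigcup_{i<\delta}p_i)\restriction\alpha=\bigcup_{i<\delta}(p_i\restriction\alpha)$. 7. If $p=(\xi,v)\in\mathbb P$ and $h:v\to v'\subseteq\lambda^+$ is an order isomorphism, then $h[p]:=(\xi,v')\in\mathbb P$; and if $q\le p$ then $h[q]\le h[p]$. 8. If $p\restriction\alpha\le q$ and $\operatorname{dom}p\cap\operatorname{dom}q=\operatorname{dom}p\cap\alpha$, then some $r\in\mathbb P$ satisfies $p,q\le r$. A partial order is *$\lambda^+$-uniform* if it is isomorphic to a standard one. It then carries the notions of domain, restriction and $h[p]$ induced by a fixed isomorphism. Put $\mathbb P_\alpha=\{p\in\mathbb P:\operatorname{dom}p\subseteq\alpha\}$. **Generic ideals.** $\mathrm{Gen}(\mathbb P_\alpha)$ is the set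 of *$\lambda$-generic ideals* of $\mathbb P_\alpha$, that is, of sets $G\subseteq\mathbb P_\alpha$ such that: $G$ is closed downward; every $Q\subseteq G$ with $|Q|<\lambda$ has an upper bound in $G$; and every $p\in\mathbb P_\alpha\setminus G$ is incompatible (has no common upper bound in $\mathbb P$) with some $q\in G$. For $G\subseteq\mathbb P$ let $\mathbb P/G$ be the set of all $p\in\mathbb P$ that are compatible with every element of $G$; so $\mathbb P/\emptyset=\mathbb P$. **Density systems.** Let $G\in\mathrm{Gen}(\mathbb P_\alpha)$, or let $G=\emptyset$ and $\alpha=0$. A *density system over $G$* is a function $D:\{(u,w):u\subseteq w\in\mathcal P_{<\lambda}(\lambda^+)\}\to\mathcal P(\mathbb P)$ such that: * (a) $D(u,w)\subseteq\{p\in\mathbb P/G:\operatorname{dom}p\subseteq w\}$; * (b) if $p,q\in\mathbb P/G$, $p\in D(u,w)$, $p\le q$ and $\operatorname{dom}q\subseteq w$, then $q\in D(u,w)$; * (c) for every $p\in\mathbb P/G$ with $\operatorname{dom}p\subseteq w$ there is $q\ge p$ in $D(u,w)$; * (d) if $w_1\cap\alpha=w_2\cap\alpha$ and $h:w_1\to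 w_2$ is an order isomorphism with $h[u_1]=u_2$, then for every $p\in\mathbb P/G$ with $\operatorname{dom}p\subseteq w_1$: $p\in D(u_1,w_1)$ if and only if $h[p]\in D(u_2,w_2)$. An ideal $G\in\mathrm{Gen}(\mathbb P_\gamma)$ *meets* $D$ if for every $u\in\mathcal P_{<\lambda}(\gamma)$ there is $v\in\mathcal P_{<\lambda}(\gamma)$ with $u\subseteq v$ and $G\cap D(u,v)\ne\emptyset$. **The genericity game for $\mathbb P$.** The game has length $\lambda^+$. At stage $\alpha<\lambda^+$ ordinals $\zeta_\beta<\lambda^+$ and ideals $G_\beta\in\mathrm{Gen}(\mathbb P_{\zeta_\beta})$ have been chosen by player II for $\beta<\alpha$. Let $\zeta_{<\alpha}=\sup_{\beta<\alpha}\zeta_\beta$. Let $G_{<0}=\emptyset$ and, for $\alpha>0$, let $G_{<\alpha}$ be the least $\lambda$-generic ideal of $\mathbb P_{\zeta_{<\alpha}}$ containing $\bigcup_{\beta<\alpha}G_\beta$. Player I plays an element $g_\alpha\in\mathbb P/G_{<\alpha}$ and at most $\lambda$ density systems $D^\alpha_i$ over $G_{<\alpha}$ (with $\zeta_{<\alpha}$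 as the ordinal in (d)). Player II then plays an ordinal $\zeta_\alpha<\lambda^+$ and a $\lambda$-generic ideal $G_\alpha$ of $\mathbb P_{\zeta_\alpha}$. Player II wins if the sequence $(\zeta_\alpha)$ is strictly increasing, the sequence $(G_\alpha)$ is increasing under inclusion, and for all $\alpha$ and all indices $i$ occurring at stage $\alpha$: $g_\alpha\in G_\alpha$, and $G_\beta$ meets $D^\alpha_i$ for every $\beta\ge\alpha$. **Theorem.** If $\lambda$ is an infinite cardinal with $\lambda^{<\lambda}=\lambda$ and $\mathrm{Dl}_\lambda$ holds, then for every $\lambda^+$-uniform partial order $\mathbb P$ player II has a winning strategy in the genericity game for $\mathbb P$. -/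

import Mathlib

open Cardinal Ordinal Set Order

universe u v

/-- `𝒫_{<κ}(A)`: the subsets of `A`, a set of ordinals, that have cardinality less than `κ`. -/
def SmallSubsets (κ : Cardinal.{u}) (A : Set Ordinal.{u}) : Set (Set Ordinal.{u}) :=
  {x | x ⊆ A ∧ #x < Cardinal.lift.{u + 1} κ}

/-- The principle `Dl_κ`: there are families `𝒜 α ⊆ 𝒫(α)`, each of fewer than `κ` sets, such that
every `A ⊆ κ` satisfies `A ∩ α ∈ 𝒜 α` for stationarily many `α < κ`. The cardinal `κ` is
identified with the initial ordinal `κ.ord`, and an ordinal `α` with the set `Iio α`. -/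
def DlPrinciple (κ : Cardinal.{u}) : Prop :=
  ∃ 𝒜 : Ordinal.{u} → Set (Set Ordinal.{u}),
    (∀ α < κ.ord, (∀ x ∈ 𝒜 α, x ⊆ Iio α) ∧ #(𝒜 α) < Cardinal.lift.{u + 1} κ) ∧
    ∀ A ⊆ Iio κ.ord, IsStationary {α : Iio κ.ord | A ∩ Iio (α : Ordinal.{u}) ∈ 𝒜 α}

/-- A partial order `P` together with two functions `code : P → κ` and `dom : P → 𝒫_{<κ}(κ⁺)` such
that `p ↦ (code p, dom p)` is injective. Transporting the order along this map identifies `P` with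
a partial order on a subset of `κ × 𝒫_{<κ}(κ⁺)`. -/
structure Coding (κ : Cardinal.{u}) (P : Type v) [PartialOrder P] where
  code : P → Ordinal.{u}
  dom : P → Set Ordinal.{u}
  code_lt : ∀ p, code p < κ.ord
  dom_mem : ∀ p, dom p ∈ SmallSubsets κ (Iio (succ κ).ord)
  inj : ∀ p q, code p = code q → dom p = dom q → p = q

namespace Coding

variable {κ : Cardinal.{u}} {P : Type v} [PartialOrder P]

/-- `q` is a restriction `p ↾ α`: a maximal element of `{q ≤ p : dom q = dom p ∩ α}`. -/
def IsRestr (C : Coding κ P) (p : P) (α : Ordinal.{u}) (q : P) : Prop :=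
  Maximal (fun r => r ≤ p ∧ C.dom r = C.dom p ∩ Iio α) q

/-- `p' = h[p]`: the element `p'` has the same code as `p`, and its domain is the image of the
domain of `p` under `h`. -/
def IsImage (C : Coding κ P) (h : Ordinal.{u} → Ordinal.{u}) (p p' : P) : Prop :=
  C.code p' = C.code p ∧ C.dom p' = h '' C.dom p

/-- The image of `P` under `p ↦ (code p, dom p)` is a standard `κ⁺`-uniform partial order. A
partial order `P` is `κ⁺`-uniform when it has such a coding. -/
structure IsUniform (C : Coding κ P) : Prop where
  dom_mono : ∀ p q, p ≤ q → C.dom p ⊆ C.dom q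
  interpolation : ∀ p q r, p ≤ r → q ≤ r →
    ∃ r', p ≤ r' ∧ q ≤ r' ∧ r' ≤ r ∧ C.dom r' = C.dom p ∪ C.dom q
  complete : ∀ δ < κ.ord, ∀ p : Iio δ → P, Monotone p →
    ∃ q, IsLUB (range p) q ∧ C.dom q = ⋃ i, C.dom (p i)
  restr : ∀ p, ∀ α < (succ κ).ord, ∃! q, C.IsRestr p α q
  restr_limit : ∀ p, ∀ δ < (succ κ).ord, IsSuccLimit δ → ∀ q, C.IsRestr p δ q →
    IsLUB {r | ∃ α < δ, C.IsRestr p α r} q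
  restr_lub : ∀ δ < κ.ord, ∀ p : Iio δ → P, Monotone p → ∀ q, IsLUB (range p) q →
    ∀ α < (succ κ).ord, ∀ r, C.IsRestr q α r → IsLUB {s | ∃ i, C.IsRestr (p i) α s} r
  /-- Indiscernibility. An order isomorphism from `dom p` onto a subset of `κ⁺` is given by a
  function that is strictly increasing on `dom p`. -/
  indiscernible : ∀ p, ∀ h : Ordinal.{u} → Ordinal.{u}, StrictMonoOn h (C.dom p) →
    h '' C.dom p ⊆ Iio (succ κ).ord →
      (∃ p', C.IsImage h p p') ∧
      ∀ q ≤ p, ∀ p' q', C.IsImage h p p' → C.IsImage h q q' → q' ≤ p'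
  /-- Amalgamation. -/
  amalgamation : ∀ p q, ∀ α < (succ κ).ord, ∀ s, C.IsRestr p α s → s ≤ q →
    C.dom p ∩ C.dom q = C.dom p ∩ Iio α → ∃ r, p ≤ r ∧ q ≤ r

/-- `P_α`. -/
def below (C : Coding κ P) (α : Ordinal.{u}) : Set P :=
  {p | C.dom p ⊆ Iio α}

/-- `G ∈ Gen(P_α)`: `G` is a `κ`-generic ideal of `P_α`. Compatibility is computed in `P`. -/
structure IsGeneric (C : Coding κ P) (α : Ordinal.{u}) (G : Set P) : Prop where
  subset : G ⊆ C.below α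
  isLowerSet : IsLowerSet G
  directed : ∀ Q ⊆ G, Cardinal.lift.{u} #Q < Cardinal.lift.{v} κ → ∃ r ∈ G, ∀ q ∈ Q, q ≤ r
  decides : ∀ p ∈ C.below α, p ∉ G → ∃ q ∈ G, ¬ ∃ r, p ≤ r ∧ q ≤ r

end Coding

/-- `P/G`, the set of all `p` that are compatible with every element of `G`. In particular
`P/∅` is all of `P`. -/
def genericQuotient {P : Type v} [PartialOrder P] (G : Set P) : Set P :=
  {p | ∀ r ∈ G, ∃ s, p ≤ s ∧ r ≤ s}

/-- The functions `(x, w) ↦ D(x, w) ⊆ P`. Only the values at sets `x ⊆ w ∈ 𝒫_{<κ}(κ⁺)` matter. -/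
abbrev SystemFun (P : Type v) : Type (max (u + 1) v) :=
  Set Ordinal.{u} → Set Ordinal.{u} → Set P

namespace Coding

variable {κ : Cardinal.{u}} {P : Type v} [PartialOrder P]

/-- `D` is a density system over `G`, where `G ∈ Gen(P_α)`, or `G = ∅` and `α = 0`. -/
structure IsDensitySystem (C : Coding κ P) (α : Ordinal.{u}) (G : Set P)
    (D : SystemFun.{u, v} P) : Prop where
  subset : ∀ w ∈ SmallSubsets κ (Iio (succ κ).ord), ∀ x ⊆ w,
    D x w ⊆ {p | p ∈ genericQuotient G ∧ C.dom p ⊆ w}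
  upward : ∀ w ∈ SmallSubsets κ (Iio (succ κ).ord), ∀ x ⊆ w,
    ∀ p ∈ genericQuotient G, ∀ q ∈ genericQuotient G,
      p ∈ D x w → p ≤ q → C.dom q ⊆ w → q ∈ D x w
  dense : ∀ w ∈ SmallSubsets κ (Iio (succ κ).ord), ∀ x ⊆ w,
    ∀ p ∈ genericQuotient G, C.dom p ⊆ w → ∃ q ∈ D x w, p ≤ q
  uniform : ∀ w₁ ∈ SmallSubsets κ (Iio (succ κ).ord), ∀ x₁ ⊆ w₁,
    ∀ w₂ ∈ SmallSubsets κ (Iio (succ κ).ord), ∀ x₂ ⊆ w₂,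
      w₁ ∩ Iio α = w₂ ∩ Iio α →
      ∀ h : Ordinal.{u} → Ordinal.{u}, StrictMonoOn h w₁ → h '' w₁ = w₂ → h '' x₁ = x₂ →
        ∀ p ∈ genericQuotient G, C.dom p ⊆ w₁ →
          ∀ p', C.IsImage h p p' → (p ∈ D x₁ w₁ ↔ p' ∈ D x₂ w₂)

end Coding

/-- `G ∈ Gen(P_γ)` meets `D`. -/
def SystemFun.Meets {P : Type v} (κ : Cardinal.{u}) (γ : Ordinal.{u}) (G : Set P)
    (D : SystemFun.{u, v} P) : Prop :=
  ∀ x ∈ SmallSubsets κ (Iio γ), ∃ w ∈ SmallSubsets κ (Iio γ), x ⊆ w ∧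
    (G ∩ D x w).Nonempty

/-! The genericity game. -/

/-- A move of player I: an element of `P` and a set of density systems. -/
structure MoveI (P : Type v) : Type (max (u + 1) v) where
  elt : P
  systems : Set (SystemFun.{u, v} P)

/-- A move of player II: an ordinal `ζ` and an ideal of `P_ζ`. -/
structure MoveII (P : Type v) : Type (max (u + 1) v) where
  height : Ordinal.{u}
  ideal : Set P

/-- A strategy for player II: a function that computes the move of player II at stage `α` from the
moves of player I at the stages `β ≤ α`. -/
def StrategyII (P : Type v) : Type (max (u + 1) v) :=
  (α : Ordinal.{u}) → (Iic α → MoveI.{u, v} P) → MoveII.{u, v} P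

/-- The moves of player II when player I plays `x` and player II follows the strategy `σ`. -/
def StrategyII.play {P : Type v} (σ : StrategyII.{u, v} P) (x : Ordinal.{u} → MoveI.{u, v} P)
    (α : Ordinal.{u}) : MoveII.{u, v} P :=
  σ α fun β => x β

/-- `ζ_{<α}`, the supremum of the ordinals `ζ_β` for `β < α`; it is `0` for `α = 0`. -/
noncomputable def heightBefore {P : Type v} (y : Ordinal.{u} → MoveII.{u, v} P)
    (α : Ordinal.{u}) : Ordinal.{u} :=
  ⨆ β : Iio α, (y β).height

namespace Coding

variable {κ : Cardinal.{u}} {P : Type v} [PartialOrder P]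

/-- `G_{<α}`. It is empty for `α = 0`. For `α > 0` it is the least `κ`-generic ideal of
`P_{ζ_{<α}}` that contains all the ideals `G_β` for `β < α`, written as the intersection of all
`κ`-generic ideals with this property. -/
def idealBefore (C : Coding κ P) (y : Ordinal.{u} → MoveII.{u, v} P) (α : Ordinal.{u}) : Set P :=
  {p | α ≠ 0 ∧ ∀ H, C.IsGeneric (heightBefore y α) H → (∀ β < α, (y β).ideal ⊆ H) → p ∈ H}

/-- The move `m` of player I at stage `α` obeys the rules, when `y` lists the moves of player II:
the element belongs to `P/G_{<α}`, and the systems are at most `κ` density systems over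
`G_{<α}`. -/
def LegalI (C : Coding κ P) (y : Ordinal.{u} → MoveII.{u, v} P) (α : Ordinal.{u})
    (m : MoveI.{u, v} P) : Prop :=
  m.elt ∈ genericQuotient (C.idealBefore y α) ∧
  #m.systems ≤ Cardinal.lift.{max (u + 1) v} κ ∧
  ∀ D ∈ m.systems, C.IsDensitySystem (heightBefore y α) (C.idealBefore y α) D

/-- What player II has to achieve at stage `α`, when `x` and `y` list the moves of players I
and II: `ζ_α < κ⁺` and `G_α ∈ Gen(P_{ζ_α})`, the sequences `ζ` and `G` are increasing up to `α`,
the element played at stage `α` is in `G_α`, and `G_α` meets every density system played at a stage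
`β ≤ α`. -/
def GoodII (C : Coding κ P) (x : Ordinal.{u} → MoveI.{u, v} P)
    (y : Ordinal.{u} → MoveII.{u, v} P) (α : Ordinal.{u}) : Prop :=
  (y α).height < (succ κ).ord ∧
  C.IsGeneric (y α).height (y α).ideal ∧
  (∀ β < α, (y β).height < (y α).height ∧ (y β).ideal ⊆ (y α).ideal) ∧
  (x α).elt ∈ (y α).ideal ∧
  ∀ β ≤ α, ∀ D ∈ (x β).systems, D.Meets κ (y α).height (y α).ideal

/-- `σ` is a winning strategy for player II in the game of length `κ⁺`: whatever player I plays,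
player II, following `σ`, achieves the aims of every stage `α < κ⁺` up to which player I has obeyed
the rules. -/
def IsWinningII (C : Coding κ P) (σ : StrategyII.{u, v} P) : Prop :=
  ∀ x : Ordinal.{u} → MoveI.{u, v} P, ∀ α < (succ κ).ord,
    (∀ β ≤ α, C.LegalI (σ.play x) β (x β)) → C.GoodII x (σ.play x) α

end Coding

/-! At stage δ the earlier moves determine the quotient `quotBefore`: the conditions whose
restrictions to all earlier heights lie in the earlier ideals. Player II wins if, for every δ < κ⁺,
this quotient has two properties: its elements with domain below ζ_{<δ} decide whether a given small
set of conditions is bounded (`DecidesBounds`), and every system played before δ is dense in it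
(`DenseIn`). The first property yields amalgamation inside the quotient and identifies the quotient
with P/G_{<δ}. Read at δ + 1, the two properties say that G_δ is generic and meets the systems
(`exists_isWinningII`).

The difficulty is at limits, where nothing can be chosen any more and the ideals already played must
have these properties. If κ = ℵ₀, small sets are finite, so an instance of either property already
lives at one earlier stage; indiscernibility leaves only countably many instances to treat at each
stage, and an ω-sequence of conditions treats them all.

If κ is uncountable, a small set can be cofinal in the earlier heights, so limits must be
anticipated. Every ideal is generated by an increasing κ-sequence, and every δ < κ⁺ is the union of
an increasing chain of small pieces `part δ i`, i < κ. An instance at a future stage consists of a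
small set of conditions, a small set of ordinals, the index of a system, and an increasing sequence
in G_{<δ} that dominates the earlier generating sequences. Its first i points collapse to a scenario
below κ. Dl_κ provides fewer than κ scenarios for each i such that every instance is guessed
correctly at some i in any given club (`exists_guess_scenarios`). At step i of every stage β, player
II chooses a condition for each scenario that is consistent with the approximation at hand. These
conditions increase along `part δ i`, agree as long as the scenarios agree, decide the boundedness
of the guessed set already at stage 0, and enter the guessed system at the stage where it is played.
For a correct guess their least upper bound over `part δ i` expands to the condition required at δ
(`exists_of_guess`).

Treating all scenarios at once is the combinatorial core. The scenarios form a tree with fewer than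
κ branches; `exists_coherent_mem` extends a coherent family on the branches into prescribed dense
sets. Branches are added one at a time, and a new branch is reconciled with the old ones by a
back-and-forth of ω steps, whose limits exist because κ > ℵ₀. -/

/-- `s` has fewer than `κ` elements. -/
def IsSmall (κ : Cardinal.{u}) {α : Type v} (s : Set α) : Prop :=
  Cardinal.lift.{u} #s < Cardinal.lift.{v} κ

/-! ### Sets of fewer than κ elements. -/

section IsSmall

universe w

variable {κ : Cardinal.{u}} {α : Type v} {β : Type w} {s t : Set α}

theorem isSmall_ordinal {s : Set Ordinal.{u}} : IsSmall κ s ↔ #s < Cardinal.lift.{u + 1} κ := by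
  unfold IsSmall
  rw [Cardinal.lift_id'.{u, u+1}]

theorem IsSmall.mono (ht : IsSmall κ t) (h : s ⊆ t) : IsSmall κ s :=
  (Cardinal.lift_le.2 (mk_le_mk_of_subset h)).trans_lt ht

theorem IsSmall.image (hs : IsSmall κ s) (f : α → β) : IsSmall κ (f '' s) := by
  unfold IsSmall at *
  have h1 := mk_image_le_lift (f := f) (s := s)
  have h2 : Cardinal.lift.{max u v} #(f '' s) ≤ Cardinal.lift.{max u w} #s := by
    have := Cardinal.lift_le.{u}.2 h1
    rw [Cardinal.lift_lift, Cardinal.lift_lift] at this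
    convert this using 1
  have h3 : Cardinal.lift.{max u w} #s < Cardinal.lift.{max v w} κ := by
    have := Cardinal.lift_lt.{_, w}.2 hs
    rw [Cardinal.lift_lift, Cardinal.lift_lift] at this
    exact this
  have h4 := h2.trans_lt h3
  rw [← Cardinal.lift_lt.{_, v}, Cardinal.lift_lift, Cardinal.lift_lift]
  exact h4

theorem isSmall_of_finite (hκ : ℵ₀ ≤ κ) (hs : s.Finite) : IsSmall κ s := by
  have : #s < ℵ₀ := Cardinal.lt_aleph0_iff_set_finite.2 hs
  have h2 : Cardinal.lift.{u} #s < ℵ₀ := by simpa using this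
  exact h2.trans_le (by simpa using hκ)

theorem isSmall_aleph0 : IsSmall ℵ₀ s ↔ s.Finite := by
  unfold IsSmall
  rw [← Cardinal.lt_aleph0_iff_set_finite]
  simp

theorem isSmall_of_countable (hκ : ℵ₀ < κ) (hs : s.Countable) : IsSmall κ s := by
  have : #s ≤ ℵ₀ := Cardinal.le_aleph0_iff_set_countable.2 hs
  have h2 : Cardinal.lift.{u} #s ≤ ℵ₀ := by simpa using this
  exact h2.trans_lt (by simpa using hκ)

theorem isSmall_Iio {i : Ordinal.{u}} (hi : i < κ.ord) : IsSmall κ (Iio i) := by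
  rw [isSmall_ordinal, Cardinal.mk_Iio_ordinal, Cardinal.lift_lt]
  exact Cardinal.lt_ord.1 hi

theorem IsSmall.union (hκ : ℵ₀ ≤ κ) (hs : IsSmall κ s) (ht : IsSmall κ t) :
    IsSmall κ (s ∪ t) := by
  unfold IsSmall at *
  have h1 := Cardinal.lift_le.{u}.2 (Cardinal.mk_union_le s t)
  rw [Cardinal.lift_add] at h1
  exact h1.trans_lt (Cardinal.add_lt_of_lt (by simpa using hκ) hs ht)

theorem exists_bijOn_of_lift_mk_eq [Nonempty α] {c : Cardinal.{u}}
    (h : Cardinal.lift.{v} c = Cardinal.lift.{u} #s) :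
    ∃ f : Ordinal.{u} → α, BijOn f (Iio c.ord) s := by
  have h1 : Cardinal.lift.{v} #c.ord.ToType = Cardinal.lift.{u} #s := by simpa using h
  obtain ⟨e⟩ := Cardinal.lift_mk_eq'.1 h1
  let g : Iio c.ord ≃ s := (Ordinal.ToType.mk (o := c.ord)).toEquiv.trans e
  refine ⟨fun ξ => if h : ξ < c.ord then g ⟨ξ, h⟩ else Classical.arbitrary α, ?_, ?_, ?_⟩
  · intro ξ hξ
    simp [mem_Iio.1 hξ]
  · intro ξ hξ ξ' hξ' heq
    simp only [mem_Iio.1 hξ, mem_Iio.1 hξ', dif_pos] at heq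
    have := g.injective (Subtype.ext heq)
    exact congrArg Subtype.val this
  · intro a ha
    refine ⟨(g.symm ⟨a, ha⟩ : Ordinal), (g.symm ⟨a, ha⟩).2, ?_⟩
    have : (g.symm ⟨a, ha⟩ : Ordinal) < c.ord := (g.symm ⟨a, ha⟩).2
    exact (dif_pos this).trans (congrArg Subtype.val (g.apply_symm_apply ⟨a, ha⟩))

theorem exists_surjOn_of_mk_le [Nonempty α] (h : Cardinal.lift.{u} #s ≤ Cardinal.lift.{v} κ) :
    ∃ f : Ordinal.{u} → α, SurjOn f (Iio κ.ord) s := by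
  obtain ⟨c, hc, h2⟩ := Cardinal.le_lift_iff.1 h
  obtain ⟨f, hf⟩ := exists_bijOn_of_lift_mk_eq h2
  exact ⟨f, hf.surjOn.mono (Iio_subset_Iio (Cardinal.ord_le_ord.2 hc)) le_rfl⟩

theorem exists_injOn_of_mk_le [Nonempty α] (h : Cardinal.lift.{u} #s ≤ Cardinal.lift.{v} κ) :
    ∃ f : α → Ordinal.{u}, InjOn f s ∧ ∀ a ∈ s, f a < κ.ord := by
  obtain ⟨c, hc, h2⟩ := Cardinal.le_lift_iff.1 h
  obtain ⟨f, hf⟩ := exists_bijOn_of_lift_mk_eq h2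
  refine ⟨Function.invFunOn f (Iio c.ord), hf.surjOn.rightInvOn_invFunOn.injOn, fun a ha => ?_⟩
  have := hf.surjOn.mapsTo_invFunOn ha
  exact lt_of_lt_of_le this (Cardinal.ord_le_ord.2 hc)

theorem IsSmall.exists_enum [Nonempty α] (hs : IsSmall κ s) :
    ∃ θ < κ.ord, ∃ f : Ordinal.{u} → α, SurjOn f (Iio θ) s := by
  obtain ⟨c, hc, h2⟩ := Cardinal.lt_lift_iff.1 hs
  obtain ⟨f, hf⟩ := exists_bijOn_of_lift_mk_eq h2
  exact ⟨c.ord, Cardinal.ord_lt_ord.2 hc, f, hf.surjOn⟩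

theorem IsSmall.exists_bound (hκ : κ.IsRegular) (hs : IsSmall κ s) (f : α → Ordinal.{u})
    (hf : ∀ a ∈ s, f a < κ.ord) : ∃ b < κ.ord, ∀ a ∈ s, f a < b := by
  have h1 := hs.image f
  -- Successors are taken so that the supremum is a strict bound.
  have hb : BddAbove ((fun x => x + 1) '' (f '' s)) := by
    refine ⟨κ.ord + 1, ?_⟩
    rintro _ ⟨_, ⟨a, ha, rfl⟩, rfl⟩
    exact add_le_add_left (hf a ha).le 1
  refine ⟨sSup ((fun x => x + 1) '' (f '' s)), ?_, ?_⟩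
  · apply Ordinal.sSup_add_one_lt_of_lt_cof
    · rw [← Ordinal.lift_cof, hκ.cof_ord]
      exact isSmall_ordinal.1 h1
    · rintro _ ⟨a, ha, rfl⟩
      exact hf a ha
  · intro a ha
    have : f a + 1 ≤ _ := le_csSup hb ⟨f a, ⟨a, ha, rfl⟩, rfl⟩
    exact (Order.lt_add_one_iff.2 le_rfl).trans_le this

/-- Regularity bounds the lengths of the enumerations of all `f a` by one b < κ, so the union is an
image of a product of two small sets. -/
theorem IsSmall.biUnion (hκ : κ.IsRegular) (hs : IsSmall κ s) {f : α → Set β}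
    (hf : ∀ a ∈ s, IsSmall κ (f a)) : IsSmall κ (⋃ a ∈ s, f a) := by
  rcases isEmpty_or_nonempty β with hβ | hβ
  · exact isSmall_of_finite hκ.aleph0_le (Set.toFinite _)
  rcases isEmpty_or_nonempty α with hα | hα
  · exact isSmall_of_finite hκ.aleph0_le (by simp)
  obtain ⟨θ, hθ, e, he⟩ := hs.exists_enum
  choose! τ hτ g hg using fun a (ha : a ∈ s) => (hf a ha).exists_enum
  obtain ⟨b, hb, hb'⟩ := hs.exists_bound hκ τ hτ
  have hprod : IsSmall κ (Iio θ ×ˢ Iio b) := by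
    have h1 := isSmall_ordinal.1 (isSmall_Iio hθ)
    have h2 := isSmall_ordinal.1 (isSmall_Iio hb)
    unfold IsSmall
    rw [Cardinal.lift_id'.{u, u+1}, Cardinal.mk_setProd]
    exact Cardinal.mul_lt_of_lt (by simpa using hκ.aleph0_le) h1 h2
  refine (hprod.image fun x => g (e x.1) x.2).mono ?_
  intro y hy
  simp only [mem_iUnion] at hy
  obtain ⟨a, ha, hy⟩ := hy
  obtain ⟨j, hj, rfl⟩ := he ha
  obtain ⟨k, hk, rfl⟩ := hg _ ha hy
  exact ⟨(j, k), ⟨hj, lt_trans hk (hb' _ ha)⟩, rfl⟩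

theorem IsSmall.succ (hs : IsSmall κ s) : IsSmall (Order.succ κ) s :=
  lt_trans hs (Cardinal.lift_lt.2 (Order.lt_succ κ))

theorem isSmall_succ : IsSmall (Order.succ κ) s ↔ Cardinal.lift.{u} #s ≤ Cardinal.lift.{v} κ := by
  unfold IsSmall
  rw [Cardinal.lift_succ, Order.lt_succ_iff]

end IsSmall

/-! ### Clubs of κ and their diagonal intersections. -/

/-- `p i` holds for all `i` in a club of `κ`, presented as the set of limit ordinals that are closed
under a function. -/
def Club (κ : Cardinal.{u}) (p : Ordinal.{u} → Prop) : Prop :=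
  ∃ F : Ordinal.{u} → Ordinal.{u}, (∀ j < κ.ord, F j < κ.ord) ∧
    ∀ i < κ.ord, IsSuccLimit i → (∀ j < i, F j < i) → p i

namespace Club

variable {κ : Cardinal.{u}} {p q : Ordinal.{u} → Prop}

theorem mono (hp : Club κ p) (h : ∀ i < κ.ord, IsSuccLimit i → p i → q i) : Club κ q := by
  obtain ⟨F, h1, h2⟩ := hp
  exact ⟨F, h1, fun i hi hl hF => h i hi hl (h2 i hi hl hF)⟩

theorem and (hp : Club κ p) (hq : Club κ q) : Club κ fun i => p i ∧ q i := by
  obtain ⟨F, h1, h2⟩ := hp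
  obtain ⟨G, h3, h4⟩ := hq
  refine ⟨fun j => max (F j) (G j), fun j hj => max_lt (h1 j hj) (h3 j hj), fun i hi hl h => ?_⟩
  exact ⟨h2 i hi hl fun j hj => (le_max_left _ _).trans_lt (h j hj),
    h4 i hi hl fun j hj => (le_max_right _ _).trans_lt (h j hj)⟩

theorem of_forall (h : ∀ i < κ.ord, IsSuccLimit i → p i) : Club κ p :=
  ⟨id, fun _ h => h, fun i hi hl _ => h i hi hl⟩

/-- A Skolem function for `R` is the closing function. Most clubs below are obtained in this way. -/
theorem of_exists {R : Ordinal.{u} → Ordinal.{u} → Prop}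
    (h : ∀ j < κ.ord, ∃ k < κ.ord, R j k) : Club κ fun i => ∀ j < i, ∃ k < i, R j k := by
  choose! F hF using h
  exact ⟨F, fun j hj => (hF j hj).1, fun i hi _ h j hj => ⟨F j, h j hj, (hF j (hj.trans hi)).2⟩⟩

theorem gt {a : Ordinal.{u}} (ha : a < κ.ord) : Club κ fun i => a < i :=
  ⟨fun _ => a, fun _ _ => ha, fun _ _ hl h => h 0 hl.bot_lt⟩

theorem diag (hκ : κ.IsRegular) {p : Ordinal.{u} → Ordinal.{u} → Prop}
    (h : ∀ j < κ.ord, Club κ (p j)) : Club κ fun i => ∀ j < i, p j i := by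
  choose! F h1 h2 using h
  -- One function that dominates all `F j l` with j, l ≤ m closes i under every `F j` with j < i.
  have key : ∀ m < κ.ord, ∃ b < κ.ord, ∀ j ≤ m, ∀ l ≤ m, F j l < b := by
    intro m hm
    have hsm : IsSmall κ (Iic m) := by
      have := isSmall_Iio ((Cardinal.isSuccLimit_ord hκ.aleph0_le).succ_lt hm)
      exact this.mono fun x hx => mem_Iio.2 (Order.lt_succ_iff.2 hx)
    have h3 : ∀ j ≤ m, ∃ b < κ.ord, ∀ l ≤ m, F j l < b := fun j hj =>
      hsm.exists_bound hκ (F j) fun l hl => h1 j (hj.trans_lt hm) l (lt_of_le_of_lt hl hm)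
    choose! b hb hb' using h3
    obtain ⟨c, hc, hc'⟩ := hsm.exists_bound hκ b fun j hj => hb j hj
    exact ⟨c, hc, fun j hj l hl => (hb' j hj l hl).trans (hc' j hj)⟩
  choose! G hG hG' using key
  refine ⟨G, hG, fun i hi hl h j hj => h2 j (hj.trans hi) i hi hl fun l hlt => ?_⟩
  have hm : max j l < i := max_lt hj hlt
  exact (hG' (max j l) (hm.trans hi) j (le_max_left _ _) l (le_max_right _ _)).trans (h _ hm)

theorem exists_of_isStationary (hκ : κ.IsRegular) (hω : ℵ₀ < κ) {S : Set (Iio κ.ord)}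
    (hS : IsStationary S) (hp : Club κ p) : ∃ i ∈ S, IsSuccLimit (i : Ordinal.{u}) ∧ p i := by
  obtain ⟨F, h1, h2⟩ := hp
  have hlim := Cardinal.isSuccLimit_ord hκ.aleph0_le
  have key : ∀ m < κ.ord, ∃ b < κ.ord, m < b ∧ ∀ j ≤ m, F j < b := by
    intro m hm
    have hsm : IsSmall κ (Iic m) :=
      (isSmall_Iio (hlim.succ_lt hm)).mono fun x hx => mem_Iio.2 (Order.lt_succ_iff.2 hx)
    obtain ⟨c, hc, hc'⟩ := hsm.exists_bound hκ F fun j hj => h1 j (lt_of_le_of_lt hj hm)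
    exact ⟨max c (Order.succ m), max_lt hc (hlim.succ_lt hm),
      (Order.lt_succ m).trans_le (le_max_right _ _), fun j hj => (hc' j hj).trans_le (le_max_left _ _)⟩
  choose! G hG hG1 hG2 using key
  have hclub : IsClub {i : Iio κ.ord | IsSuccLimit (i : Ordinal.{u}) ∧ ∀ j < i.1, F j < i} := by
    constructor
    · intro t ht hne _ x hx
      obtain ⟨i0, hi0⟩ := hne
      have hlt : ∀ j < (x : Ordinal), ∃ i ∈ t, j < (i : Ordinal) ∧ i ≤ x := by
        intro j hj
        have hj' : j < κ.ord := hj.trans x.2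
        obtain ⟨i, hi, hi', hi''⟩ := hx.exists_between (b := ⟨j, hj'⟩) hj
        exact ⟨i, hi, hi', hi''⟩
      refine ⟨⟨?_, Order.isSuccPrelimit_of_succ_lt fun j hj => ?_⟩, fun j hj => ?_⟩
      · intro hmin
        have h0 : (i0 : Ordinal) ≤ x := hx.1 hi0
        have := (ht hi0).1.bot_lt.trans_le h0
        exact hmin.not_lt this
      · obtain ⟨i, hi, hi', hi''⟩ := hlt j hj
        exact ((ht hi).1.succ_lt hi').trans_le hi''
      · obtain ⟨i, hi, hi', hi''⟩ := hlt j hj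
        exact ((ht hi).2 j hi').trans_le hi''
    · intro a
      -- Closed limit ordinals are unbounded: ω iterations of `G` stay below κ because κ is regular
      -- and uncountable.
      have hlt : Ordinal.nfp G a < κ.ord :=
        Cardinal.nfp_lt_ord_of_isRegular hκ hω.ne' (fun i hi => hG i hi) a.2
      have hit : ∀ n, G^[n] a < κ.ord := fun n => (Ordinal.iterate_le_nfp G a n).trans_lt hlt
      have hs : ∀ n, G^[n] a < G^[n+1] a := fun n => by
        rw [Function.iterate_succ_apply']; exact hG1 _ (hit n)
      have hle : (a : Ordinal) < Ordinal.nfp G a :=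
        (hs 0).trans_le (Ordinal.iterate_le_nfp G a 1)
      refine ⟨⟨_, hlt⟩, ⟨⟨?_, Order.isSuccPrelimit_of_succ_lt fun j hj => ?_⟩, fun j hj => ?_⟩, hle.le⟩
      · exact fun hmin => hmin.not_lt hle
      · obtain ⟨n, hn⟩ := Ordinal.lt_nfp_iff.1 hj
        exact (Order.succ_le_of_lt hn).trans_lt
          ((hs n).trans_le (Ordinal.iterate_le_nfp G a (n+1)))
      · obtain ⟨n, hn⟩ := Ordinal.lt_nfp_iff.1 hj
        have := hG2 _ (hit n) j hn.le
        rw [← Function.iterate_succ_apply' G] at this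
        exact this.trans_le (Ordinal.iterate_le_nfp G a (n+1))
  obtain ⟨i, hi, hi1, hi2⟩ := hS hclub
  exact ⟨i, hi, hi1, h2 i i.2 hi1 hi2⟩

end Club

/-! ### Recursive choice and least upper bounds. -/

/-- Recursive choice along the ordinals. -/
theorem exists_ordinal_sequence {X : Type v} [Nonempty X] (θ : Ordinal.{u})
    (R : Ordinal.{u} → (Ordinal.{u} → X) → X → Prop)
    (hR : ∀ l < θ, ∀ s s' x, (∀ m < l, s m = s' m) → R l s x → R l s' x)
    (step : ∀ l < θ, ∀ s : Ordinal.{u} → X, (∀ m < l, R m s (s m)) → ∃ x, R l s x) :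
    ∃ s : Ordinal.{u} → X, ∀ l < θ, R l s (s l) := by
  classical
  -- The sequence built so far is continued by an arbitrary value; by `hR` the relation at l does
  -- not see the difference.
  let G : (l : Ordinal.{u}) → ((m : Ordinal.{u}) → m < l → X) → X := fun l f =>
    Classical.epsilon (R l fun m => if h : m < l then f m h else Classical.arbitrary X)
  let s : Ordinal.{u} → X := WellFounded.fix (r := (· < ·)) (C := fun _ => X) Ordinal.lt_wf G
  have hs : ∀ l, s l = Classical.epsilon
      (R l fun m => if m < l then s m else Classical.arbitrary X) := by
    intro l
    change WellFounded.fix _ _ l = _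
    rw [WellFounded.fix_eq]
    simp only [G, dite_eq_ite]
    rfl
  refine ⟨s, fun l => ?_⟩
  induction l using WellFoundedLT.induction with
  | ind l ih =>
    intro hl
    obtain ⟨x, hx⟩ := step l hl s fun m hm => ih m hm (hm.trans hl)
    have h1 : ∃ x, R l (fun m => if m < l then s m else Classical.arbitrary X) x :=
      ⟨x, hR l hl s _ x (fun m hm => by simp [hm]) hx⟩
    have h2 := Classical.epsilon_spec h1
    rw [← hs] at h2
    exact hR l hl _ _ _ (fun m hm => by simp [hm]) h2

/-- A least upper bound of `S`, if there is one. -/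
noncomputable def lub {P : Type v} [PartialOrder P] [Nonempty P] (S : Set P) : P :=
  Classical.epsilon (IsLUB S)

theorem lub_eq {P : Type v} [PartialOrder P] [Nonempty P] {S : Set P} {q : P} (h : IsLUB S q) :
    lub S = q :=
  (Classical.epsilon_spec (p := IsLUB S) ⟨q, h⟩).unique h

/-! ### Calculus of restrictions and least upper bounds in a uniform order. -/

namespace Coding

universe w

variable {κ : Cardinal.{u}} {P : Type v} [PartialOrder P]

open Classical in
/-- The restriction `p ↾ α`. -/
noncomputable def restr (C : Coding κ P) (p : P) (α : Ordinal.{u}) : P :=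
  -- For α ≥ κ⁺ the whole domain lies below α, so the default p is the correct restriction.
  if h : α < (succ κ).ord ∧ ∃ q, C.IsRestr p α q then h.2.choose else p

variable {C : Coding κ P}

theorem dom_lt {p : P} {ξ : Ordinal.{u}} (h : ξ ∈ C.dom p) : ξ < (succ κ).ord :=
  (C.dom_mem p).1 h

theorem isSmall_dom (p : P) : IsSmall κ (C.dom p) := isSmall_ordinal.2 (C.dom_mem p).2

theorem exists_dom_bound (hκ : ℵ₀ ≤ κ) (p : P) : ∃ θ < (succ κ).ord, C.dom p ⊆ Iio θ :=
  (isSmall_dom p).succ.exists_bound (Cardinal.isRegular_succ hκ) id fun _ h => dom_lt h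

namespace IsUniform

variable (hC : C.IsUniform)

include hC

/-- A maximal candidate is in fact greatest: interpolating below p between it and any r ≤ p with
domain below α gives a condition of the same domain, to which maximality applies. -/
theorem restr_aux (p : P) (α : Ordinal.{u}) :
    C.restr p α ≤ p ∧ C.dom (C.restr p α) = C.dom p ∩ Iio α ∧
      ∀ r ≤ p, C.dom r ⊆ Iio α → r ≤ C.restr p α := by
  by_cases hα : α < (succ κ).ord
  · have h : α < (succ κ).ord ∧ ∃ q, C.IsRestr p α q := ⟨hα, (hC.restr p α hα).exists⟩
    have h1 : C.IsRestr p α (C.restr p α) := by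
      rw [Coding.restr, dif_pos h]; exact h.2.choose_spec
    refine ⟨h1.1.1, h1.1.2, fun r hr hd => ?_⟩
    obtain ⟨r', h2, h3, h4, h5⟩ := hC.interpolation _ _ _ hr h1.1.1
    have h6 : C.dom r' = C.dom p ∩ Iio α := by
      rw [h5, h1.1.2, union_eq_right]
      exact subset_inter (hC.dom_mono _ _ hr) hd
    exact h2.trans (h1.2 ⟨h4, h6⟩ h3)
  · have h1 : C.restr p α = p := by
      rw [Coding.restr, dif_neg (fun h => hα h.1)]
    rw [h1]
    refine ⟨le_rfl, ?_, fun r hr _ => hr⟩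
    exact (inter_eq_left.2 fun ξ hξ => (dom_lt hξ).trans_le (not_lt.1 hα)).symm

theorem restr_le (p : P) (α : Ordinal.{u}) : C.restr p α ≤ p := (hC.restr_aux p α).1

theorem dom_restr (p : P) (α : Ordinal.{u}) : C.dom (C.restr p α) = C.dom p ∩ Iio α :=
  (hC.restr_aux p α).2.1

theorem dom_restr_subset (p : P) (α : Ordinal.{u}) : C.dom (C.restr p α) ⊆ Iio α := by
  rw [hC.dom_restr]; exact inter_subset_right

theorem le_restr_iff {p r : P} {α : Ordinal.{u}} :
    r ≤ C.restr p α ↔ r ≤ p ∧ C.dom r ⊆ Iio α :=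
  ⟨fun h => ⟨h.trans (hC.restr_le p α), (hC.dom_mono _ _ h).trans (hC.dom_restr_subset p α)⟩,
    fun h => (hC.restr_aux p α).2.2 r h.1 h.2⟩

theorem restr_mono {p q : P} {α : Ordinal.{u}} (h : p ≤ q) : C.restr p α ≤ C.restr q α :=
  hC.le_restr_iff.2 ⟨(hC.restr_le p α).trans h, hC.dom_restr_subset p α⟩

theorem restr_eq_self {p : P} {α : Ordinal.{u}} (h : C.dom p ⊆ Iio α) : C.restr p α = p :=
  le_antisymm (hC.restr_le p α) (hC.le_restr_iff.2 ⟨le_rfl, h⟩)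

theorem restr_restr {p : P} {α β : Ordinal.{u}} (h : β ≤ α) :
    C.restr (C.restr p α) β = C.restr p β :=
  le_antisymm (hC.restr_mono (hC.restr_le p α)) (hC.le_restr_iff.2 ⟨hC.le_restr_iff.2
    ⟨hC.restr_le _ _, (hC.dom_restr_subset p β).trans (Iio_subset_Iio h)⟩,
      hC.dom_restr_subset p β⟩)

theorem restr_le_restr {p : P} {α β : Ordinal.{u}} (h : β ≤ α) : C.restr p β ≤ C.restr p α :=
  hC.le_restr_iff.2 ⟨hC.restr_le _ _, (hC.dom_restr_subset p β).trans (Iio_subset_Iio h)⟩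

theorem isRestr_iff {p q : P} {α : Ordinal.{u}} (hα : α < (succ κ).ord) :
    C.IsRestr p α q ↔ q = C.restr p α := by
  have h1 : C.IsRestr p α (C.restr p α) := by
    refine ⟨⟨hC.restr_le p α, hC.dom_restr p α⟩, fun r hr _ => hC.le_restr_iff.2 ⟨hr.1, ?_⟩⟩
    rw [hr.2]; exact inter_subset_right
  exact ⟨fun h => (hC.restr p α hα).unique h h1, fun h => h ▸ h1⟩

/-- A condition is determined by its restrictions to a cofinal set of ordinals. -/
theorem le_of_restr_le {p s : P} {B : Set Ordinal.{u}} {θ : Ordinal.{u}} (hne : B.Nonempty)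
    (hθ : θ < (succ κ).ord) (hB : ∀ β ∈ B, β ≤ θ)
    (hd : ∀ ξ ∈ C.dom p, ∃ β ∈ B, ξ < β) (h : ∀ β ∈ B, C.restr p β ≤ s) : p ≤ s := by
  have hbdd : BddAbove B := ⟨θ, hB⟩
  have hlub : IsLUB B (sSup B) := isLUB_csSup hne hbdd
  have hle : sSup B ≤ θ := csSup_le hne hB
  have hp : C.dom p ⊆ Iio (sSup B) := fun ξ hξ => by
    obtain ⟨β, hβ, h1⟩ := hd ξ hξ
    exact h1.trans_le (hlub.1 hβ)
  -- If the supremum is attained, one of the restrictions is p itself. Otherwise it is a limit, and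
  -- p is the least upper bound of its restrictions below it.
  by_cases hmem : sSup B ∈ B
  · rw [← hC.restr_eq_self hp]; exact h _ hmem
  · have hlt : ∀ β < sSup B, ∃ b ∈ B, β < b := fun β hβ => by
      obtain ⟨b, hb, h1, _⟩ := hlub.exists_between hβ
      exact ⟨b, hb, h1⟩
    have hlim : IsSuccLimit (sSup B) := by
      refine ⟨fun hmin => ?_, Order.isSuccPrelimit_of_succ_lt fun j hj => ?_⟩
      · obtain ⟨b, hb⟩ := hne
        have : b = sSup B := le_antisymm (hlub.1 hb) (hmin (hlub.1 hb))
        exact hmem (this ▸ hb)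
      · obtain ⟨b, hb, h1⟩ := hlt j hj
        refine (Order.succ_le_of_lt h1).trans_lt (lt_of_le_of_ne (hlub.1 hb) ?_)
        rintro rfl; exact hmem hb
    have h2 := hC.restr_limit p (sSup B) (hle.trans_lt hθ) hlim p
      ((hC.isRestr_iff (hle.trans_lt hθ)).2 (hC.restr_eq_self hp).symm)
    refine h2.2 ?_
    rintro r ⟨α, hα, hr⟩
    rw [hC.isRestr_iff (hα.trans (hle.trans_lt hθ))] at hr
    obtain ⟨b, hb, h1⟩ := hlt α hα
    rw [hr]
    exact (hC.restr_le_restr h1.le).trans (h b hb)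

/-- The domain hypothesis of amalgamation is automatic when dom q lies below α, and interpolation
trims the domain of the common bound. -/
theorem amalgam {p q : P} {α : Ordinal.{u}} (hα : α < (succ κ).ord) (h : C.restr p α ≤ q)
    (hq : C.dom q ⊆ Iio α) : ∃ r, p ≤ r ∧ q ≤ r ∧ C.dom r = C.dom p ∪ C.dom q := by
  obtain ⟨r, hpr, hqr⟩ := hC.amalgamation p q α hα _ ((hC.isRestr_iff hα).2 rfl) h (by
    apply Subset.antisymm
    · exact fun ξ hξ => ⟨hξ.1, hq hξ.2⟩
    · rw [← hC.dom_restr]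
      exact subset_inter (hC.dom_mono _ _ (hC.restr_le p α)) (hC.dom_mono _ _ h))
  obtain ⟨r', h1, h2, _, h3⟩ := hC.interpolation p q r hpr hqr
  exact ⟨r', h1, h2, h3⟩

/-- Completeness and its compatibility with restriction, reindexed from ordinals below κ to any
small well-ordered index type. -/
theorem exists_isLUB {ι : Type w} [LinearOrder ι] [WellFoundedLT ι]
    (hι : Cardinal.lift.{u} #ι < Cardinal.lift.{w} κ) {p : ι → P} (hp : Monotone p) :
    ∃ q, IsLUB (range p) q ∧ C.dom q = (⋃ i, C.dom (p i)) ∧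
      ∀ α, IsLUB (range fun i => C.restr (p i) α) (C.restr q α) := by
  have h1 : Ordinal.lift.{u} (typeLT ι) < Ordinal.lift.{w} κ.ord := by
    rw [Cardinal.lift_ord, Cardinal.lt_ord, ← Ordinal.lift_card, Ordinal.card_type]
    exact hι
  obtain ⟨δ, hδ, h2⟩ := Ordinal.lt_lift_iff.1 h1
  have h3 : Ordinal.lift.{max w u} (typeLT δ.ToType) = Ordinal.lift.{max u u} (typeLT ι) := by
    rw [Ordinal.type_toType]
    exact (congrFun Ordinal.lift_umax δ).trans h2
  obtain ⟨e0⟩ := Ordinal.lift_type_eq.{u, w, u}.1 h3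
  let e : Iio δ ≃o ι := (Ordinal.ToType.mk (o := δ)).trans (OrderIso.ofRelIsoLT e0)
  have hmono : Monotone (p ∘ e) := hp.comp e.monotone
  obtain ⟨q, hq, hd⟩ := hC.complete δ hδ (p ∘ e) hmono
  have hr : ∀ {β : Type v} (f : ι → β), range (f ∘ e) = range f := fun f => e.surjective.range_comp f
  refine ⟨q, by rwa [hr] at hq, ?_, fun α => ?_⟩
  · rw [hd]
    exact e.surjective.iUnion_comp fun i => C.dom (p i)
  · by_cases hα : α < (succ κ).ord
    · have h4 := hC.restr_lub δ hδ (p ∘ e) hmono q hq α hα _ ((hC.isRestr_iff hα).2 rfl)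
      convert h4 using 1
      ext s
      simp only [mem_range, mem_ofPred_eq, hC.isRestr_iff hα]
      constructor
      · rintro ⟨i, rfl⟩; exact ⟨e.symm i, by simp⟩
      · rintro ⟨i, rfl⟩; exact ⟨e i, rfl⟩
    · have h5 : ∀ x : P, C.restr x α = x := fun x =>
        hC.restr_eq_self fun ξ hξ => (dom_lt hξ).trans_le (not_lt.1 hα)
      simp only [h5]
      rwa [hr] at hq

theorem exists_isLUB_on {B : Set Ordinal.{u}} (hB : IsSmall κ B) {p : Ordinal.{u} → P}
    (hp : MonotoneOn p B) :
    ∃ q, IsLUB (p '' B) q ∧ C.dom q = (⋃ b ∈ B, C.dom (p b)) ∧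
      ∀ α, IsLUB ((fun b => C.restr (p b) α) '' B) (C.restr q α) := by
  obtain ⟨q, h1, h2, h3⟩ := hC.exists_isLUB (ι := B) hB (p := fun b => p b)
    fun a b hab => hp a.2 b.2 hab
  refine ⟨q, by rwa [image_eq_range], by rw [h2, biUnion_eq_iUnion], fun α => ?_⟩
  rw [image_eq_range]; exact h3 α

theorem exists_isLUB_nat (hω : ℵ₀ < κ) {p : ℕ → P} (hp : Monotone p) :
    ∃ q, IsLUB (range p) q ∧ C.dom q = (⋃ i, C.dom (p i)) ∧
      ∀ α, IsLUB (range fun i => C.restr (p i) α) (C.restr q α) :=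
  hC.exists_isLUB (by simpa using hω) hp

/-- The least upper bound of the empty sequence. -/
theorem exists_bot (hκ : 0 < κ) : ∃ b : P, C.dom b = ∅ ∧ ∀ p, b ≤ p := by
  obtain ⟨q, h1, h2⟩ := hC.complete 0 (by simpa using hκ) (fun i => absurd i.2 (by simp))
    (fun i => absurd i.2 (by simp))
  refine ⟨q, ?_, fun p => h1.2 ?_⟩
  · rw [h2]; ext ξ; simp
  · rintro _ ⟨i, _⟩; exact absurd i.2 (by simp)

end IsUniform

end Coding

/-! ### Transport of conditions along order isomorphisms. -/

/-- A strictly increasing map of the ordinals that maps `κ⁺` to itself. -/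
structure IsShift (κ : Cardinal.{u}) (h : Ordinal.{u} → Ordinal.{u}) : Prop where
  strictMono : StrictMono h
  map_lt : ∀ ξ < (succ κ).ord, h ξ < (succ κ).ord

namespace Coding

universe w

variable {κ : Cardinal.{u}} {P : Type v} [PartialOrder P]

open Classical in
/-- The condition `h[p]`. -/
noncomputable def map (C : Coding κ P) (h : Ordinal.{u} → Ordinal.{u}) (p : P) : P :=
  if H : ∃ p', C.IsImage h p p' then H.choose else p

variable {C : Coding κ P}

theorem IsImage.unique {h : Ordinal.{u} → Ordinal.{u}} {p a b : P} (ha : C.IsImage h p a)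
    (hb : C.IsImage h p b) : a = b :=
  C.inj _ _ (ha.1.trans hb.1.symm) (ha.2.trans hb.2.symm)

namespace IsUniform

variable (hC : C.IsUniform)

include hC

/-- Interpolation for small sets of conditions. -/
theorem interpolation_small (hκ : κ.IsRegular) {X : Set P} (hX : IsSmall κ X) {y : P}
    (hy : y ∈ upperBounds X) : ∃ x ≤ y, x ∈ upperBounds X ∧ C.dom x = ⋃ p ∈ X, C.dom p := by
  have : Nonempty P := ⟨y⟩
  obtain ⟨b, hb, hb'⟩ := hC.exists_bot hκ.pos
  obtain ⟨θ, hθ, e, he⟩ := hX.exists_enum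
  -- The members of `X` are absorbed one at a time by binary interpolation below y; at limits, least
  -- upper bounds stay below y and add nothing to the domain.
  have key : ∀ l ≤ θ, ∀ s : Ordinal.{u} → P, (∀ m < l, (∀ n < m, s n ≤ s m) ∧ s m ≤ y ∧
      C.dom (s m) ⊆ ⋃ p ∈ X, C.dom p) → ∃ x ≤ y, (∀ m < l, s m ≤ x) ∧
      C.dom x ⊆ ⋃ p ∈ X, C.dom p := by
    intro l hl s hs
    have hmono : MonotoneOn s (Iio l) := fun m _ n hn hmn => by
      rcases hmn.eq_or_lt with rfl | h
      · exact le_rfl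
      · exact (hs n hn).1 m h
    obtain ⟨q, hq, hd, _⟩ := hC.exists_isLUB_on (isSmall_Iio (hl.trans_lt hθ)) hmono
    refine ⟨q, hq.2 ?_, fun m hm => hq.1 ⟨m, hm, rfl⟩, ?_⟩
    · rintro _ ⟨m, hm, rfl⟩; exact (hs m hm).2.1
    · rw [hd]; exact iUnion₂_subset fun m hm => (hs m hm).2.2
  obtain ⟨s, hs⟩ := exists_ordinal_sequence θ (fun l (s : Ordinal.{u} → P) x =>
      (∀ n < l, s n ≤ x) ∧ x ≤ y ∧ C.dom x ⊆ (⋃ p ∈ X, C.dom p) ∧ (e l ∈ X → e l ≤ x))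
    (by
      rintro l - s s' x h ⟨h1, h2⟩
      exact ⟨fun n hn => h n hn ▸ h1 n hn, h2⟩)
    (by
      intro l hl s hs
      obtain ⟨q, hq1, hq2, hq3⟩ := key l hl.le s fun m hm =>
        ⟨(hs m hm).1, (hs m hm).2.1, (hs m hm).2.2.1⟩
      by_cases hel : e l ∈ X
      · obtain ⟨r, h1, h2, h3, h4⟩ := hC.interpolation q (e l) y hq1 (hy hel)
        refine ⟨r, fun n hn => (hq2 n hn).trans h1, h3, ?_, fun _ => h2⟩
        rw [h4]
        exact union_subset hq3 (subset_biUnion_of_mem (u := fun p => C.dom p) hel)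
      · exact ⟨q, hq2, hq1, hq3, fun h => absurd h hel⟩)
  obtain ⟨q, hq1, hq2, hq3⟩ := key θ le_rfl s fun m hm =>
    ⟨(hs m hm).1, (hs m hm).2.1, (hs m hm).2.2.1⟩
  have hub : q ∈ upperBounds X := fun p hp => by
    obtain ⟨l, hl, rfl⟩ := he hp
    exact ((hs l hl).2.2.2 hp).trans (hq2 l hl)
  exact ⟨q, hq1, hub, hq3.antisymm (iUnion₂_subset fun p hp => hC.dom_mono _ _ (hub hp))⟩

variable {h h' : Ordinal.{u} → Ordinal.{u}} (hh : IsShift κ h) (hh' : IsShift κ h')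

section

include hh

theorem isImage_map (p : P) : C.IsImage h p (C.map h p) := by
  have H : ∃ p', C.IsImage h p p' := (hC.indiscernible p h (hh.strictMono.strictMonoOn _) (by
    rintro _ ⟨ξ, hξ, rfl⟩; exact hh.map_lt ξ (dom_lt hξ))).1
  rw [map, dif_pos H]
  exact H.choose_spec

theorem code_map (p : P) : C.code (C.map h p) = C.code p := (hC.isImage_map hh p).1

theorem dom_map (p : P) : C.dom (C.map h p) = h '' C.dom p := (hC.isImage_map hh p).2

theorem map_eq {p p' : P} (H : C.IsImage h p p') : C.map h p = p' :=
  (hC.isImage_map hh p).unique H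

theorem map_mono {p q : P} (hpq : p ≤ q) : C.map h p ≤ C.map h q :=
  (hC.indiscernible q h (hh.strictMono.strictMonoOn _) (by
    rintro _ ⟨ξ, hξ, rfl⟩; exact hh.map_lt ξ (dom_lt hξ))).2 p hpq _ _
    (hC.isImage_map hh q) (hC.isImage_map hh p)

theorem isImage_inv (p : P) : C.IsImage (Function.invFun h) (C.map h p) p := by
  refine ⟨(hC.code_map hh p).symm, ?_⟩
  rw [hC.dom_map hh, image_image]
  simp [Function.leftInverse_invFun hh.strictMono.injective _]

theorem inv_strictMonoOn {s : Set Ordinal.{u}} (hs : s ⊆ range h) :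
    StrictMonoOn (Function.invFun h) s := by
  intro a ha b hb hab
  obtain ⟨x, rfl⟩ := hs ha
  obtain ⟨y, rfl⟩ := hs hb
  rw [Function.leftInverse_invFun hh.strictMono.injective,
    Function.leftInverse_invFun hh.strictMono.injective]
  exact hh.strictMono.lt_iff_lt.1 hab

theorem inv_image_subset {q : P} (hs : C.dom q ⊆ range h) :
    Function.invFun h '' C.dom q ⊆ Iio (succ κ).ord := by
  rintro _ ⟨ξ, hξ, rfl⟩
  obtain ⟨x, rfl⟩ := hs hξ
  rw [Function.leftInverse_invFun hh.strictMono.injective]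
  exact (hh.strictMono.le_apply).trans_lt (dom_lt hξ)

/-- The converse direction is indiscernibility for the inverse of h, which is increasing on the
image of the domain. -/
theorem map_le_map_iff {p q : P} : C.map h p ≤ C.map h q ↔ p ≤ q := by
  refine ⟨fun H => ?_, hC.map_mono hh⟩
  have hr : C.dom (C.map h q) ⊆ range h := by
    rw [hC.dom_map hh]; exact image_subset_range _ _
  exact (hC.indiscernible _ _ (hC.inv_strictMonoOn hh hr) (hC.inv_image_subset hh hr)).2 _ H _ _
    (hC.isImage_inv hh q) (hC.isImage_inv hh p)

theorem map_injective : Function.Injective (C.map h) := fun _ _ H =>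
  le_antisymm ((hC.map_le_map_iff hh).1 H.le) ((hC.map_le_map_iff hh).1 H.ge)

theorem exists_map_eq {q : P} (hq : C.dom q ⊆ range h) : ∃ p, C.map h p = q := by
  obtain ⟨⟨p, hp⟩, _⟩ :=
    hC.indiscernible _ _ (hC.inv_strictMonoOn hh hq) (hC.inv_image_subset hh hq)
  refine ⟨p, hC.map_eq hh ⟨hp.1.symm, ?_⟩⟩
  rw [hp.2, image_image]
  conv_lhs => rw [← image_id (C.dom q)]
  apply image_congr
  intro ξ hξ
  exact (Function.invFun_eq (hq hξ)).symm

/-- Only the points of dom p have to respect the cut, so γ' may lie outside the range of h. -/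
theorem map_restr {p : P} {γ γ' : Ordinal.{u}} (H : ∀ ξ ∈ C.dom p, ξ < γ ↔ h ξ < γ') :
    C.map h (C.restr p γ) = C.restr (C.map h p) γ' := by
  apply le_antisymm
  · refine hC.le_restr_iff.2 ⟨hC.map_mono hh (hC.restr_le _ _), ?_⟩
    rw [hC.dom_map hh, hC.dom_restr]
    rintro _ ⟨ξ, hξ, rfl⟩
    exact (H ξ hξ.1).1 hξ.2
  · have hr : C.dom (C.restr (C.map h p) γ') ⊆ range h := by
      rw [hC.dom_restr, hC.dom_map hh]; exact inter_subset_left.trans (image_subset_range _ _)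
    obtain ⟨x, hx⟩ := hC.exists_map_eq hh hr
    rw [← hx]
    have hxp : x ≤ p := (hC.map_le_map_iff hh).1 (hx.le.trans (hC.restr_le _ _))
    refine hC.map_mono hh (hC.le_restr_iff.2 ⟨hxp, fun ξ hξ => ?_⟩)
    refine (H ξ (hC.dom_mono _ _ hxp hξ)).2 ?_
    have : h ξ ∈ C.dom (C.restr (C.map h p) γ') := by
      rw [← hx, hC.dom_map hh]; exact mem_image_of_mem _ hξ
    exact hC.dom_restr_subset _ _ this

/-- The least upper bound of the images has its domain inside the range of h, so it pulls back to an
upper bound of the original sequence. -/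
theorem map_isLUB {ι : Type w} [LinearOrder ι] [WellFoundedLT ι]
    (hι : Cardinal.lift.{u} #ι < Cardinal.lift.{w} κ) {p : ι → P} (hp : Monotone p) {q : P}
    (hq : IsLUB (range p) q) : IsLUB (range fun i => C.map h (p i)) (C.map h q) := by
  obtain ⟨y, hy, hd, _⟩ := hC.exists_isLUB hι (p := fun i => C.map h (p i))
    fun a b hab => hC.map_mono hh (hp hab)
  have hr : C.dom y ⊆ range h := by
    rw [hd]
    refine iUnion_subset fun i => ?_
    rw [hC.dom_map hh]; exact image_subset_range _ _
  obtain ⟨x, rfl⟩ := hC.exists_map_eq hh hr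
  have hqx : q ≤ x := hq.2 (by
    rintro _ ⟨i, rfl⟩
    exact (hC.map_le_map_iff hh).1 (hy.1 ⟨i, rfl⟩))
  have hxq : C.map h x ≤ C.map h q := hy.2 (by
    rintro _ ⟨i, rfl⟩
    exact hC.map_mono hh (hq.1 ⟨i, rfl⟩))
  rwa [le_antisymm hxq (hC.map_mono hh hqx)] at hy

theorem map_isLUB_on {B : Set Ordinal.{u}} (hB : IsSmall κ B) {p : Ordinal.{u} → P}
    (hp : MonotoneOn p B) {q : P} (hq : IsLUB (p '' B) q) :
    IsLUB ((fun b => C.map h (p b)) '' B) (C.map h q) := by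
  have := hC.map_isLUB hh (ι := B) hB (p := fun b => p b) (fun a b hab => hp a.2 b.2 hab) (q := q)
    (by rwa [← image_eq_range])
  rwa [image_eq_range]

end

include hh hh'

theorem map_congr {p : P} (H : ∀ ξ ∈ C.dom p, h ξ = h' ξ) : C.map h p = C.map h' p :=
  hC.map_eq hh ⟨hC.code_map hh' p, (hC.dom_map hh' p).trans (image_congr fun ξ hξ => (H ξ hξ).symm)⟩

theorem isImage_map_map (p : P) : C.IsImage (h' ∘ Function.invFun h) (C.map h p) (C.map h' p) := by
  refine ⟨(hC.code_map hh' p).trans (hC.code_map hh p).symm, ?_⟩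
  rw [hC.dom_map hh, hC.dom_map hh', image_image]
  simp [Function.leftInverse_invFun hh.strictMono.injective _]

/-- Moves membership in a density system between two expansions of the same abstract data. The
isomorphism to which uniformity is applied is h' ∘ h⁻¹. -/
theorem mem_system_iff {α : Ordinal.{u}} {G : Set P} {D : SystemFun.{u, v} P}
    (hD : C.IsDensitySystem α G D) {w x : Set Ordinal.{u}}
    (hw : IsSmall κ w) (hwκ : w ⊆ Iio (succ κ).ord) (hx : x ⊆ w)
    (hα : h '' w ∩ Iio α = h' '' w ∩ Iio α) {p : P} (hp : C.map h p ∈ genericQuotient G)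
    (hd : C.dom p ⊆ w) :
    C.map h p ∈ D (h '' x) (h '' w) ↔ C.map h' p ∈ D (h' '' x) (h' '' w) := by
  have hmem : ∀ {g : Ordinal.{u} → Ordinal.{u}}, IsShift κ g →
      g '' w ∈ SmallSubsets κ (Iio (succ κ).ord) := fun {g} hg => by
    refine ⟨?_, isSmall_ordinal.1 (hw.image g)⟩
    rintro _ ⟨ξ, hξ, rfl⟩
    exact hg.map_lt ξ (hwκ hξ)
  have himg : ∀ y : Set Ordinal.{u}, (h' ∘ Function.invFun h) '' (h '' y) = h' '' y := fun y => by
    rw [image_image]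
    simp [Function.leftInverse_invFun hh.strictMono.injective _]
  refine hD.uniform _ (hmem hh) _ (image_mono hx) _ (hmem hh') _ (image_mono hx) hα
    (h' ∘ Function.invFun h) ?_ (himg w) (himg x) _ hp ?_ _ (hC.isImage_map_map hh hh' p)
  · exact hh'.strictMono.comp_strictMonoOn (hC.inv_strictMonoOn hh (image_subset_range _ _))
  · rw [hC.dom_map hh]; exact image_mono hd

end IsUniform

end Coding

/-! ### Enumerations of small sets of ordinals as total increasing maps. -/

/-- The increasing enumeration of `w` followed by the ordinals from `θ` on. -/
noncomputable def shift (w : Set Ordinal.{u}) (θ : Ordinal.{u}) : Ordinal.{u} → Ordinal.{u} :=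
  Ordinal.enumOrd (w ∪ Ici θ)

theorem not_bddAbove_union_Ici (w : Set Ordinal.{u}) (θ : Ordinal.{u}) :
    ¬ BddAbove (w ∪ Ici θ) := fun ⟨b, hb⟩ => by
  have : Order.succ (max b θ) ≤ b :=
    hb (Or.inr (mem_Ici.2 ((le_max_right _ _).trans (Order.le_succ _))))
  exact absurd ((Order.lt_succ _).trans_le this) (not_lt.2 (le_max_left _ _))

theorem shift_strictMono (w : Set Ordinal.{u}) (θ : Ordinal.{u}) : StrictMono (shift w θ) :=
  Ordinal.enumOrd_strictMono (not_bddAbove_union_Ici w θ)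

theorem range_shift (w : Set Ordinal.{u}) (θ : Ordinal.{u}) : range (shift w θ) = w ∪ Ici θ :=
  Ordinal.range_enumOrd (not_bddAbove_union_Ici w θ)

/-- The tail from θ on makes the enumeration total, and the bound θ + ξ on its values stays below
κ⁺, which is closed under addition. -/
theorem isShift_shift {κ : Cardinal.{u}} (hκ : ℵ₀ ≤ κ) (w : Set Ordinal.{u}) {θ : Ordinal.{u}}
    (hθ : θ < (succ κ).ord) : IsShift κ (shift w θ) := by
  refine ⟨shift_strictMono w θ, fun ξ hξ => ?_⟩
  have h1 : ∀ ξ, shift w θ ξ ≤ θ + ξ := by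
    intro ξ
    induction ξ using WellFoundedLT.induction with
    | ind ξ ih =>
      refine Ordinal.enumOrd_le_of_forall_lt (Or.inr (mem_Ici.2 (le_self_add))) fun b hb => ?_
      exact (ih b hb).trans_lt (by simpa using hb)
  exact (h1 ξ).trans_lt
    (Ordinal.isPrincipal_add_ord (hκ.trans (Order.le_succ κ)) hθ hξ)

/-- By induction, each value is the least member of its set above the earlier values, and below γ
the two sets have the same members. -/
theorem shift_eq_of_inter_eq {w w' : Set Ordinal.{u}} {θ θ' γ : Ordinal.{u}} (hθ : γ ≤ θ)
    (hθ' : γ ≤ θ') (h : w ∩ Iio γ = w' ∩ Iio γ) {ξ : Ordinal.{u}} (hξ : shift w θ ξ < γ) :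
    shift w' θ' ξ = shift w θ ξ := by
  have hmem : ∀ {v : Set Ordinal.{u}} {τ ξ : Ordinal.{u}}, γ ≤ τ → shift v τ ξ < γ →
      shift v τ ξ ∈ v ∩ Iio γ := fun {v τ ξ} hτ hlt => by
    have : shift v τ ξ ∈ v ∪ Ici τ := by rw [← range_shift]; exact mem_range_self _
    exact ⟨this.resolve_right fun h2 => absurd (hτ.trans h2) (not_le.2 hlt), hlt⟩
  induction ξ using WellFoundedLT.induction with
  | ind ξ ih =>
    have ih' : ∀ b < ξ, shift w' θ' b = shift w θ b := fun b hb =>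
      ih b hb ((shift_strictMono w θ hb).trans hξ)
    have h1 : shift w' θ' ξ ≤ shift w θ ξ := by
      refine Ordinal.enumOrd_le_of_forall_lt (Or.inl (h.subset (hmem hθ hξ)).1) fun b hb => ?_
      exact (ih' b hb).trans_lt (shift_strictMono w θ hb)
    refine h1.antisymm ?_
    refine Ordinal.enumOrd_le_of_forall_lt
      (Or.inl (h.superset (hmem hθ' (h1.trans_lt hξ))).1) fun b hb => ?_
    exact (ih' b hb).symm.trans_lt (shift_strictMono w' θ' hb)

/-- The position of `γ` in the enumeration `shift w θ`. -/
noncomputable def shiftPos (w : Set Ordinal.{u}) (θ γ : Ordinal.{u}) : Ordinal.{u} :=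
  sInf {ξ | γ ≤ shift w θ ξ}

theorem lt_shiftPos {w : Set Ordinal.{u}} {θ γ ξ : Ordinal.{u}} :
    ξ < shiftPos w θ γ ↔ shift w θ ξ < γ := by
  have hne : {ξ | γ ≤ shift w θ ξ}.Nonempty := ⟨γ, (shift_strictMono w θ).le_apply⟩
  constructor
  · intro h
    by_contra h2
    exact absurd (csInf_le' (show ξ ∈ {ξ | γ ≤ shift w θ ξ} from not_lt.1 h2)) (not_le.2 h)
  · intro h
    by_contra h2
    have h3 : γ ≤ shift w θ (shiftPos w θ γ) := csInf_mem hne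
    exact absurd (h3.trans ((shift_strictMono w θ).monotone (not_lt.1 h2))) (not_le.2 h)

theorem shift_shiftPos (w : Set Ordinal.{u}) (θ : Ordinal.{u}) :
    shift w θ (shiftPos w θ θ) = θ := by
  have : θ ∈ range (shift w θ) := by rw [range_shift]; exact Or.inr self_mem_Ici
  obtain ⟨ξ, hξ⟩ := this
  have h1 : ¬ ξ < shiftPos w θ θ := fun h => by
    have := lt_shiftPos.1 h; rw [hξ] at this; exact lt_irrefl _ this
  have h2 : shiftPos w θ θ ≤ ξ := not_lt.1 h1
  rcases h2.eq_or_lt with h | h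
  · rw [h, hξ]
  · have h3 := shift_strictMono w θ h
    rw [hξ] at h3
    exact absurd (lt_shiftPos.2 h3) (lt_irrefl _)

theorem shiftPos_eq_of_inter_eq {w w' : Set Ordinal.{u}} {θ θ' γ : Ordinal.{u}} (hθ : γ ≤ θ)
    (hθ' : γ ≤ θ') (h : w ∩ Iio γ = w' ∩ Iio γ) : shiftPos w θ γ = shiftPos w' θ' γ := by
  apply le_antisymm <;> refine le_of_forall_lt fun ξ hξ => ?_ <;> rw [lt_shiftPos] at hξ ⊢
  · rwa [shift_eq_of_inter_eq hθ hθ' h hξ]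
  · rwa [shift_eq_of_inter_eq hθ' hθ h.symm hξ]

theorem image_shift_Iio_shiftPos {w : Set Ordinal.{u}} {θ γ : Ordinal.{u}} (hγ : γ ≤ θ) :
    shift w θ '' Iio (shiftPos w θ γ) = w ∩ Iio γ := by
  ext ζ
  constructor
  · rintro ⟨ξ, hξ, rfl⟩
    have h1 := lt_shiftPos.1 hξ
    have : shift w θ ξ ∈ w ∪ Ici θ := by rw [← range_shift]; exact mem_range_self _
    exact ⟨this.resolve_right fun h2 => absurd (hγ.trans h2) (not_le.2 h1), h1⟩
  · rintro ⟨h1, h2⟩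
    have : ζ ∈ range (shift w θ) := by rw [range_shift]; exact Or.inl h1
    obtain ⟨ξ, rfl⟩ := this
    exact ⟨ξ, lt_shiftPos.2 h2, rfl⟩

theorem shiftPos_lt {κ : Cardinal.{u}} {w : Set Ordinal.{u}} {θ γ : Ordinal.{u}} (hγ : γ ≤ θ)
    (hw : IsSmall κ w) : shiftPos w θ γ < κ.ord := by
  have h1 : IsSmall κ (shift w θ '' Iio (shiftPos w θ γ)) := by
    rw [image_shift_Iio_shiftPos hγ]; exact hw.mono inter_subset_left
  rw [isSmall_ordinal, Cardinal.mk_image_eq (shift_strictMono w θ).injective,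
    Cardinal.mk_Iio_ordinal, Cardinal.lift_lt] at h1
  exact Cardinal.lt_ord.2 h1

/-! ### Coherent families of conditions on the branches of a tree. -/

namespace Coding

universe w

variable {κ : Cardinal.{u}} {P : Type v} [PartialOrder P] {C : Coding κ P}

/-- A set of conditions that behaves like the quotient of the forcing by a generic ideal
of `P_ζ`. -/
structure IsNice (C : Coding κ P) (ζ : Ordinal.{u}) (Q : Set P) : Prop where
  isLowerSet : IsLowerSet Q
  lub_mem : ∀ (ι : Type (u + 1)) [LinearOrder ι] [WellFoundedLT ι],
    Cardinal.lift.{u} #ι < Cardinal.lift.{u + 1} κ → ∀ p : ι → P, Monotone p → (∀ i, p i ∈ Q) →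
      ∀ q, IsLUB (range p) q → q ∈ Q
  amalgam : ∀ f ∈ Q, ∀ q ∈ Q, ∀ γ < (succ κ).ord, ζ ≤ γ → C.restr f γ ≤ q → C.dom q ⊆ Iio γ →
    ∃ r ∈ Q, f ≤ r ∧ q ≤ r ∧ C.dom r = C.dom f ∪ C.dom q

theorem IsNice.lub_mem_on {ζ : Ordinal.{u}} {Q : Set P} (hQ : C.IsNice ζ Q)
    {B : Set Ordinal.{u}} (hB : IsSmall κ B) {p : Ordinal.{u} → P} (hp : MonotoneOn p B)
    (hpQ : ∀ b ∈ B, p b ∈ Q) {q : P} (hq : IsLUB (p '' B) q) : q ∈ Q :=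
  hQ.lub_mem B hB (fun b => p b) (fun a b hab => hp a.2 b.2 hab) (fun b => hpQ b b.2) q
    (by rwa [← image_eq_range])

theorem IsNice.lub_mem_nat {ζ : Ordinal.{u}} {Q : Set P} (hQ : C.IsNice ζ Q) (hω : ℵ₀ < κ)
    {p : ℕ → P} (hp : Monotone p) (hpQ : ∀ n, p n ∈ Q) {q : P} (hq : IsLUB (range p) q) :
    q ∈ Q := by
  have hwf : WellFoundedLT (ULift.{u + 1} ℕ) :=
    ⟨InvImage.wf ULift.down wellFounded_lt⟩
  refine hQ.lub_mem (ULift.{u + 1} ℕ) (by simpa using hω) (fun b => p b.down)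
    (fun a b hab => hp hab) (fun b => hpQ b.down) q ?_
  convert hq using 1
  ext x
  simp

/-- Branches `a : I` through a tree. The branches `a` and `b` separate at `gap a b`, a coherent
family is required to agree below, and the conditions on the branch `a` have their domain
below `top a`. -/
structure Branching (κ : Cardinal.{u}) (ζ : Ordinal.{u}) (I : Type w) where
  gap : I → I → Ordinal.{u}
  node : I → Ordinal.{u}
  top : I → Ordinal.{u}
  symm : ∀ a b, gap a b = gap b a
  ultra : ∀ a b c, min (gap a b) (gap b c) ≤ gap a c
  gap_le : ∀ a b, gap a b ≤ node a
  le_gap : ∀ a b, ζ ≤ gap a b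
  node_le : ∀ a, node a ≤ top a
  top_lt : ∀ a, top a < (succ κ).ord

namespace Branching

variable {ζ : Ordinal.{u}} {I : Type w} (T : Branching κ ζ I) (C) (Q : Set P)

/-- The conditions on the branch `a`. -/
def conds (a : I) : Set P := {p | p ∈ Q ∧ C.dom p ⊆ Iio (T.top a)}

/-- `f` is coherent on the set `S` of branches. -/
def Coherent (f : I → P) (S : Set I) : Prop :=
  (∀ a ∈ S, f a ∈ T.conds C Q a) ∧
    ∀ a ∈ S, ∀ b ∈ S, C.restr (f a) (T.gap a b) = C.restr (f b) (T.gap a b)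

/-- Every coherent family on `S` can be extended to one that lies above a given condition on
another branch. -/
def Extendible (S : Set I) : Prop :=
  ∀ f, T.Coherent C Q f S → ∀ x ∉ S, ∀ r ∈ T.conds C Q x, (∀ s ∈ S, C.restr (f s) (T.gap s x) ≤ r) →
    ∃ f', T.Coherent C Q f' S ∧ (∀ s ∈ S, f s ≤ f' s) ∧ ∀ s ∈ S, C.restr r (T.gap s x) ≤ f' s

variable {T C Q} {S : Set I} {f : I → P} {x : I}

theorem gap_lt (a b : I) : T.gap a b < (succ κ).ord :=
  ((T.gap_le a b).trans (T.node_le a)).trans_lt (T.top_lt a)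

theorem gap_le' (a b : I) : T.gap a b ≤ T.node b := T.symm a b ▸ T.gap_le b a

theorem Coherent.mono {S' : Set I} (hf : T.Coherent C Q f S) (h : S' ⊆ S) : T.Coherent C Q f S' :=
  ⟨fun a ha => hf.1 a (h ha), fun a ha b hb => hf.2 a (h ha) b (h hb)⟩

theorem Coherent.congr {g : I → P} (hf : T.Coherent C Q f S) (h : ∀ a ∈ S, g a = f a) :
    T.Coherent C Q g S :=
  ⟨fun a ha => h a ha ▸ hf.1 a ha, fun a ha b hb => by rw [h a ha, h b hb]; exact hf.2 a ha b hb⟩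

variable (hC : C.IsUniform) (hQ : C.IsNice ζ Q)

include hC hQ

/-- The join of the parts of a coherent family that concern the branch `x`. -/
theorem exists_join (hS : IsSmall κ S) (hf : T.Coherent C Q f S) {h : P}
    (hh : h ∈ T.conds C Q x) (hle : ∀ s ∈ S, C.restr h (T.gap s x) ≤ f s) :
    ∃ q ∈ Q, ∃ γ, ζ ≤ γ ∧ γ ≤ T.node x ∧ C.dom q ⊆ Iio γ ∧ C.restr h γ ≤ q ∧
      ∀ s ∈ S, C.restr (f s) (T.gap s x) ≤ q := by
  rcases S.eq_empty_or_nonempty with rfl | hne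
  · exact ⟨C.restr h ζ, hQ.isLowerSet (hC.restr_le _ _) hh.1, ζ, le_rfl,
      (T.le_gap x x).trans (T.gap_le x x), hC.dom_restr_subset _ _, le_rfl, by simp⟩
  let B : Set Ordinal.{u} := (fun s => T.gap s x) '' S
  have hB : IsSmall κ B := hS.image _
  have hpick : ∀ b ∈ B, ∃ s ∈ S, T.gap s x = b := fun b hb => hb
  have : Nonempty I := ⟨x⟩
  -- One branch is kept for each value of the gap to x, so that the pieces to be joined form a
  -- well-ordered chain indexed by `B`.
  choose! s hsS hsb using hpick
  -- By the ultrametric inequality, of two branches the one that leaves x earlier leaves the other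
  -- no earlier than x, so the two conditions agree up to that point.
  have hmono0 : ∀ s ∈ S, ∀ t ∈ S, T.gap s x ≤ T.gap t x →
      C.restr (f s) (T.gap s x) ≤ C.restr (f t) (T.gap t x) := by
    intro s hs t ht hst
    have h1 : T.gap s x ≤ T.gap s t := by
      have := T.ultra s x t
      rwa [T.symm x t, min_eq_left hst] at this
    rw [← hC.restr_restr h1, hf.2 s hs t ht, hC.restr_restr h1]
    exact hC.restr_le_restr hst
  have hmono : MonotoneOn (fun b => C.restr (f (s b)) b) B := by
    intro b hb c hc hbc
    have := hmono0 (s b) (hsS b hb) (s c) (hsS c hc) (by rw [hsb b hb, hsb c hc]; exact hbc)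
    rwa [hsb b hb, hsb c hc] at this
  obtain ⟨q, hq, hqd, _⟩ := hC.exists_isLUB_on hB hmono
  have hbdd : ∀ b ∈ B, b ≤ T.node x := by
    rintro _ ⟨s, _, rfl⟩; exact gap_le' s x
  have hBne : B.Nonempty := hne.image _
  have hlub : IsLUB B (sSup B) := isLUB_csSup hBne ⟨_, hbdd⟩
  have hsup : sSup B ≤ T.node x := csSup_le hBne hbdd
  have hqs : ∀ s ∈ S, C.restr (f s) (T.gap s x) ≤ q := by
    intro t ht
    have hb : T.gap t x ∈ B := mem_image_of_mem _ ht
    have h1 := hmono0 t ht (s (T.gap t x)) (hsS _ hb) (by rw [hsb _ hb])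
    rw [hsb _ hb] at h1
    exact h1.trans (hq.1 (mem_image_of_mem _ hb))
  refine ⟨q, ?_, sSup B, ?_, hsup, ?_, ?_, hqs⟩
  · exact hQ.lub_mem_on hB hmono (fun b hb => hQ.isLowerSet (hC.restr_le _ _)
      (hf.1 _ (hsS b hb)).1) hq
  · obtain ⟨t, ht⟩ := hne
    exact (T.le_gap t x).trans (hlub.1 (mem_image_of_mem _ ht))
  · rw [hqd]
    exact iUnion₂_subset fun b hb => (hC.dom_restr_subset _ _).trans (Iio_subset_Iio (hlub.1 hb))
  · refine hC.le_of_restr_le hBne (hsup.trans_lt ((T.node_le x).trans_lt (T.top_lt x)))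
      (fun b hb => hlub.1 hb) ?_ ?_
    · intro ξ hξ
      have h1 := hC.dom_restr_subset _ _ hξ
      obtain ⟨b, hb, h2, _⟩ := hlub.exists_between h1
      exact ⟨b, hb, h2⟩
    · rintro _ ⟨t, ht, rfl⟩
      have h1 : T.gap t x ≤ sSup B := hlub.1 (mem_image_of_mem _ ht)
      rw [hC.restr_restr h1]
      have h2 : C.restr h (T.gap t x) ≤ C.restr (f t) (T.gap t x) :=
        hC.le_restr_iff.2 ⟨hle t ht, hC.dom_restr_subset _ _⟩
      exact h2.trans (hqs t ht)

/-- Lets the branch x absorb all that a coherent family already says about it: h is amalgamated with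
the join. -/
theorem exists_amalgam (hS : IsSmall κ S) (hf : T.Coherent C Q f S) {h : P}
    (hh : h ∈ T.conds C Q x) (hle : ∀ s ∈ S, C.restr h (T.gap s x) ≤ f s) :
    ∃ h' ∈ T.conds C Q x, h ≤ h' ∧ ∀ s ∈ S, C.restr (f s) (T.gap s x) ≤ h' := by
  obtain ⟨q, hq, γ, h1, h2, h3, h4, h5⟩ := exists_join hC hQ hS hf hh hle
  have h6 : γ ≤ T.top x := h2.trans (T.node_le x)
  obtain ⟨r, hr, h7, h8, h9⟩ := hQ.amalgam h hh.1 q hq γ (h6.trans_lt (T.top_lt x)) h1 h4 h3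
  refine ⟨r, ⟨hr, ?_⟩, h7, fun s hs => (h5 s hs).trans h8⟩
  rw [h9]
  exact union_subset hh.2 (h3.trans (Iio_subset_Iio h6))

/-- A back-and-forth of length ω. Extendibility raises the family above the condition on x, then
that condition absorbs the new family. In the limit the two sides agree up to the gaps. -/
theorem coherent_insert_of_extendible (hω : ℵ₀ < κ) (hS : IsSmall κ S)
    (hx : x ∉ S) (hE : T.Extendible C Q S) (hf : T.Coherent C Q f S) {h : P}
    (hh : h ∈ T.conds C Q x) (hle : ∀ s ∈ S, C.restr (f s) (T.gap s x) ≤ h) :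
    ∃ f', T.Coherent C Q f' (insert x S) ∧ (∀ s ∈ S, f s ≤ f' s) ∧ h ≤ f' x := by
  classical
  let St := {y : (I → P) × P // T.Coherent C Q y.1 S ∧ y.2 ∈ T.conds C Q x ∧
    ∀ s ∈ S, C.restr (y.1 s) (T.gap s x) ≤ y.2}
  have step : ∀ y : St, ∃ z : St, (∀ s ∈ S, y.1.1 s ≤ z.1.1 s) ∧ y.1.2 ≤ z.1.2 ∧
      ∀ s ∈ S, C.restr y.1.2 (T.gap s x) ≤ z.1.1 s := by
    rintro ⟨⟨g, k⟩, hg, hk, hgk⟩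
    obtain ⟨g', hg', h1, h2⟩ := hE g hg x hx k hk hgk
    obtain ⟨k', hk', h3, h4⟩ := exists_amalgam hC hQ hS hg' hk h2
    exact ⟨⟨⟨g', k'⟩, hg', hk', h4⟩, h1, h3, h2⟩
  choose nx hnx1 hnx2 hnx3 using step
  let y : ℕ → St := fun n => nx^[n] ⟨⟨f, h⟩, hf, hh, hle⟩
  have hy : ∀ n, y (n + 1) = nx (y n) := fun n => Function.iterate_succ_apply' _ _ _
  have hm1 : ∀ s ∈ S, Monotone fun n => (y n).1.1 s := fun s hs =>
    monotone_nat_of_le_succ fun n => by rw [hy]; exact hnx1 _ s hs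
  have hm2 : Monotone fun n => (y n).1.2 :=
    monotone_nat_of_le_succ fun n => by rw [hy]; exact hnx2 _
  have : Nonempty P := ⟨h⟩
  choose! F hF1 hF2 hF3 using fun s (hs : s ∈ S) => hC.exists_isLUB_nat hω (hm1 s hs)
  obtain ⟨k, hk1, hk2, hk3⟩ := hC.exists_isLUB_nat hω hm2
  -- The restrictions of the two sequences interleave, and restriction commutes with their least
  -- upper bounds.
  have hFx : ∀ s ∈ S, C.restr (F s) (T.gap s x) = C.restr k (T.gap s x) := by
    intro s hs
    apply le_antisymm
    · refine (hF3 s hs _).2 ?_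
      rintro _ ⟨n, rfl⟩
      refine hC.le_restr_iff.2 ⟨((y n).2.2.2 s hs).trans (hk1.1 ⟨n, rfl⟩), hC.dom_restr_subset _ _⟩
    · refine (hk3 _).2 ?_
      rintro _ ⟨n, rfl⟩
      refine hC.le_restr_iff.2 ⟨?_, hC.dom_restr_subset _ _⟩
      have := hnx3 (y n) s hs
      rw [← hy] at this
      exact this.trans ((hF1 s hs).1 ⟨n + 1, rfl⟩)
  have hne : ∀ s ∈ S, s ≠ x := fun s hs h => hx (h ▸ hs)
  have hkc : k ∈ T.conds C Q x := by
    refine ⟨hQ.lub_mem_nat hω hm2 (fun n => (y n).2.2.1.1) hk1, ?_⟩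
    rw [hk2]; exact iUnion_subset fun n => (y n).2.2.1.2
  have hFc : ∀ s ∈ S, F s ∈ T.conds C Q s := fun s hs => by
    refine ⟨hQ.lub_mem_nat hω (hm1 s hs) (fun n => ((y n).2.1.1 s hs).1) (hF1 s hs), ?_⟩
    rw [hF2 s hs]; exact iUnion_subset fun n => ((y n).2.1.1 s hs).2
  refine ⟨fun a => if a = x then k else F a, ⟨?_, ?_⟩, fun s hs => ?_, ?_⟩
  · rintro a (rfl | ha)
    · simpa using hkc
    · simpa [hne a ha] using hFc a ha
  · rintro a (rfl | ha) b (rfl | hb)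
    · rfl
    · simp only [if_true, hne b hb, if_false]
      rw [T.symm, hFx b hb]
    · simp only [if_true, hne a ha, if_false]
      exact hFx a ha
    · simp only [hne a ha, hne b hb, if_false]
      have h1 := hF3 a ha (T.gap a b)
      have h2 := hF3 b hb (T.gap a b)
      have h3 : (fun n => C.restr ((y n).1.1 a) (T.gap a b)) =
          fun n => C.restr ((y n).1.1 b) (T.gap a b) :=
        funext fun n => (y n).2.1.2 a ha b hb
      rw [h3] at h1
      exact h1.unique h2
  · simp only [hne s hs, if_false]
    exact (hF1 s hs).1 ⟨0, rfl⟩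
  · simp only [if_true]
    exact hk1.1 ⟨0, rfl⟩

/-- The argument depends on whether the new branch y is at least as close to x as every branch of
`S`. The closest branch receives r directly, and coherence passes r on to the others. -/
theorem Extendible.insert (hω : ℵ₀ < κ) (hS : IsSmall κ S) {y : I}
    (hy : y ∉ S) (hE : T.Extendible C Q S) : T.Extendible C Q (insert y S) := by
  intro f hf x hx r hr hle
  have hfS := hf.mono (subset_insert y S)
  have hfy := hf.1 y (mem_insert _ _)
  by_cases hcase : ∀ s ∈ S, T.gap s x ≤ T.gap y x
  -- Here y is closest: r is first amalgamated into f y, and every s in `S` receives its share of r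
  -- through y.
  · obtain ⟨h, hh, h1, h2, h3⟩ := hQ.amalgam (f y) hfy.1 (C.restr r (T.gap y x))
      (hQ.isLowerSet (hC.restr_le _ _) hr.1) (T.gap y x) (gap_lt _ _) (T.le_gap _ _)
      (hC.le_restr_iff.2 ⟨hle y (mem_insert _ _), hC.dom_restr_subset _ _⟩)
      (hC.dom_restr_subset _ _)
    have hhc : h ∈ T.conds C Q y := by
      refine ⟨hh, ?_⟩
      rw [h3]
      exact union_subset hfy.2 ((hC.dom_restr_subset _ _).trans
        (Iio_subset_Iio ((T.gap_le y x).trans (T.node_le y))))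
    obtain ⟨f', hf', h4, h5⟩ := coherent_insert_of_extendible hC hQ hω hS hy hE hfS hhc
      fun s hs => by
        rw [hf.2 s (mem_insert_of_mem _ hs) y (mem_insert _ _)]
        exact (hC.restr_le _ _).trans h1
    have h6 : C.restr r (T.gap y x) ≤ f' y := h2.trans h5
    refine ⟨f', hf', ?_, ?_⟩
    · rintro s (rfl | hs)
      · exact h1.trans h5
      · exact h4 s hs
    · rintro s (rfl | hs)
      · exact h6
      · have h7 : T.gap s x ≤ T.gap s y := by
          have := T.ultra s x y
          rwa [T.symm x y, min_eq_left (hcase s hs)] at this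
        have h8 : C.restr r (T.gap s x) ≤ C.restr (f' y) (T.gap s x) :=
          hC.le_restr_iff.2 ⟨(hC.restr_le_restr (hcase s hs)).trans h6, hC.dom_restr_subset _ _⟩
        rw [← hC.restr_restr (p := f' y) h7,
          ← hf'.2 s (mem_insert_of_mem _ hs) y (mem_insert _ _), hC.restr_restr h7] at h8
        exact h8.trans (hC.restr_le _ _)
  · push Not at hcase
    obtain ⟨s0, hs0, hlt⟩ := hcase
    -- Here s₀ in `S` is closer to x than y is: `S` is raised above r first, and y receives its
    -- share of r through s₀.
    obtain ⟨g, hg, h1, h2⟩ := hE f hfS x (fun h => hx (mem_insert_of_mem _ h)) r hr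
      fun s hs => hle s (mem_insert_of_mem _ hs)
    obtain ⟨h, hh, h3, h4⟩ := exists_amalgam hC hQ hS hg hfy fun s hs => by
      rw [← hf.2 s (mem_insert_of_mem _ hs) y (mem_insert _ _)]
      exact (hC.restr_le _ _).trans (h1 s hs)
    obtain ⟨f', hf', h5, h6⟩ := coherent_insert_of_extendible hC hQ hω hS hy hE hg hh h4
    refine ⟨f', hf', ?_, ?_⟩
    · rintro s (rfl | hs)
      · exact h3.trans h6
      · exact (h1 s hs).trans (h5 s hs)
    · rintro s (rfl | hs)
      · have h7 : T.gap s x ≤ T.gap s0 s := by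
          have := T.ultra s0 x s
          rwa [T.symm x s, min_eq_right hlt.le] at this
        have h8 : C.restr r (T.gap s x) ≤ C.restr (f' s0) (T.gap s x) :=
          hC.le_restr_iff.2 ⟨(hC.restr_le_restr hlt.le).trans ((h2 s0 hs0).trans (h5 s0 hs0)),
            hC.dom_restr_subset _ _⟩
        rw [← hC.restr_restr (p := f' s0) h7, hf'.2 s0 (mem_insert_of_mem _ hs0) s (mem_insert _ _),
          hC.restr_restr h7] at h8
        exact h8.trans (hC.restr_le _ _)
      · exact (h2 s hs).trans (h5 s hs)

/-- The branches e l join the coherent part `B` one by one. When its turn comes, a branch first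
moves above its old condition and above the join of what the treated branches prescribe, choosing a
member of `O`; then it is reconciled with them. -/
theorem exists_coherent_of_extendible (hω : ℵ₀ < κ) {B : Set I} (hB : IsSmall κ B)
    {θ : Ordinal.{u}} (hθ : θ < κ.ord) {e : Ordinal.{u} → I} (O : I → Set P)
    (hc : ∀ a ∈ B ∪ e '' Iio θ, f a ∈ T.conds C Q a) (hcoh : T.Coherent C Q f B)
    (hle : ∀ a ∈ e '' Iio θ, ∀ s ∈ B ∪ e '' Iio θ, C.restr (f a) (T.gap s a) ≤ f s)
    (hE : ∀ l < θ, T.Extendible C Q (B ∪ e '' Iio l))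
    (hup : ∀ a, ∀ p ∈ O a, ∀ q ∈ T.conds C Q a, p ≤ q → q ∈ O a)
    (hO : ∀ a ∈ e '' Iio θ, ∀ q ∈ Q, ∀ γ, ζ ≤ γ → γ ≤ T.node a → C.dom q ⊆ Iio γ →
      C.restr (f a) γ ≤ q → ∃ g ∈ O a, g ∈ T.conds C Q a ∧ f a ≤ g ∧ q ≤ g) :
    ∃ F, T.Coherent C Q F (B ∪ e '' Iio θ) ∧ (∀ a, f a ≤ F a) ∧
      ∀ a ∈ e '' Iio θ, a ∉ B → F a ∈ O a := by
  classical
  rcases isEmpty_or_nonempty I with hI | ⟨⟨a0⟩⟩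
  · exact ⟨f, ⟨fun a => isEmptyElim a, fun a => isEmptyElim a⟩, fun a => isEmptyElim a,
      fun a => isEmptyElim a⟩
  have : Nonempty P := ⟨f a0⟩
  let J : Ordinal.{u} → Set I := fun l => B ∪ e '' Iio l
  have hJ : ∀ l m, l ≤ m → J l ⊆ J m := fun l m h =>
    union_subset_union_right _ (image_mono (Iio_subset_Iio h))
  have hJs : ∀ m, J (Order.succ m) = insert (e m) (J m) := by
    intro m
    simp only [J]
    rw [show Iio (Order.succ m) = insert m (Iio m) by ext; simp [le_iff_eq_or_lt],
      image_insert_eq, union_insert]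
  -- Untreated branches keep their initial condition, so that `hle` and `hO`, which speak of f,
  -- apply when they are reached.
  let Ok : Ordinal.{u} → (I → P) → Prop := fun l F => T.Coherent C Q F (J l) ∧
    (∀ a, f a ≤ F a) ∧ (∀ a ∉ J l, F a = f a) ∧ ∀ a ∈ e '' Iio l, a ∉ B → F a ∈ O a
  have key : ∀ l ≤ θ, ∀ s : Ordinal.{u} → I → P,
      (∀ m < l, (∀ n < m, ∀ a, s n a ≤ s m a) ∧ Ok (Order.succ m) (s m)) →
      ∃ F, (∀ m < l, ∀ a, s m a ≤ F a) ∧ Ok l F := by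
    intro l hl s hs
    rcases eq_or_ne l 0 with rfl | hl0
    · refine ⟨f, by simp, ?_, fun a => le_rfl, fun _ _ => rfl, by simp⟩
      simpa [J] using hcoh
    have hpos : 0 < l := pos_iff_ne_zero.2 hl0
    have hmono : ∀ a, MonotoneOn (fun m => s m a) (Iio l) := fun a m _ n hn hmn => by
      rcases hmn.eq_or_lt with rfl | h
      · exact le_rfl
      · exact (hs n hn).1 m h a
    have hsm := isSmall_Iio (hl.trans_lt hθ)
    choose F hF1 hF2 hF3 using fun a => hC.exists_isLUB_on hsm (hmono a)
    have hup' : ∀ m < l, ∀ a, s m a ≤ F a := fun m hm a => (hF1 a).1 ⟨m, hm, rfl⟩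
    have hcF : ∀ a ∈ J l, F a ∈ T.conds C Q a := by
      intro a ha
      have hall : ∀ m < l, s m a ∈ T.conds C Q a := by
        intro m hm
        by_cases h : a ∈ J (Order.succ m)
        · exact (hs m hm).2.1.1 a h
        · rw [(hs m hm).2.2.2.1 a h]
          exact hc a (hJ l θ hl ha)
      refine ⟨hQ.lub_mem_on hsm (hmono a) (fun m hm => (hall m hm).1) (hF1 a), ?_⟩
      rw [hF2]
      exact iUnion₂_subset fun m hm => (hall m hm).2
    -- Any two branches of `J l` have both been treated from some index on, and from there the
    -- families are coherent on them; this survives least upper bounds.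
    have hlate : ∀ a ∈ J l, ∃ m < l, ∀ n, m ≤ n → n < l → a ∈ J (Order.succ n) := by
      rintro a (ha | ⟨m, hm, rfl⟩)
      · exact ⟨0, hpos, fun n _ _ => Or.inl ha⟩
      · exact ⟨m, hm, fun n hn _ => Or.inr ⟨m, Order.lt_succ_iff.2 hn, rfl⟩⟩
    refine ⟨F, hup', ⟨hcF, fun a ha b hb => ?_⟩, fun a => ?_, fun a ha => ?_, fun a ha haB => ?_⟩
    · obtain ⟨m, hm, hm'⟩ := hlate a ha
      obtain ⟨m2, hm2, hm2'⟩ := hlate b hb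
      have hmm : max m m2 < l := max_lt hm hm2
      have hstep : ∀ a b, a ∈ J l → b ∈ J l →
          (∀ n, max m m2 ≤ n → n < l → a ∈ J (Order.succ n)) →
          (∀ n, max m m2 ≤ n → n < l → b ∈ J (Order.succ n)) →
          C.restr (F a) (T.gap a b) ≤ C.restr (F b) (T.gap a b) := by
        intro a b _ _ ha' hb'
        refine (hF3 a _).2 ?_
        rintro _ ⟨n, hn, rfl⟩
        have hN : max n (max m m2) < l := max_lt hn hmm
        have h1 : s n a ≤ s (max n (max m m2)) a := hmono a hn hN (le_max_left _ _)
        have h2 := (hs _ hN).2.1.2 a (ha' _ (le_max_right _ _) hN) b (hb' _ (le_max_right _ _) hN)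
        have h3 := (hC.restr_mono (α := T.gap a b) h1).trans h2.le
        exact h3.trans (hC.restr_mono (hup' _ hN b))
      have ha' : ∀ n, max m m2 ≤ n → n < l → a ∈ J (Order.succ n) :=
        fun n hn => hm' n ((le_max_left _ _).trans hn)
      have hb' : ∀ n, max m m2 ≤ n → n < l → b ∈ J (Order.succ n) :=
        fun n hn => hm2' n ((le_max_right _ _).trans hn)
      apply le_antisymm
      · exact hstep a b ha hb ha' hb'
      · rw [T.symm a b]
        exact hstep b a hb ha hb' ha'
    · exact ((hs 0 hpos).2.2.1 a).trans (hup' 0 hpos a)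
    · refine le_antisymm ((hF1 a).2 ?_) (((hs 0 hpos).2.2.1 a).trans (hup' 0 hpos a))
      rintro _ ⟨m, hm, rfl⟩
      exact ((hs m hm).2.2.2.1 a fun h => ha (hJ _ _ (Order.succ_le_of_lt hm) h)).le
    · obtain ⟨m, hm, rfl⟩ := ha
      exact hup _ _ ((hs m hm).2.2.2.2 _ ⟨m, Order.lt_succ m, rfl⟩ haB) _
        (hcF _ (Or.inr ⟨m, hm, rfl⟩)) (hup' m hm _)
  have step : ∀ l < θ, ∀ F, Ok l F → ∃ F', (∀ a, F a ≤ F' a) ∧ Ok (Order.succ l) F' := by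
    intro l hl F hF
    by_cases hel : e l ∈ J l
    · have hJl : J (Order.succ l) = J l := by rw [hJs, insert_eq_of_mem hel]
      refine ⟨F, fun _ => le_rfl, hJl ▸ hF.1, hF.2.1, hJl ▸ hF.2.2.1, ?_⟩
      rintro _ ⟨m, hm, rfl⟩ hmB
      rcases (Order.lt_succ_iff.1 (mem_Iio.1 hm)).eq_or_lt with rfl | h
      · exact hF.2.2.2 _ (hel.resolve_left hmB) hmB
      · exact hF.2.2.2 _ ⟨m, h, rfl⟩ hmB
    · have hmem : e l ∈ e '' Iio θ := ⟨l, hl, rfl⟩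
      have hsmall : IsSmall κ (J l) := hB.union hω.le ((isSmall_Iio (hl.trans hθ)).image e)
      have hfc := hc (e l) (Or.inr hmem)
      obtain ⟨q, hq, γ, h1, h2, h3, h4, h5⟩ := exists_join hC hQ hsmall hF.1 hfc fun s hs =>
        (hle (e l) hmem s (hJ l θ hl.le hs)).trans (hF.2.1 s)
      obtain ⟨g, hgO, hgc, hfg, hqg⟩ := hO (e l) hmem q hq γ h1 h2 h3 h4
      obtain ⟨F', hF', h6, h7⟩ := coherent_insert_of_extendible hC hQ hω hsmall hel (hE l hl) hF.1
        hgc fun s hs => (h5 s hs).trans hqg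
      have hFF : ∀ a, F a ≤ if a ∈ insert (e l) (J l) then F' a else F a := by
        intro a
        by_cases ha : a ∈ insert (e l) (J l)
        · rw [if_pos ha]
          rcases ha with rfl | ha
          · rw [hF.2.2.1 _ hel]; exact hfg.trans h7
          · exact h6 a ha
        · rw [if_neg ha]
      have hcoh' : T.Coherent C Q (fun a => if a ∈ insert (e l) (J l) then F' a else F a)
          (insert (e l) (J l)) := hF'.congr fun a ha => if_pos ha
      refine ⟨_, hFF, by rw [hJs]; exact hcoh', fun a => (hF.2.1 a).trans (hFF a), fun a ha => ?_, ?_⟩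
      · rw [hJs] at ha
        simp only [if_neg ha]
        exact hF.2.2.1 a fun h => ha (mem_insert_of_mem _ h)
      · rintro _ ⟨m, hm, rfl⟩ hmB
        rcases (Order.lt_succ_iff.1 (mem_Iio.1 hm)).eq_or_lt with rfl | h
        · exact hup _ _ hgO _ (hcoh'.1 _ (mem_insert _ _))
            (h7.trans_eq (if_pos (mem_insert _ _)).symm)
        · have h8 : e m ∈ insert (e l) (J l) := mem_insert_of_mem _ (Or.inr ⟨m, h, rfl⟩)
          exact hup _ _ (hF.2.2.2 _ ⟨m, h, rfl⟩ hmB) _ (hcoh'.1 _ h8) (hFF _)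
  obtain ⟨s, hs⟩ := exists_ordinal_sequence θ
    (fun l (s : Ordinal.{u} → I → P) F => (∀ m < l, ∀ a, s m a ≤ F a) ∧ Ok (Order.succ l) F)
    (by
      rintro l - s s' F h ⟨h1, h2⟩
      exact ⟨fun m hm a => h m hm ▸ h1 m hm a, h2⟩)
    (by
      intro l hl s hs
      obtain ⟨F, h1, h2⟩ := key l hl.le s hs
      obtain ⟨F', h3, h4⟩ := step l hl F h2
      exact ⟨F', fun m hm a => (h1 m hm a).trans (h3 a), h4⟩)
  obtain ⟨F, _, h2⟩ := key θ le_rfl s hs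
  exact ⟨F, h2.1, h2.2.1, h2.2.2.2⟩

/-- Induction on θ. The family is rebuilt starting from x with condition r; the initial segments
needed on the way are shorter sets of branches together with x, which are extendible by induction
and `Extendible.insert`. -/
theorem extendible_image (hω : ℵ₀ < κ) (e : Ordinal.{u} → I) {θ : Ordinal.{u}}
    (hθ : θ < κ.ord) : T.Extendible C Q (e '' Iio θ) := by
  classical
  induction θ using WellFoundedLT.induction with
  | ind θ ih =>
    intro f hf x hx r hr hle
    have hx1 : ∀ s ∈ e '' Iio θ, s ≠ x := fun s hs h => hx (h ▸ hs)
    let g : I → P := fun a => if a = x then r else f a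
    have hgx : g x = r := if_pos rfl
    have hgs : ∀ s ∈ e '' Iio θ, g s = f s := fun s hs => if_neg (hx1 s hs)
    obtain ⟨F, hF1, hF2, _⟩ := exists_coherent_of_extendible (T := T) (f := g) hC hQ hω (B := {x})
      (isSmall_of_finite hω.le (finite_singleton x)) hθ (e := e) (fun a => T.conds C Q a)
      (by
        rintro a (rfl | ha)
        · rw [hgx]; exact hr
        · rw [hgs a ha]; exact hf.1 a ha)
      ⟨by rintro a rfl; rw [hgx]; exact hr, by rintro a rfl b rfl; rfl⟩
      (by
        rintro a ha s (rfl | hs)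
        · rw [hgx, hgs a ha, T.symm]; exact hle a ha
        · rw [hgs a ha, hgs s hs, T.symm, hf.2 a ha s hs]; exact hC.restr_le _ _)
      (fun l hl => by
        rw [singleton_union]
        exact (ih l hl (hl.trans hθ)).insert hC hQ hω
          ((isSmall_Iio (hl.trans hθ)).image e)
          fun h => hx (image_mono (Iio_subset_Iio hl.le) h))
      (fun a p _ q hq _ => hq)
      (by
        intro a ha q hq γ h1 h2 h3 h4
        rw [hgs a ha] at h4 ⊢
        have h6 : γ ≤ T.top a := h2.trans (T.node_le a)
        obtain ⟨k, hk, h7, h8, h9⟩ := hQ.amalgam (f a) (hf.1 a ha).1 q hq γ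
          (h6.trans_lt (T.top_lt a)) h1 h4 h3
        have : k ∈ T.conds C Q a := by
          refine ⟨hk, ?_⟩
          rw [h9]; exact union_subset (hf.1 a ha).2 (h3.trans (Iio_subset_Iio h6))
        exact ⟨k, this, this, h7, h8⟩)
    refine ⟨F, hF1.mono subset_union_right, fun s hs => ?_, fun s hs => ?_⟩
    · rw [← hgs s hs]; exact hF2 s
    · have h1 : r ≤ F x := by rw [← hgx]; exact hF2 x
      have h2 := hF1.2 s (Or.inr hs) x (Or.inl rfl)
      exact ((hC.restr_mono h1).trans h2.ge).trans (hC.restr_le _ _)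

/-- A coherent family can be extended to a coherent family of elements of dense sets. -/
theorem exists_coherent_mem (hω : ℵ₀ < κ) (hI : IsSmall κ (Set.univ : Set I)) (O : I → Set P)
    (hf : T.Coherent C Q f Set.univ)
    (hup : ∀ a, ∀ p ∈ O a, ∀ q ∈ T.conds C Q a, p ≤ q → q ∈ O a)
    (hO : ∀ a, ∀ q ∈ Q, ∀ γ, ζ ≤ γ → γ ≤ T.node a → C.dom q ⊆ Iio γ →
      C.restr (f a) γ ≤ q → ∃ g ∈ O a, g ∈ T.conds C Q a ∧ f a ≤ g ∧ q ≤ g) :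
    ∃ F, T.Coherent C Q F Set.univ ∧ ∀ a, f a ≤ F a ∧ F a ∈ O a := by
  rcases isEmpty_or_nonempty I with hI' | hI'
  · exact ⟨f, hf, fun a => isEmptyElim a⟩
  obtain ⟨θ, hθ, e, he⟩ := hI.exists_enum
  have he' : e '' Iio θ = Set.univ := univ_subset_iff.1 he
  obtain ⟨F, h1, h2, h3⟩ := exists_coherent_of_extendible (T := T) (f := f) hC hQ hω (B := ∅)
    (isSmall_of_finite hω.le finite_empty) hθ (e := e) O (fun a _ => hf.1 a (mem_univ a))
    ⟨by simp, by simp⟩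
    (fun a _ s _ => by
      rw [T.symm, hf.2 a (mem_univ a) s (mem_univ s)]; exact hC.restr_le _ _)
    (fun l hl => by
      rw [empty_union]; exact extendible_image hC hQ hω e (hl.trans hθ))
    hup (fun a _ => hO a)
  rw [empty_union, he'] at h1
  exact ⟨F, h1, fun a => ⟨h2 a, h3 a (he' ▸ mem_univ a) (notMem_empty a)⟩⟩

end Branching

end Coding

/-! ### The quotient by the ideals already played. -/

namespace Coding

variable {κ : Cardinal.{u}} {P : Type v} [PartialOrder P]

/-- The quotient of `P` by the ideals played before stage `δ`. -/
def quotBefore (C : Coding κ P) (y : Ordinal.{u} → MoveII.{u, v} P) (δ : Ordinal.{u}) : Set P :=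
  {p | ∀ β < δ, C.restr p (y β).height ∈ (y β).ideal}

/-- The move `m` of player II at stage `δ` consists of a directed ideal that projects to all the
earlier ones. -/
structure IsStage (C : Coding κ P) (y : Ordinal.{u} → MoveII.{u, v} P) (δ : Ordinal.{u})
    (m : MoveII.{u, v} P) : Prop where
  height_lt : m.height < (succ κ).ord
  lt_height : ∀ β < δ, (y β).height < m.height
  pos : 0 < m.height
  subset : m.ideal ⊆ C.below m.height
  isLowerSet : IsLowerSet m.ideal
  directed : ∀ X ⊆ m.ideal, IsSmall κ X → ∃ r ∈ m.ideal, r ∈ upperBounds X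
  ideal_subset : ∀ β < δ, (y β).ideal ⊆ m.ideal
  restr_mem : ∀ p ∈ m.ideal, ∀ β < δ, C.restr p (y β).height ∈ (y β).ideal

/-- The conditions of `Q` whose domain is below `ζ` decide whether a small set is bounded in `Q`. -/
def DecidesBounds (C : Coding κ P) (ζ : Ordinal.{u}) (Q : Set P) : Prop :=
  ∀ X : Set P, IsSmall κ X →
    (∃ s ∈ Q, s ∈ upperBounds X ∧ C.dom s ⊆ Iio ζ ∪ ⋃ p ∈ X, C.dom p) ∨
    ∃ t ∈ Q, C.dom t ⊆ Iio ζ ∧ ¬ ∃ x ∈ upperBounds X, t ≤ x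

/-- The density system `D` is dense in `Q`. -/
def DenseIn (C : Coding κ P) (ζ : Ordinal.{u}) (Q : Set P) (D : SystemFun.{u, v} P) : Prop :=
  ∀ a ∈ Q, ∀ x : Set Ordinal.{u}, IsSmall κ x → x ⊆ Iio (succ κ).ord →
    ∃ s ∈ Q, a ≤ s ∧ ∃ w : Set Ordinal.{u}, IsSmall κ w ∧ x ⊆ w ∧
      w ⊆ Iio ζ ∪ (C.dom a ∪ x) ∧ C.dom s ⊆ w ∧ s ∈ D x w

variable {C : Coding κ P} {y : Ordinal.{u} → MoveII.{u, v} P} {δ : Ordinal.{u}}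

theorem le_heightBefore {β : Ordinal.{u}} (h : β < δ) : (y β).height ≤ heightBefore y δ :=
  Ordinal.le_iSup (fun β : Iio δ => (y β).height) ⟨β, h⟩

theorem lt_heightBefore {ξ : Ordinal.{u}} :
    ξ < heightBefore y δ ↔ ∃ β < δ, ξ < (y β).height := by
  unfold heightBefore
  rw [Ordinal.lt_iSup_iff]
  exact ⟨fun ⟨β, h⟩ => ⟨β, β.2, h⟩, fun ⟨β, hβ, h⟩ => ⟨⟨β, hβ⟩, h⟩⟩

theorem heightBefore_congr {y' : Ordinal.{u} → MoveII.{u, v} P} (h : ∀ β < δ, y β = y' β) :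
    heightBefore y δ = heightBefore y' δ := by
  refine eq_of_forall_lt_iff fun ξ => ?_
  rw [lt_heightBefore, lt_heightBefore]
  exact exists_congr fun β => and_congr_right fun hβ => by rw [h β hβ]

theorem idealBefore_congr {y' : Ordinal.{u} → MoveII.{u, v} P} (h : ∀ β < δ, y β = y' β) :
    C.idealBefore y δ = C.idealBefore y' δ := by
  ext p
  simp only [idealBefore, mem_ofPred_eq, heightBefore_congr h]
  refine and_congr_right fun _ => forall₂_congr fun H _ => imp_congr_left ?_
  exact forall₂_congr fun β hβ => by rw [h β hβ]

theorem legalI_congr {y' : Ordinal.{u} → MoveII.{u, v} P} (h : ∀ β < δ, y β = y' β)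
    {m : MoveI.{u, v} P} (hm : C.LegalI y δ m) : C.LegalI y' δ m := by
  unfold LegalI at *
  rwa [← heightBefore_congr h, ← idealBefore_congr h]

theorem isStage_congr {y' : Ordinal.{u} → MoveII.{u, v} P} (h : ∀ β < δ, y β = y' β)
    {m : MoveII.{u, v} P} (hm : C.IsStage y δ m) : C.IsStage y' δ m := by
  refine ⟨hm.height_lt, fun β hβ => ?_, hm.pos, hm.subset, hm.isLowerSet, hm.directed,
    fun β hβ => ?_, fun p hp β hβ => ?_⟩
  · rw [← h β hβ]; exact hm.lt_height β hβ
  · rw [← h β hβ]; exact hm.ideal_subset β hβ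
  · rw [← h β hβ]; exact hm.restr_mem p hp β hβ

theorem IsStage.lub_mem {m : MoveII.{u, v} P} (hm : C.IsStage y δ m) {S : Set P}
    (hS : IsSmall κ S) (h : S ⊆ m.ideal) {q : P} (hq : IsLUB S q) : q ∈ m.ideal := by
  obtain ⟨r, hr, hr'⟩ := hm.directed S h hS
  exact hm.isLowerSet (hq.2 hr') hr

theorem heightBefore_lt (hκ : ℵ₀ ≤ κ) (hδ : δ < (succ κ).ord)
    (hst : ∀ β < δ, C.IsStage y β (y β)) : heightBefore y δ < (succ κ).ord := by
  obtain ⟨b, hb, h⟩ := (isSmall_Iio hδ).exists_bound (Cardinal.isRegular_succ hκ)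
    (fun β => (y β).height) fun β hβ => (hst β hβ).height_lt
  refine lt_of_le_of_lt (le_of_forall_lt fun ξ hξ => ?_) hb
  obtain ⟨β, hβ, h1⟩ := lt_heightBefore.1 hξ
  exact h1.trans (h β hβ)

variable (hC : C.IsUniform)

include hC

theorem isLowerSet_quotBefore (hst : ∀ β < δ, C.IsStage y β (y β)) :
    IsLowerSet (C.quotBefore y δ) := fun _ _ hab ha β hβ =>
  (hst β hβ).isLowerSet (hC.restr_mono hab) (ha β hβ)

theorem mem_quotBefore_iff {p : P} :
    p ∈ C.quotBefore y δ ↔ C.restr p (heightBefore y δ) ∈ C.quotBefore y δ :=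
  forall₂_congr fun β hβ => by rw [hC.restr_restr (le_heightBefore hβ)]

theorem mem_quotBefore_of_mem (hst : ∀ β < δ, C.IsStage y β (y β)) {β : Ordinal.{u}} (hβ : β < δ)
    {p : P} (hp : p ∈ (y β).ideal) : p ∈ C.quotBefore y δ := by
  intro γ hγ
  rcases lt_trichotomy γ β with h | rfl | h
  · exact (hst β hβ).restr_mem p hp γ h
  · exact (hst γ hγ).isLowerSet (hC.restr_le _ _) hp
  · exact (hst γ hγ).isLowerSet (hC.restr_le _ _) ((hst γ hγ).ideal_subset β h hp)

theorem quotBefore_lub (hst : ∀ β < δ, C.IsStage y β (y β)) {ι : Type (u + 1)} [LinearOrder ι]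
    [WellFoundedLT ι] (hι : Cardinal.lift.{u} #ι < Cardinal.lift.{u + 1} κ) {p : ι → P}
    (hp : Monotone p) (hpQ : ∀ i, p i ∈ C.quotBefore y δ) {q : P} (hq : IsLUB (range p) q) :
    q ∈ C.quotBefore y δ := by
  intro β hβ
  obtain ⟨q', h1, _, h3⟩ := hC.exists_isLUB hι hp
  rw [hq.unique h1]
  refine (hst β hβ).lub_mem ?_ ?_ (h3 _)
  · rw [← image_univ]
    refine IsSmall.image ?_ _
    unfold IsSmall
    rwa [mk_univ]
  · rintro _ ⟨i, rfl⟩; exact hpQ i β hβ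

/-- One earlier stage is picked for each point of x; 0 is added to keep the set nonempty. A
condition with domain x can then be tested on few stages, although δ may have κ many. -/
theorem exists_small_cofinal (hδ : δ ≠ 0) {x : Set Ordinal.{u}} (hx : IsSmall κ x)
    (hκ : ℵ₀ ≤ κ) : ∃ B : Set Ordinal.{u}, B ⊆ Iio δ ∧ B.Nonempty ∧ IsSmall κ B ∧
      ∀ ξ ∈ x, ξ < heightBefore y δ → ∃ β ∈ B, ξ < (y β).height := by
  have : ∀ ξ ∈ x ∩ Iio (heightBefore y δ), ∃ β < δ, ξ < (y β).height := fun ξ hξ =>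
    lt_heightBefore.1 hξ.2
  choose! f hf hf' using this
  refine ⟨insert 0 (f '' (x ∩ Iio (heightBefore y δ))), ?_, insert_nonempty _ _, ?_, ?_⟩
  · rintro b (rfl | ⟨ξ, hξ, rfl⟩)
    · exact pos_iff_ne_zero.2 hδ
    · exact hf ξ hξ
  · rw [← singleton_union]
    exact (isSmall_of_finite hκ (finite_singleton _)).union hκ
      ((hx.mono inter_subset_left).image f)
  · intro ξ hξ h
    exact ⟨f ξ, Or.inr ⟨ξ, ⟨hξ, h⟩, rfl⟩, hf' ξ ⟨hξ, h⟩⟩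

/-- A condition that is cofinally in the ideals is in the quotient. -/
theorem mem_quotBefore_of_cofinal (hst : ∀ β < δ, C.IsStage y β (y β))
    (hδ : δ < (succ κ).ord) (hκ : ℵ₀ ≤ κ)
    {B : Set Ordinal.{u}} (hB : B ⊆ Iio δ) (hBne : B.Nonempty) (hBs : IsSmall κ B) {p : P}
    (hd : ∀ ξ ∈ C.dom p, ξ < heightBefore y δ → ∃ β ∈ B, ξ < (y β).height)
    (hp : ∀ β ∈ B, C.restr p (y β).height ∈ (y β).ideal) : p ∈ C.quotBefore y δ := by
  intro β hβ
  by_cases h : ∃ b ∈ B, β ≤ b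
  · obtain ⟨b, hb, hle⟩ := h
    rcases hle.eq_or_lt with rfl | hlt
    · exact hp _ hb
    · have h1 := (hst b (hB hb)).restr_mem _ (hp b hb) β hlt
      rwa [hC.restr_restr ((hst b (hB hb)).lt_height β hlt).le] at h1
  · push Not at h
    -- All of `B` lies below β. The ideal of β contains a bound r of the restrictions of p to the
    -- heights from `B`, and these already determine the restriction of p to the height of β.
    obtain ⟨r, hr, hr'⟩ := (hst β hβ).directed ((fun b => C.restr p (y b).height) '' B) (by
      rintro _ ⟨b, hb, rfl⟩
      exact (hst β hβ).ideal_subset b (h b hb) (hp b hb)) (hBs.image _)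
    refine (hst β hβ).isLowerSet (?_ : _ ≤ r) hr
    refine hC.le_of_restr_le (B := (fun b => (y b).height) '' B) (hBne.image _)
      (heightBefore_lt hκ hδ hst) ?_ ?_ ?_
    · rintro _ ⟨b, hb, rfl⟩; exact le_heightBefore (hB hb)
    · intro ξ hξ
      rw [hC.dom_restr] at hξ
      obtain ⟨b, hb, h1⟩ := hd ξ hξ.1 (lt_heightBefore.2 ⟨β, hβ, hξ.2⟩)
      exact ⟨_, ⟨b, hb, rfl⟩, h1⟩
    · rintro _ ⟨b, hb, rfl⟩
      rw [hC.restr_restr ((hst β hβ).lt_height b (h b hb)).le]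
      exact hr' ⟨b, hb, rfl⟩

/-- A bound is assembled along a small cofinal set `B` of stages from members of the ideals that
dominate the restrictions of `X`. -/
theorem directed_quotBefore (hst : ∀ β < δ, C.IsStage y β (y β))
    (hδ : δ < (succ κ).ord) (hδ0 : δ ≠ 0) (hκ : κ.IsRegular) {X : Set P} (hX : IsSmall κ X)
    (hXQ : X ⊆ C.quotBefore y δ) (hXd : ∀ p ∈ X, C.dom p ⊆ Iio (heightBefore y δ)) :
    ∃ r ∈ C.quotBefore y δ, C.dom r ⊆ Iio (heightBefore y δ) ∧ r ∈ upperBounds X := by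
  obtain ⟨B, hB, hBne, hBs, hBc⟩ := exists_small_cofinal (y := y) hC hδ0
    (hX.biUnion hκ (f := C.dom) fun p _ => isSmall_dom p) hκ.aleph0_le
  have hP : Nonempty P := by
    obtain ⟨r, _⟩ := (hst 0 (pos_iff_ne_zero.2 hδ0)).directed ∅ (empty_subset _)
      (isSmall_of_finite hκ.aleph0_le finite_empty)
    exact ⟨r⟩
  -- Monotonicity is demanded only over `B`: the ideals bound sets of fewer than κ elements, and
  -- there may be κ many stages before β.
  obtain ⟨s, hs⟩ := exists_ordinal_sequence δ (fun β (s : Ordinal.{u} → P) x =>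
      x ∈ (y β).ideal ∧ (∀ b ∈ B, b < β → s b ≤ x) ∧ ∀ p ∈ X, C.restr p (y β).height ≤ x)
    (by
      rintro l - s s' x h ⟨h1, h2, h3⟩
      exact ⟨h1, fun b hb hbl => h b hbl ▸ h2 b hb hbl, h3⟩)
    (by
      intro β hβ s hs
      obtain ⟨r, hr, hr'⟩ := (hst β hβ).directed
        (s '' (B ∩ Iio β) ∪ (fun p => C.restr p (y β).height) '' X) (by
          rintro _ (⟨b, hb, rfl⟩ | ⟨p, hp, rfl⟩)
          · exact (hst β hβ).ideal_subset b hb.2 (hs b hb.2).1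
          · exact hXQ hp β hβ)
        (((hBs.mono inter_subset_left).image _).union hκ.aleph0_le (hX.image _))
      exact ⟨r, hr, fun b hb hbl => hr' (Or.inl ⟨b, ⟨hb, hbl⟩, rfl⟩),
        fun p hp => hr' (Or.inr ⟨p, hp, rfl⟩)⟩)
  have hmono : MonotoneOn s B := fun a ha b hb hab => by
    rcases hab.eq_or_lt with rfl | h
    · exact le_rfl
    · exact (hs b (hB hb)).2.1 a ha h
  obtain ⟨r, hr1, hr2, hr3⟩ := hC.exists_isLUB_on hBs hmono
  have hsd : ∀ b ∈ B, C.dom (s b) ⊆ Iio (y b).height := fun b hb =>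
    (hst b (hB hb)).subset (hs b (hB hb)).1
  refine ⟨r, ?_, ?_, fun p hp => ?_⟩
  · refine mem_quotBefore_of_cofinal hC hst hδ hκ.aleph0_le hB hBne hBs ?_ ?_
    · intro ξ hξ _
      rw [hr2] at hξ
      simp only [mem_iUnion] at hξ
      obtain ⟨b, hb, h⟩ := hξ
      exact ⟨b, hb, hsd b hb h⟩
    · intro β hβ
      refine (hst β (hB hβ)).lub_mem (hBs.image _) ?_ (hr3 _)
      rintro _ ⟨b, hb, rfl⟩
      exact mem_quotBefore_of_mem hC hst (hB hb) (hs b (hB hb)).1 β (hB hβ)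
  · rw [hr2]
    exact iUnion₂_subset fun b hb => (hsd b hb).trans (Iio_subset_Iio (le_heightBefore (hB hb)))
  · refine hC.le_of_restr_le (B := (fun b => (y b).height) '' B) (hBne.image _)
      (heightBefore_lt hκ.aleph0_le hδ hst) ?_ ?_ ?_
    · rintro _ ⟨b, hb, rfl⟩; exact le_heightBefore (hB hb)
    · intro ξ hξ
      obtain ⟨b, hb, h⟩ := hBc ξ (mem_biUnion hp hξ) (hXd p hp hξ)
      exact ⟨_, ⟨b, hb, rfl⟩, h⟩
    · rintro _ ⟨b, hb, rfl⟩
      exact ((hs b (hB hb)).2.2 p hp).trans (hr1.1 ⟨b, hb, rfl⟩)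

/-- The low part of q and `X` are bounded by directedness, and that bound is amalgamated with q in
P. The result need not lie in the quotient. -/
theorem exists_compatible (hst : ∀ β < δ, C.IsStage y β (y β))
    (hδ : δ < (succ κ).ord) (hδ0 : δ ≠ 0) (hκ : κ.IsRegular) {q : P} {X : Set P}
    (hq : q ∈ C.quotBefore y δ) (hX : IsSmall κ X)
    (hXQ : X ⊆ C.quotBefore y δ) (hXd : ∀ p ∈ X, C.dom p ⊆ Iio (heightBefore y δ)) :
    ∃ x ∈ upperBounds X, q ≤ x := by
  obtain ⟨r, hr, hrd, hr'⟩ := directed_quotBefore hC hst hδ hδ0 hκ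
    (X := insert (C.restr q (heightBefore y δ)) X) (by
      rw [← singleton_union]
      exact (isSmall_of_finite hκ.aleph0_le (finite_singleton _)).union hκ.aleph0_le hX)
    (insert_subset ((mem_quotBefore_iff hC).1 hq) hXQ)
    (by
      rintro p (rfl | hp)
      · exact hC.dom_restr_subset _ _
      · exact hXd p hp)
  obtain ⟨x, h1, h2, _⟩ := hC.amalgam (heightBefore_lt hκ.aleph0_le hδ hst)
    (hr' (mem_insert _ _)) hrd
  exact ⟨x, fun p hp => (hr' (mem_insert_of_mem _ hp)).trans h2, h1⟩

/-- Only amalgamation needs an argument. If f and q had no bound in the quotient, some low t would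
exclude {f, q}. If q and t are bounded in the quotient, amalgamating f with the part below γ of that
bound contradicts the choice of t. If not, some low t' excludes {q, t}, although q is compatible
with {t, t'}. -/
theorem isNice_quotBefore (hst : ∀ β < δ, C.IsStage y β (y β))
    (hδ : δ < (succ κ).ord) (hκ : κ.IsRegular)
    (hdec : C.DecidesBounds (heightBefore y δ) (C.quotBefore y δ)) :
    C.IsNice (heightBefore y δ) (C.quotBefore y δ) := by
  refine ⟨isLowerSet_quotBefore hC hst, fun ι _ _ hι p hp hpQ q hq =>
    quotBefore_lub hC hst hι hp hpQ hq, fun f hf q hq γ hγ hζ hle hd => ?_⟩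
  rcases eq_or_ne δ 0 with rfl | hδ0
  · obtain ⟨r, h1, h2, h3⟩ := hC.amalgam hγ hle hd
    exact ⟨r, fun β hβ => absurd hβ (by simp), h1, h2, h3⟩
  have hpair : ∀ a b : P, IsSmall κ ({a, b} : Set P) := fun a b =>
    isSmall_of_finite hκ.aleph0_le (toFinite _)
  suffices ∃ r ∈ C.quotBefore y δ, f ≤ r ∧ q ≤ r by
    obtain ⟨r, hr, h1, h2⟩ := this
    obtain ⟨r', h3, h4, h5, h6⟩ := hC.interpolation f q r h1 h2
    exact ⟨r', isLowerSet_quotBefore hC hst h5 hr, h3, h4, h6⟩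
  rcases hdec {f, q} (hpair f q) with ⟨s, hs, hs', _⟩ | ⟨t, ht, htd, ht'⟩
  · exact ⟨s, hs, hs' (by simp), hs' (by simp)⟩
  exfalso
  rcases hdec {q, t} (hpair q t) with ⟨s, hs, hs', _⟩ | ⟨t', htq, htd', ht''⟩
  · have hqs : q ≤ C.restr s γ := hC.le_restr_iff.2 ⟨hs' (by simp), hd⟩
    have hts : t ≤ C.restr s γ :=
      hC.le_restr_iff.2 ⟨hs' (by simp), htd.trans (Iio_subset_Iio hζ)⟩
    obtain ⟨x, h1, h2, _⟩ := hC.amalgam hγ (hle.trans hqs) (hC.dom_restr_subset _ _)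
    refine ht' ⟨x, ?_, hts.trans h2⟩
    rintro p (rfl | rfl)
    · exact h1
    · exact hqs.trans h2
  · obtain ⟨x, hx, hqx⟩ := exists_compatible hC hst hδ hδ0 hκ hq (hpair t t')
      (by rintro p (rfl | rfl) <;> assumption) (by rintro p (rfl | rfl) <;> assumption)
    refine ht'' ⟨x, ?_, hx (by simp)⟩
    rintro p (rfl | rfl)
    · exact hqx
    · exact hx (by simp)

theorem isGeneric_quotBefore (hst : ∀ β < δ, C.IsStage y β (y β))
    (hδ : δ < (succ κ).ord) (hδ0 : δ ≠ 0) (hκ : κ.IsRegular)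
    (hdec : C.DecidesBounds (heightBefore y δ) (C.quotBefore y δ)) :
    C.IsGeneric (heightBefore y δ) (C.quotBefore y δ ∩ C.below (heightBefore y δ)) := by
  refine ⟨inter_subset_right, fun a b hab ha => ⟨isLowerSet_quotBefore hC hst hab ha.1,
    (hC.dom_mono _ _ hab).trans ha.2⟩, fun X hX hXs => ?_, fun p hp hpn => ?_⟩
  · obtain ⟨r, h1, h2, h3⟩ := directed_quotBefore hC hst hδ hδ0 hκ hXs
      (fun p hp => (hX hp).1) (fun p hp => (hX hp).2)
    exact ⟨r, ⟨h1, h2⟩, h3⟩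
  · rcases hdec {p} (isSmall_of_finite hκ.aleph0_le (finite_singleton _)) with
      ⟨s, hs, hs', _⟩ | ⟨t, ht, htd, ht'⟩
    · exact absurd ⟨isLowerSet_quotBefore hC hst (hs' rfl) hs, hp⟩ hpn
    · exact ⟨t, ⟨ht, htd⟩, fun ⟨r, h1, h2⟩ => ht' ⟨r, by simpa [upperBounds] using h1, h2⟩⟩

/-- A generic ideal that contains the earlier ideals contains a bound of small cofinally many
restrictions of p, hence p; so the low part of the quotient is the least such ideal. -/
theorem idealBefore_eq (hst : ∀ β < δ, C.IsStage y β (y β))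
    (hδ : δ < (succ κ).ord) (hδ0 : δ ≠ 0) (hκ : κ.IsRegular)
    (hdec : C.DecidesBounds (heightBefore y δ) (C.quotBefore y δ)) :
    C.idealBefore y δ = C.quotBefore y δ ∩ C.below (heightBefore y δ) := by
  apply Subset.antisymm
  · rintro p ⟨_, h⟩
    refine h _ (isGeneric_quotBefore hC hst hδ hδ0 hκ hdec) fun β hβ q hq => ?_
    exact ⟨mem_quotBefore_of_mem hC hst hβ hq,
      ((hst β hβ).subset hq).trans (Iio_subset_Iio (le_heightBefore hβ))⟩
  · rintro p ⟨hp, hpd⟩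
    refine ⟨hδ0, fun H hH hsub => ?_⟩
    obtain ⟨B, hB, hBne, hBs, hBc⟩ := exists_small_cofinal (y := y) hC hδ0
      (isSmall_dom (C := C) p) hκ.aleph0_le
    obtain ⟨r, hr, hr'⟩ := hH.directed ((fun b => C.restr p (y b).height) '' B) (by
      rintro _ ⟨b, hb, rfl⟩
      exact hsub b (hB hb) (hp b (hB hb))) (hBs.image _)
    refine hH.isLowerSet (?_ : p ≤ r) hr
    refine hC.le_of_restr_le (B := (fun b => (y b).height) '' B) (hBne.image _)
      (heightBefore_lt hκ.aleph0_le hδ hst) ?_ ?_ ?_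
    · rintro _ ⟨b, hb, rfl⟩; exact le_heightBefore (hB hb)
    · intro ξ hξ
      obtain ⟨b, hb, h⟩ := hBc ξ hξ (hpd hξ)
      exact ⟨_, ⟨b, hb, rfl⟩, h⟩
    · rintro _ ⟨b, hb, rfl⟩
      exact hr' _ ⟨b, hb, rfl⟩

/-- Identifies the set in which the moves of player I live with the one that the construction
controls. At δ = 0 both are all of P. -/
theorem genericQuotient_idealBefore (hst : ∀ β < δ, C.IsStage y β (y β))
    (hδ : δ < (succ κ).ord) (hκ : κ.IsRegular)
    (hdec : C.DecidesBounds (heightBefore y δ) (C.quotBefore y δ)) :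
    genericQuotient (C.idealBefore y δ) = C.quotBefore y δ := by
  rcases eq_or_ne δ 0 with rfl | hδ0
  · ext p
    refine ⟨fun _ β hβ => absurd hβ (by simp), fun _ r hr => absurd rfl hr.1⟩
  · rw [idealBefore_eq hC hst hδ hδ0 hκ hdec]
    have hg := isGeneric_quotBefore hC hst hδ hδ0 hκ hdec
    apply Subset.antisymm
    · intro p hp
      rw [mem_quotBefore_iff hC]
      by_contra hn
      obtain ⟨q, hq, hq'⟩ := hg.decides (C.restr p (heightBefore y δ)) (hC.dom_restr_subset _ _)
        fun h => hn h.1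
      obtain ⟨s, h1, h2⟩ := hp q hq
      exact hq' ⟨s, (hC.restr_le _ _).trans h1, h2⟩
    · intro p hp r hr
      obtain ⟨x, hx, hpx⟩ := exists_compatible hC hst hδ hδ0 hκ hp (X := {r})
        (isSmall_of_finite hκ.aleph0_le (finite_singleton _)) (by rintro p rfl; exact hr.1)
        (by rintro p rfl; exact hr.2)
      exact ⟨x, hpx, hx rfl⟩

omit hC in
theorem heightBefore_succ (hst : ∀ β ≤ δ, C.IsStage y β (y β)) :
    heightBefore y (Order.succ δ) = (y δ).height := by
  apply le_antisymm
  · refine le_of_forall_lt fun ξ hξ => ?_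
    obtain ⟨β, hβ, h⟩ := lt_heightBefore.1 hξ
    rcases (Order.lt_succ_iff.1 hβ).eq_or_lt with rfl | h2
    · exact h
    · exact h.trans ((hst δ le_rfl).lt_height β h2)
  · exact le_heightBefore (Order.lt_succ δ)

theorem quotBefore_succ (hst : ∀ β ≤ δ, C.IsStage y β (y β)) :
    C.quotBefore y (Order.succ δ) = {p | C.restr p (y δ).height ∈ (y δ).ideal} := by
  ext p
  refine ⟨fun h => h δ (Order.lt_succ δ), fun h β hβ => ?_⟩
  rcases (Order.lt_succ_iff.1 hβ).eq_or_lt with rfl | h2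
  · exact h
  · have := (hst δ le_rfl).restr_mem _ h β h2
    rwa [hC.restr_restr ((hst δ le_rfl).lt_height β h2).le] at this

/-- The low part of the quotient before δ + 1 is G_δ itself. Density is applied to the least
condition, whose domain is empty, so that the set w obtained stays below ζ_δ. -/
theorem goodII_of_dec (hκ : κ.IsRegular) (hδ : δ < (succ κ).ord)
    (hst : ∀ β ≤ δ, C.IsStage y β (y β)) {x : Ordinal.{u} → MoveI.{u, v} P}
    (hx : (x δ).elt ∈ (y δ).ideal)
    (hdec : C.DecidesBounds (heightBefore y (Order.succ δ)) (C.quotBefore y (Order.succ δ)))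
    (hD : ∀ β ≤ δ, ∀ D ∈ (x β).systems,
      C.DenseIn (heightBefore y (Order.succ δ)) (C.quotBefore y (Order.succ δ)) D) :
    C.GoodII x y δ := by
  have hδ' : Order.succ δ < (succ κ).ord :=
    (Cardinal.isSuccLimit_ord (hκ.aleph0_le.trans (Order.le_succ κ))).succ_lt hδ
  have hst' : ∀ β < Order.succ δ, C.IsStage y β (y β) := fun β hβ => hst β (Order.lt_succ_iff.1 hβ)
  have hgen := isGeneric_quotBefore hC hst' hδ' (by simp) hκ hdec
  have heq : C.quotBefore y (Order.succ δ) ∩ C.below (y δ).height = (y δ).ideal := by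
    rw [quotBefore_succ hC hst]
    ext p
    constructor
    · rintro ⟨h1, h2⟩
      have h3 : C.restr p (y δ).height = p := hC.restr_eq_self h2
      rw [mem_ofPred_eq, h3] at h1
      exact h1
    · intro h
      exact ⟨(hst δ le_rfl).isLowerSet (hC.restr_le _ _) h, (hst δ le_rfl).subset h⟩
  rw [heightBefore_succ hst, heq] at hgen
  refine ⟨(hst δ le_rfl).height_lt, hgen, fun β hβ => ⟨(hst δ le_rfl).lt_height β hβ,
    (hst δ le_rfl).ideal_subset β hβ⟩, hx, fun β hβ D hDm u hu => ?_⟩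
  obtain ⟨b, hb, hb'⟩ := hC.exists_bot hκ.pos
  have hbQ : b ∈ C.quotBefore y (Order.succ δ) :=
    isLowerSet_quotBefore hC hst' (hb' (x δ).elt)
      (mem_quotBefore_of_mem hC hst' (Order.lt_succ δ) hx)
  obtain ⟨s, hs, _, w, hw, huw, hwd, hsd, hsD⟩ := hD β hβ D hDm b hbQ u (isSmall_ordinal.2 hu.2)
    (hu.1.trans (Iio_subset_Iio (hst δ le_rfl).height_lt.le))
  rw [heightBefore_succ hst, hb, empty_union, union_eq_self_of_subset_right hu.1] at hwd
  refine ⟨w, ⟨hwd, isSmall_ordinal.1 hw⟩, huw, s, ?_, hsD⟩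
  rw [← heq]
  exact ⟨hs, hsd.trans hwd⟩

end Coding

/-! ### Winning by maintaining an invariant of the levels. -/

namespace Coding

variable {κ : Cardinal.{u}} {P : Type v} [PartialOrder P]

/-- The sequence of levels chosen by player II, when player I plays `x` and player II chooses at
each stage a level that satisfies `Lev` if there is one. -/
noncomputable def run {L : Type*} [Nonempty L] (mv : L → MoveI.{u, v} P)
    (Lev : (Ordinal.{u} → L) → Ordinal.{u} → L → Prop) (x : Ordinal.{u} → MoveI.{u, v} P) :
    Ordinal.{u} → L :=
  WellFounded.fix (C := fun _ => L) Ordinal.lt_wf fun δ r => Classical.epsilon fun l =>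
    mv l = x δ ∧ Lev (fun β => if h : β < δ then r β h else Classical.arbitrary L) δ l

section Run

variable {L : Type*} [Nonempty L] {mv : L → MoveI.{u, v} P}
  {Lev : (Ordinal.{u} → L) → Ordinal.{u} → L → Prop}

theorem run_eq (x : Ordinal.{u} → MoveI.{u, v} P) (δ : Ordinal.{u}) :
    run mv Lev x δ = Classical.epsilon fun l => mv l = x δ ∧
      Lev (fun β => if β < δ then run mv Lev x β else Classical.arbitrary L) δ l := by
  conv_lhs => rw [run, WellFounded.fix_eq]
  rfl

theorem run_congr {x x' : Ordinal.{u} → MoveI.{u, v} P} {δ : Ordinal.{u}}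
    (h : ∀ β ≤ δ, x β = x' β) : run mv Lev x δ = run mv Lev x' δ := by
  induction δ using WellFoundedLT.induction with
  | ind δ ih =>
    rw [run_eq, run_eq, h δ le_rfl]
    have : (fun β => if β < δ then run mv Lev x β else Classical.arbitrary L) =
        fun β => if β < δ then run mv Lev x' β else Classical.arbitrary L := by
      funext β
      split_ifs with hβ
      · exact ih β hβ fun γ hγ => h γ (hγ.trans hβ.le)
      · rfl
    rw [this]

end Run

/-- A sufficient condition for a winning strategy: player II can maintain a property `Lev` of
levels that makes the quotient by the ideals played so far decide bounds and makes all the systems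
played so far dense. -/
theorem exists_isWinningII {C : Coding κ P} (hC : C.IsUniform) (hκ : κ.IsRegular)
    {L : Type*} [Nonempty L] (mv : L → MoveI.{u, v} P) (toII : L → MoveII.{u, v} P)
    (Lev : (Ordinal.{u} → L) → Ordinal.{u} → L → Prop)
    (hcongr : ∀ δ Λ Λ' l, (∀ β < δ, Λ β = Λ' β) → Lev Λ δ l → Lev Λ' δ l)
    (hstage : ∀ δ Λ l, Lev Λ δ l →
      C.IsStage (toII ∘ Λ) δ (toII l) ∧ (mv l).elt ∈ (toII l).ideal)
    (hdec : ∀ δ < (succ κ).ord, ∀ Λ, (∀ β < δ, Lev Λ β (Λ β)) →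
      C.DecidesBounds (heightBefore (toII ∘ Λ) δ) (C.quotBefore (toII ∘ Λ) δ) ∧
      ∀ β < δ, ∀ D ∈ (mv (Λ β)).systems,
        C.DenseIn (heightBefore (toII ∘ Λ) δ) (C.quotBefore (toII ∘ Λ) δ) D)
    (hex : ∀ δ < (succ κ).ord, ∀ Λ, (∀ β < δ, Lev Λ β (Λ β)) → ∀ m,
      C.LegalI (toII ∘ Λ) δ m → ∃ l, mv l = m ∧ Lev Λ δ l) :
    ∃ σ : StrategyII.{u, v} P, C.IsWinningII σ := by
  classical
  -- Beyond α the moves are filled in by the last known one; the run up to α does not depend on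
  -- them.
  let σ : StrategyII.{u, v} P := fun α m => toII (run mv Lev
    (fun β => if h : β ≤ α then m ⟨β, h⟩ else m ⟨α, self_mem_Iic⟩) α)
  have hplay : ∀ x, σ.play x = toII ∘ run mv Lev x := by
    intro x
    funext α
    refine congrArg toII (run_congr fun β hβ => ?_)
    simp only [dif_pos hβ]
  refine ⟨σ, fun x α hα hleg => ?_⟩
  rw [hplay] at hleg ⊢
  have key : ∀ β ≤ α, mv (run mv Lev x β) = x β ∧
      Lev (run mv Lev x) β (run mv Lev x β) := by
    intro β
    induction β using WellFoundedLT.induction with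
    | ind β ih =>
      intro hβ
      obtain ⟨l, hl1, hl2⟩ := hex β (hβ.trans_lt hα) (run mv Lev x)
        (fun γ hγ => (ih γ hγ (hγ.le.trans hβ)).2) (x β) (hleg β hβ)
      have hc : ∀ γ < β, run mv Lev x γ =
          (fun γ => if γ < β then run mv Lev x γ else Classical.arbitrary L) γ :=
        fun γ hγ => by simp only [if_pos hγ]
      have := Classical.epsilon_spec (p := fun l => mv l = x β ∧
        Lev (fun γ => if γ < β then run mv Lev x γ else Classical.arbitrary L) β l)
        ⟨l, hl1, hcongr _ _ _ _ hc hl2⟩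
      rw [← run_eq] at this
      exact ⟨this.1, hcongr _ _ _ _ (fun γ hγ => (hc γ hγ).symm) this.2⟩
  have hα' : Order.succ α < (succ κ).ord :=
    (Cardinal.isSuccLimit_ord (hκ.aleph0_le.trans (Order.le_succ κ))).succ_lt hα
  obtain ⟨h1, h2⟩ := hdec _ hα' (run mv Lev x) fun β hβ => (key β (Order.lt_succ_iff.1 hβ)).2
  refine goodII_of_dec hC hκ hα (fun β hβ => (hstage _ _ _ (key β hβ).2).1) ?_ h1 fun β hβ D hD =>
    h2 β (Order.lt_succ_iff.2 hβ) D ?_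
  · have := (hstage _ _ _ (key α le_rfl).2).2
    rwa [(key α le_rfl).1] at this
  · rwa [(key β hβ).1]

end Coding

/-! ### Deciding bounds in the quotient. -/

namespace Coding

variable {κ : Cardinal.{u}} {P : Type v} [PartialOrder P] {C : Coding κ P}
  {y : Ordinal.{u} → MoveII.{u, v} P} {δ : Ordinal.{u}}

theorem quotBefore_zero : C.quotBefore y 0 = Set.univ :=
  eq_univ_of_forall fun _ _ hβ => absurd hβ (by simp)

variable (hC : C.IsUniform)

include hC

theorem exists_bounded_or_not [Nonempty P] (hκ : κ.IsRegular) {X : Set P} (hX : IsSmall κ X) :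
    (∃ s ∈ upperBounds X, C.dom s ⊆ ⋃ p ∈ X, C.dom p) ∨ ¬ (upperBounds X).Nonempty := by
  by_cases h : (upperBounds X).Nonempty
  · obtain ⟨y, hy⟩ := h
    obtain ⟨x, _, hx, hxd⟩ := hC.interpolation_small hκ hX hy
    exact Or.inl ⟨x, hx, hxd.le⟩
  · exact Or.inr h

theorem decidesBounds_zero [Nonempty P] (hκ : κ.IsRegular) :
    C.DecidesBounds (heightBefore y 0) (C.quotBefore y 0) := by
  intro X hX
  rw [quotBefore_zero]
  rcases exists_bounded_or_not hC hκ hX with ⟨s, hs, hsd⟩ | h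
  · exact Or.inl ⟨s, mem_univ _, hs, hsd.trans subset_union_right⟩
  · obtain ⟨b, hb, _⟩ := hC.exists_bot hκ.pos
    exact Or.inr ⟨b, mem_univ _, by simp [hb], fun ⟨x, hx, _⟩ => h ⟨x, hx⟩⟩

theorem denseIn_of_isDensitySystem (hst : ∀ β < δ, C.IsStage y β (y β))
    (hδ : δ < (succ κ).ord) (hκ : κ.IsRegular)
    (hdec : C.DecidesBounds (heightBefore y δ) (C.quotBefore y δ)) {D : SystemFun.{u, v} P}
    (hD : C.IsDensitySystem (heightBefore y δ) (C.idealBefore y δ) D) :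
    C.DenseIn (heightBefore y δ) (C.quotBefore y δ) D := by
  intro a ha x hx hxκ
  have hq := genericQuotient_idealBefore hC hst hδ hκ hdec
  have hw : IsSmall κ (C.dom a ∪ x) := (isSmall_dom a).union hκ.aleph0_le hx
  have hwm : C.dom a ∪ x ∈ SmallSubsets κ (Iio (succ κ).ord) :=
    ⟨union_subset (C.dom_mem a).1 hxκ, isSmall_ordinal.1 hw⟩
  obtain ⟨s, hs, has⟩ := hD.dense _ hwm x subset_union_right a (hq ▸ ha) subset_union_left
  have := hD.subset _ hwm x subset_union_right hs
  exact ⟨s, hq ▸ this.1, has, _, hw, subset_union_right, subset_union_right, this.2, hs⟩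

/-- Above every element of the quotient it can be decided whether a small set is bounded. -/
theorem exists_decide_above (hst : ∀ β < δ, C.IsStage y β (y β))
    (hδ : δ < (succ κ).ord) (hκ : κ.IsRegular)
    (hdec : C.DecidesBounds (heightBefore y δ) (C.quotBefore y δ)) {p : P}
    (hp : p ∈ C.quotBefore y δ) {X : Set P} (hX : IsSmall κ X) :
    (∃ s ∈ C.quotBefore y δ, s ∈ upperBounds X ∧ p ≤ s ∧
      C.dom s ⊆ Iio (heightBefore y δ) ∪ (C.dom p ∪ ⋃ p ∈ X, C.dom p)) ∨
    ∃ p' ∈ C.quotBefore y δ, p ≤ p' ∧ C.dom p' ⊆ Iio (heightBefore y δ) ∪ C.dom p ∧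
      ¬ ∃ x ∈ upperBounds X, p' ≤ x := by
  have : Nonempty P := ⟨p⟩
  have hX' : IsSmall κ (insert p X) := by
    rw [← singleton_union]
    exact (isSmall_of_finite hκ.aleph0_le (finite_singleton _)).union hκ.aleph0_le hX
  rcases eq_or_ne δ 0 with rfl | hδ0
  · rw [quotBefore_zero]
    rcases exists_bounded_or_not hC hκ hX' with ⟨s, hs, hsd⟩ | h
    · rw [biUnion_insert] at hsd
      exact Or.inl ⟨s, mem_univ _, fun q hq => hs (mem_insert_of_mem _ hq), hs (mem_insert _ _),
        hsd.trans subset_union_right⟩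
    · refine Or.inr ⟨p, mem_univ _, le_rfl, subset_union_right, fun ⟨x, hx, hpx⟩ => h ⟨x, ?_⟩⟩
      rintro q (rfl | hq)
      · exact hpx
      · exact hx hq
  · rcases hdec _ hX' with ⟨s, hs, hsX, hsd⟩ | ⟨t, ht, htd, h⟩
    · rw [biUnion_insert] at hsd
      exact Or.inl ⟨s, hs, fun q hq => hsX (mem_insert_of_mem _ hq), hsX (mem_insert _ _), hsd⟩
    -- The low witness t against `X` together with p is joined to p in two moves: below the height
    -- by directedness, then by amalgamation.
    · obtain ⟨q, hq, hqd, hqX⟩ := directed_quotBefore hC hst hδ hδ0 hκ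
        (X := {C.restr p (heightBefore y δ), t})
        (isSmall_of_finite hκ.aleph0_le (toFinite _))
        (by
          rintro x (rfl | rfl)
          · exact (mem_quotBefore_iff hC).1 hp
          · exact ht)
        (by
          rintro x (rfl | rfl)
          · exact hC.dom_restr_subset _ _
          · exact htd)
      obtain ⟨r, hr, h1, h2, h3⟩ := (isNice_quotBefore hC hst hδ hκ hdec).amalgam p hp q hq _
        (heightBefore_lt hκ.aleph0_le hδ hst) le_rfl (hqX (by simp)) hqd
      refine Or.inr ⟨r, hr, h1, ?_, fun ⟨x, hx, hrx⟩ => h ⟨x, ?_, ?_⟩⟩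
      · rw [h3, union_comm]; exact union_subset_union_left _ hqd
      · rintro q (rfl | hq)
        · exact h1.trans hrx
        · exact hx hq
      · exact (hqX (by simp)).trans (h2.trans hrx)

end Coding

/-! ### The case κ = ℵ₀. -/

/-- A sequence in which each of countably many tasks is carried out cofinally often. -/
theorem exists_seq_of_tasks {P : Type v} [Preorder P] {α : Type*} {S : Set α} (hS : S.Countable)
    (Q : Set P) (T : α → P → P → Prop) {p₀ : P} (h₀ : p₀ ∈ Q)
    (hT : ∀ a ∈ S, ∀ p ∈ Q, ∃ p' ∈ Q, p ≤ p' ∧ T a p p') :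
    ∃ p : ℕ → P, Monotone p ∧ p 0 = p₀ ∧ (∀ n, p n ∈ Q) ∧
      ∀ a ∈ S, ∀ n, ∃ m ≥ n, T a (p m) (p (m + 1)) := by
  rcases S.eq_empty_or_nonempty with rfl | hne
  · exact ⟨fun _ => p₀, monotone_const, rfl, fun _ => h₀, by simp⟩
  obtain ⟨e, rfl⟩ := hS.exists_eq_range hne
  choose! F hF1 hF2 hF3 using fun k : ℕ => hT (e k) (mem_range_self k)
  -- Step n carries out the task numbered `n.unpair.1`, so task k recurs at every `Nat.pair k n`.
  let p : ℕ → P := fun n => Nat.rec p₀ (fun n q => F n.unpair.1 q) n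
  have hp : ∀ n, p (n + 1) = F n.unpair.1 (p n) := fun n => rfl
  have hpQ : ∀ n, p n ∈ Q := fun n => by
    induction n with
    | zero => exact h₀
    | succ n ih => rw [hp]; exact hF1 _ _ ih
  refine ⟨p, monotone_nat_of_le_succ fun n => ?_, rfl, hpQ, ?_⟩
  · rw [hp]; exact hF2 _ _ (hpQ n)
  · rintro _ ⟨k, rfl⟩ n
    refine ⟨Nat.pair k n, Nat.right_le_pair k n, ?_⟩
    rw [hp, Nat.unpair_pair]
    exact hF3 _ _ (hpQ _)

/-- An order preserving map that fixes `ζ` and carries a subset of `ζ + ω` onto a given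
finite set. -/
theorem exists_isShift_of_finite {κ : Cardinal.{u}} (hκ : ℵ₀ ≤ κ) {ζ : Ordinal.{u}}
    (hζ : ζ < (succ κ).ord) {W : Set Ordinal.{u}} (hW : W.Finite)
    (hWκ : W ⊆ Iio (succ κ).ord) : ∃ h : Ordinal.{u} → Ordinal.{u}, IsShift κ h ∧
      (∀ ξ < ζ, h ξ = ξ) ∧ W ⊆ range h ∧ ∀ ξ, h ξ ∈ W → ξ < ζ + ω := by
  obtain ⟨b, hb, hWb⟩ := (isSmall_of_finite hκ hW).succ.exists_bound (Cardinal.isRegular_succ hκ)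
    id fun ξ h => hWκ h
  have hθ : max b ζ < (succ κ).ord := max_lt hb hζ
  have hmono := shift_strictMono (Iio ζ ∪ W) (max b ζ)
  refine ⟨shift (Iio ζ ∪ W) (max b ζ), isShift_shift hκ _ hθ, fun ξ hξ => ?_, ?_, fun ξ hξ => ?_⟩
  · have hid : ∀ ξ, shift (Iio ζ) ζ ξ = ξ := fun ξ => by
      rw [shift, Iio_union_Ici, Ordinal.enumOrd_univ, id]
    have := shift_eq_of_inter_eq (w := Iio ζ) (w' := Iio ζ ∪ W) (θ := ζ) (θ' := max b ζ) (γ := ζ)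
      le_rfl (le_max_right _ _) (by rw [inter_self, inter_eq_self_of_subset_right subset_union_left])
      (ξ := ξ) (by rwa [hid])
    rwa [hid] at this
  · rw [range_shift]
    exact fun ξ hξ => Or.inl (Or.inr hξ)
  · by_contra hn
    -- If ξ were at least ζ + ω, all points ζ + n would be mapped into the finite set W.
    have hlt : ∀ n : ℕ, ζ + n < ξ := fun n =>
      (add_lt_add_right (Ordinal.natCast_lt_omega0 n) ζ).trans_le (not_lt.1 hn)
    refine Set.infinite_of_injective_forall_mem (s := W)
      (f := fun n : ℕ => shift (Iio ζ ∪ W) (max b ζ) (ζ + n)) (fun m n hmn => ?_) (fun n => ?_) hW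
    · have := hmono.injective hmn
      simpa using this
    · have h1 : shift (Iio ζ ∪ W) (max b ζ) (ζ + n) ∈ (Iio ζ ∪ W) ∪ Ici (max b ζ) := by
        rw [← range_shift]; exact mem_range_self _
      rcases h1 with (h1 | h1) | h1
      · exact absurd (le_self_add.trans (hmono.le_apply (x := ζ + n))) (not_le.2 h1)
      · exact h1
      · refine absurd ((le_max_left _ _).trans (h1.trans (hmono (hlt n)).le)) (not_le.2 ?_)
        exact hWb _ hξ

namespace Coding

section Transport

variable {κ : Cardinal.{u}} {P : Type v} [PartialOrder P] {C : Coding κ P}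

theorem IsUniform.map_eq_self (hC : C.IsUniform) {h : Ordinal.{u} → Ordinal.{u}}
    (hh : IsShift κ h) {p : P} (H : ∀ ξ ∈ C.dom p, h ξ = ξ) : C.map h p = p :=
  hC.map_eq hh ⟨rfl, by rw [image_congr H, image_id']⟩

theorem IsUniform.restr_map (hC : C.IsUniform) {h : Ordinal.{u} → Ordinal.{u}}
    (hh : IsShift κ h) {ζ : Ordinal.{u}} (hid : ∀ ξ < ζ, h ξ = ξ) (p : P) :
    C.restr (C.map h p) ζ = C.restr p ζ := by
  rw [← hC.map_restr hh (γ := ζ) (γ' := ζ)]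
  · refine hC.map_eq_self hh fun ξ hξ => hid ξ (hC.dom_restr_subset _ _ hξ)
  · intro ξ _
    refine ⟨fun h => by rwa [hid ξ h], fun h => ?_⟩
    exact hh.strictMono.le_apply.trans_lt h

end Transport

variable {P : Type v} [PartialOrder P]

/-- The quotient by the ideal of a move. -/
def quotOf {κ : Cardinal.{u}} (C : Coding κ P) (m : MoveII.{u, v} P) : Set P :=
  {p | C.restr p m.height ∈ m.ideal}

/-- The properties maintained by player II when `κ` is countable. -/
structure CountableLevel (C : Coding ℵ₀ P)
    (Λ : Ordinal.{u} → MoveII.{u, v} P × MoveI.{u, v} P)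
    (δ : Ordinal.{u}) (l : MoveII.{u, v} P × MoveI.{u, v} P) : Prop where
  stage : C.IsStage (Prod.fst ∘ Λ) δ l.1
  elt_mem : l.2.elt ∈ l.1.ideal
  legal : C.LegalI (Prod.fst ∘ Λ) δ l.2
  decides : C.DecidesBounds l.1.height (C.quotOf l.1)
  dense : ∀ D ∈ l.2.systems, C.DenseIn l.1.height (C.quotOf l.1) D
  dense_before : ∀ β < δ, ∀ D ∈ (Λ β).2.systems, C.DenseIn l.1.height (C.quotOf l.1) D

variable {C : Coding ℵ₀ P} {Λ : Ordinal.{u} → MoveII.{u, v} P × MoveI.{u, v} P}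
  {δ : Ordinal.{u}}

theorem CountableLevel.congr {Λ' : Ordinal.{u} → MoveII.{u, v} P × MoveI.{u, v} P}
    {l : MoveII.{u, v} P × MoveI.{u, v} P} (h : ∀ β < δ, Λ β = Λ' β)
    (hl : C.CountableLevel Λ δ l) : C.CountableLevel Λ' δ l := by
  have h' : ∀ β < δ, (Prod.fst ∘ Λ) β = (Prod.fst ∘ Λ') β := fun β hβ => congrArg Prod.fst (h β hβ)
  exact ⟨isStage_congr h' hl.stage, hl.elt_mem, legalI_congr h' hl.legal, hl.decides, hl.dense,
    fun β hβ D hD => hl.dense_before β hβ D (by rwa [h β hβ])⟩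

theorem countable_setOf_dom {θ : Ordinal.{u}} (hθ : (Iio θ).Countable) :
    {p | C.dom p ⊆ Iio θ}.Countable := by
  have h1 : (Iio (ℵ₀ : Cardinal.{u}).ord).Countable := by
    rw [Cardinal.ord_aleph0, ← Cardinal.le_aleph0_iff_set_countable, Cardinal.mk_Iio_ordinal]
    simp
  have h2 := Set.countable_ofPred_finite_subset hθ
  refine Set.MapsTo.countable_of_injOn (f := fun p => (C.code p, C.dom p)) (t := _ ×ˢ _)
    (fun p hp => ?_) (fun p _ q _ hpq => ?_) (h1.prod h2)
  · exact ⟨C.code_lt p, isSmall_aleph0.1 (isSmall_dom p), hp⟩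
  · exact C.inj p q (congrArg Prod.fst hpq) (congrArg Prod.snd hpq)

end Coding

namespace Coding

variable {P : Type v} [PartialOrder P]
variable {C : Coding ℵ₀ P} {Λ : Ordinal.{u} → MoveII.{u, v} P × MoveI.{u, v} P}
  {δ : Ordinal.{u}}

/-- Limits are harmless when small means finite: among finitely many stages there is a last one, and
its height bounds all the relevant points. -/
theorem exists_max_cofinal (hC : C.IsUniform) {y : Ordinal.{u} → MoveII.{u, v} P} (hδ0 : δ ≠ 0)
    (hst : ∀ β < δ, C.IsStage y β (y β)) {x : Set Ordinal.{u}} (hx : x.Finite) {β₀ : Ordinal.{u}}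
    (hβ₀ : β₀ < δ) :
    ∃ β < δ, β₀ ≤ β ∧ ∀ ξ ∈ x, ξ < heightBefore y δ → ξ < (y β).height := by
  obtain ⟨B, hB, hBne, hBs, hBc⟩ := exists_small_cofinal (C := C) (y := y) hC hδ0
    (isSmall_aleph0.2 hx) le_rfl
  have hfin : (insert β₀ B).Finite := (isSmall_aleph0.1 hBs).insert β₀
  obtain ⟨β, hβ, hmax⟩ := hfin.exists_maximal (insert_nonempty _ _)
  have hmax' : ∀ b ∈ insert β₀ B, b ≤ β := fun b hb => by
    rcases le_total b β with h | h
    · exact h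
    · exact hmax hb h
  have hβδ : β < δ := by
    rcases hβ with rfl | h
    · exact hβ₀
    · exact hB h
  refine ⟨β, hβδ, hmax' β₀ (mem_insert _ _), fun ξ hξ hlt => ?_⟩
  obtain ⟨b, hb, h1⟩ := hBc ξ hξ hlt
  rcases (hmax' b (mem_insert_of_mem _ hb)).eq_or_lt with rfl | h2
  · exact h1
  · exact h1.trans ((hst β hβδ).lt_height b h2)

/-- An instance involves finitely many ordinals, so it is settled at a single stage β. The answer
passes to the quotient before δ because its points below ζ_{<δ} are already below ζ_β. -/
theorem decides_of_countableLevel [Nonempty P] (hC : C.IsUniform) (hδ : δ < (succ ℵ₀).ord)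
    (hΛ : ∀ β < δ, C.CountableLevel Λ β (Λ β)) :
    C.DecidesBounds (heightBefore (Prod.fst ∘ Λ) δ) (C.quotBefore (Prod.fst ∘ Λ) δ) ∧
      ∀ β < δ, ∀ D ∈ (Λ β).2.systems,
        C.DenseIn (heightBefore (Prod.fst ∘ Λ) δ) (C.quotBefore (Prod.fst ∘ Λ) δ) D := by
  have hst : ∀ β < δ, C.IsStage (Prod.fst ∘ Λ) β ((Prod.fst ∘ Λ) β) := fun β hβ => (hΛ β hβ).stage
  have hmem : ∀ β < δ, ∀ s ∈ C.quotOf (Λ β).1, (∀ ξ ∈ C.dom s, ξ < heightBefore (Prod.fst ∘ Λ) δ →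
      ξ < (Λ β).1.height) → s ∈ C.quotBefore (Prod.fst ∘ Λ) δ := by
    intro β hβ s hs hd
    refine mem_quotBefore_of_cofinal hC hst hδ le_rfl (B := {β}) (by simpa using hβ)
      (singleton_nonempty _) (isSmall_aleph0.2 (finite_singleton _)) (fun ξ hξ h => ⟨β, rfl, ?_⟩) ?_
    · exact hd ξ hξ h
    · rintro b rfl; exact hs
  have hle : ∀ β < δ, (Λ β).1.height ≤ heightBefore (Prod.fst ∘ Λ) δ := fun β hβ =>
    le_heightBefore (y := Prod.fst ∘ Λ) hβ
  rcases eq_or_ne δ 0 with rfl | hδ0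
  · exact ⟨decidesBounds_zero hC isRegular_aleph0, fun β hβ => absurd hβ (by simp)⟩
  constructor
  · intro X hX
    obtain ⟨β, hβ, _, hc⟩ := exists_max_cofinal hC hδ0 hst (isSmall_aleph0.1
      (hX.biUnion isRegular_aleph0 (f := C.dom) fun p _ => isSmall_dom p))
      (pos_iff_ne_zero.2 hδ0)
    rcases (hΛ β hβ).decides X hX with ⟨s, hs, hsX, hsd⟩ | ⟨t, ht, htd, h⟩
    · refine Or.inl ⟨s, hmem β hβ s hs fun ξ hξ hlt => ?_, hsX,
        hsd.trans (union_subset_union_left _ (Iio_subset_Iio (hle β hβ)))⟩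
      rcases hsd hξ with h1 | h1
      · exact h1
      · exact hc ξ h1 hlt
    · refine Or.inr ⟨t, ?_, htd.trans (Iio_subset_Iio (hle β hβ)), h⟩
      exact hmem β hβ t ht fun ξ hξ _ => htd hξ
  · intro β₀ hβ₀ D hD a ha x hx hxκ
    obtain ⟨β, hβ, hle', hc⟩ := exists_max_cofinal hC hδ0 hst (isSmall_aleph0.1
      ((isSmall_dom a).union le_rfl hx)) hβ₀
    have hdense : C.DenseIn (Λ β).1.height (C.quotOf (Λ β).1) D := by
      rcases hle'.eq_or_lt with rfl | h
      · exact (hΛ _ hβ).dense D hD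
      · exact (hΛ β hβ).dense_before β₀ h D hD
    obtain ⟨s, hs, has, w, hw, hxw, hwd, hsw, hsD⟩ := hdense a (ha β hβ) x hx hxκ
    refine ⟨s, hmem β hβ s hs fun ξ hξ hlt => ?_, has, w, hw, hxw,
      hwd.trans (union_subset_union_left _ (Iio_subset_Iio (hle β hβ))), hsw, hsD⟩
    rcases hwd (hsw hξ) with h1 | h1
    · exact h1
    · exact hc ξ h1 hlt

/-- A property of small sets of conditions, or of conditions and small sets, that is invariant
under order isomorphisms over `ζ` has to be checked only below `ζ + ω`. -/
theorem decidesBounds_of_below (hC : C.IsUniform) {m : MoveII.{u, v} P}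
    (hζ : m.height < (succ ℵ₀).ord)
    (h : ∀ X : Set P, X.Finite → (∀ p ∈ X, C.dom p ⊆ Iio (m.height + ω)) →
      (∃ s ∈ C.quotOf m, s ∈ upperBounds X ∧ C.dom s ⊆ Iio m.height ∪ ⋃ p ∈ X, C.dom p) ∨
      ∃ t ∈ C.quotOf m, C.dom t ⊆ Iio m.height ∧ ¬ ∃ x ∈ upperBounds X, t ≤ x) :
    C.DecidesBounds m.height (C.quotOf m) := by
  intro X hX
  obtain ⟨g, hg, hid, hW, hg'⟩ := exists_isShift_of_finite le_rfl hζ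
    (isSmall_aleph0.1 (hX.biUnion isRegular_aleph0 (f := C.dom) fun p _ => isSmall_dom p))
    (iUnion₂_subset fun p _ => (C.dom_mem p).1)
  have hX' : C.map g '' (C.map g ⁻¹' X) = X := by
    refine image_preimage_eq_of_subset fun p hp => ?_
    exact hC.exists_map_eq hg ((subset_biUnion_of_mem (u := C.dom) hp).trans hW)
  have hlow : ∀ ξ, g ξ < m.height ↔ ξ < m.height := fun ξ =>
    ⟨fun h => hg.strictMono.le_apply.trans_lt h, fun h => by rwa [hid ξ h]⟩
  rcases h (C.map g ⁻¹' X) ((isSmall_aleph0.1 hX).preimage (hC.map_injective hg).injOn) (by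
      intro p hp ξ hξ
      refine hg' ξ (mem_biUnion hp ?_)
      rw [hC.dom_map hg]; exact mem_image_of_mem _ hξ) with ⟨s, hs, hsX, hsd⟩ | ⟨t, ht, htd, hn⟩
  · refine Or.inl ⟨C.map g s, ?_, ?_, ?_⟩
    · change C.restr _ _ ∈ m.ideal
      rw [hC.restr_map hg hid]; exact hs
    · rw [← hX']
      rintro _ ⟨p, hp, rfl⟩
      exact hC.map_mono hg (hsX hp)
    · rw [hC.dom_map hg]
      rintro _ ⟨ξ, hξ, rfl⟩
      rcases hsd hξ with h1 | h1
      · exact Or.inl ((hlow ξ).2 h1)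
      · obtain ⟨p, hp, h2⟩ := mem_iUnion₂.1 h1
        refine Or.inr (mem_biUnion hp ?_)
        rw [hC.dom_map hg]; exact mem_image_of_mem _ h2
  · refine Or.inr ⟨t, ht, htd, fun ⟨x, hx, htx⟩ => hn ?_⟩
    have htm : C.map g t = t := hC.map_eq_self hg fun ξ hξ => hid ξ (htd hξ)
    obtain ⟨x', hx', hxX, hxd⟩ := hC.interpolation_small isRegular_aleph0 (X := insert t X)
      (isSmall_aleph0.2 ((isSmall_aleph0.1 hX).insert t)) (y := x) (by
        rintro p (rfl | hp)
        · exact htx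
        · exact hx hp)
    obtain ⟨x₀, rfl⟩ := hC.exists_map_eq hg (q := x') (by
      rw [hxd, biUnion_insert]
      refine union_subset (fun ξ hξ => ⟨ξ, hid ξ (htd hξ)⟩) hW)
    refine ⟨x₀, fun p hp => ?_, ?_⟩
    · exact (hC.map_le_map_iff hg).1 (hxX (mem_insert_of_mem _ hp))
    · rw [← htm] at hxX
      exact (hC.map_le_map_iff hg).1 (hxX (mem_insert _ _))

/-- The instance is pulled back along a map g that fixes everything below the height, and the
solution is pushed forward; uniformity of `D` is used between the identity and g. -/
theorem denseIn_of_below (hC : C.IsUniform) {m : MoveII.{u, v} P} (hζ : m.height < (succ ℵ₀).ord)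
    {α : Ordinal.{u}} (hα : α ≤ m.height) {G : Set P} {D : SystemFun.{u, v} P}
    (hD : C.IsDensitySystem α G D) (hG : C.quotOf m ⊆ genericQuotient G)
    (h : ∀ a ∈ C.quotOf m, C.dom a ⊆ Iio (m.height + ω) → ∀ x : Set Ordinal.{u}, x.Finite →
      x ⊆ Iio (m.height + ω) →
      ∃ s ∈ C.quotOf m, a ≤ s ∧ ∃ w : Set Ordinal.{u}, IsSmall (ℵ₀ : Cardinal.{u}) w ∧ x ⊆ w ∧
        w ⊆ Iio m.height ∪ (C.dom a ∪ x) ∧ C.dom s ⊆ w ∧ s ∈ D x w) :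
    C.DenseIn m.height (C.quotOf m) D := by
  intro a ha x hx hxκ
  obtain ⟨g, hg, hid, hW, hg'⟩ := exists_isShift_of_finite le_rfl hζ
    (isSmall_aleph0.1 ((isSmall_dom a).union le_rfl hx)) (union_subset (C.dom_mem a).1 hxκ)
  have hlow : ∀ ξ, g ξ < m.height ↔ ξ < m.height := fun ξ =>
    ⟨fun h => hg.strictMono.le_apply.trans_lt h, fun h => by rwa [hid ξ h]⟩
  obtain ⟨a₀, rfl⟩ := hC.exists_map_eq hg (subset_union_left.trans hW)
  have hx' : g '' (g ⁻¹' x) = x := image_preimage_eq_of_subset (subset_union_right.trans hW)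
  have ha₀ : a₀ ∈ C.quotOf m := by
    change C.restr _ _ ∈ m.ideal
    rw [← hC.restr_map hg hid]; exact ha
  have hζω : m.height + ω < (succ ℵ₀).ord := by
    refine Ordinal.isPrincipal_add_ord (Order.le_succ _) hζ ?_
    rw [Cardinal.lt_ord, Ordinal.card_omega0]
    exact Order.lt_succ _
  have hdW : ∀ ξ ∈ C.dom a₀, ξ < m.height + ω := fun ξ hξ => hg' ξ (Or.inl (by
      rw [hC.dom_map hg]; exact mem_image_of_mem _ hξ))
  have hxW : ∀ ξ ∈ g ⁻¹' x, ξ < m.height + ω := fun ξ hξ => hg' ξ (Or.inr hξ)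
  obtain ⟨s, hs, has, w, hw, hxw, hwd, hsw, hsD⟩ := h a₀ ha₀ hdW
    (g ⁻¹' x) ((isSmall_aleph0.1 hx).preimage hg.strictMono.injective.injOn) hxW
  have hwκ : w ⊆ Iio (succ ℵ₀).ord := fun ξ hξ => by
    rcases hwd hξ with h1 | h1 | h1
    · exact (mem_Iio.1 h1).trans hζ
    · exact (hdW ξ h1).trans hζω
    · exact (hxW ξ h1).trans hζω
  have hidS : IsShift (ℵ₀ : Cardinal.{u}) (id : Ordinal.{u} → Ordinal.{u}) :=
    ⟨strictMono_id, fun _ h => h⟩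
  have hms : C.map id s = s := hC.map_eq_self hidS fun _ _ => rfl
  refine ⟨C.map g s, ?_, hC.map_mono hg has, g '' w, hw.image g, ?_, ?_, ?_, ?_⟩
  · change C.restr _ _ ∈ m.ideal
    rw [hC.restr_map hg hid]; exact hs
  · rw [← hx']; exact image_mono hxw
  · rintro _ ⟨ξ, hξ, rfl⟩
    rcases hwd hξ with h1 | h1 | h1
    · exact Or.inl ((hlow ξ).2 h1)
    · refine Or.inr (Or.inl ?_)
      rw [hC.dom_map hg]; exact mem_image_of_mem _ h1
    · exact Or.inr (Or.inr h1)
  · rw [hC.dom_map hg]; exact image_mono hsw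
  · have := hC.mem_system_iff hidS hg hD hw hwκ hxw (p := s) (by
      rw [image_id]
      ext ξ
      constructor
      · rintro ⟨h1, h2⟩
        exact ⟨⟨ξ, h1, hid ξ (lt_of_lt_of_le h2 hα)⟩, h2⟩
      · rintro ⟨⟨η, h1, rfl⟩, h2⟩
        have h3 : η < m.height := (hlow η).1 (lt_of_lt_of_le h2 hα)
        rw [hid η h3] at h2 ⊢
        exact ⟨h1, h2⟩) (by rw [hms]; exact hG hs) hsw
    rw [hms, image_id, image_id, hx'] at this
    exact this.1 hsD

end Coding

namespace Coding

theorem countable_Iio_of_lt {δ : Ordinal.{u}} (hδ : δ < (succ ℵ₀).ord) : (Iio δ).Countable := by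
  have := isSmall_succ.1 (isSmall_Iio hδ)
  rw [← Cardinal.le_aleph0_iff_set_countable]
  simpa using this

variable {P : Type v} [PartialOrder P]
variable {C : Coding ℵ₀ P} {Λ : Ordinal.{u} → MoveII.{u, v} P × MoveI.{u, v} P}
  {δ : Ordinal.{u}}

theorem LegalI.countable_systems {y : Ordinal.{u} → MoveII.{u, v} P} {m : MoveI.{u, v} P}
    (hm : C.LegalI y δ m) : m.systems.Countable := by
  rw [← Cardinal.le_aleph0_iff_set_countable]
  simpa using hm.2.1

/-- Up to isomorphism over ζ all instances lie below ζ + ω, and there are countably many of them. An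
ω-sequence in the quotient, with domains below ζ, treats each one and generates the new ideal. -/
theorem exists_countableLevel [Nonempty P] (hC : C.IsUniform) (hδ : δ < (succ ℵ₀).ord)
    (hΛ : ∀ β < δ, C.CountableLevel Λ β (Λ β)) {m : MoveI.{u, v} P}
    (hm : C.LegalI (Prod.fst ∘ Λ) δ m) : ∃ l, l.2 = m ∧ C.CountableLevel Λ δ l := by
  have hreg := isRegular_aleph0
  have hst : ∀ β < δ, C.IsStage (Prod.fst ∘ Λ) β ((Prod.fst ∘ Λ) β) := fun β hβ => (hΛ β hβ).stage
  have hdecs : ∀ β ≤ δ,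
      C.DecidesBounds (heightBefore (Prod.fst ∘ Λ) β) (C.quotBefore (Prod.fst ∘ Λ) β) :=
    fun β hβ => (decides_of_countableLevel hC (hβ.trans_lt hδ)
      fun γ hγ => hΛ γ (hγ.trans_le hβ)).1
  obtain ⟨hdec, hdense⟩ := decides_of_countableLevel hC hδ hΛ
  have hquot : ∀ β ≤ δ, genericQuotient (C.idealBefore (Prod.fst ∘ Λ) β) =
      C.quotBefore (Prod.fst ∘ Λ) β := fun β hβ =>
    genericQuotient_idealBefore hC (fun γ hγ => hst γ (hγ.trans_le hβ)) (hβ.trans_lt hδ) hreg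
      (hdecs β hβ)
  have hnice := isNice_quotBefore hC hst hδ hreg hdec
  have hlow := isLowerSet_quotBefore hC hst
  have hηκ := heightBefore_lt le_rfl hδ hst
  have hηle : ∀ β < δ, (Λ β).1.height ≤ heightBefore (Prod.fst ∘ Λ) δ := fun β hβ =>
    le_heightBefore (y := Prod.fst ∘ Λ) hβ
  have hquotle : ∀ β ≤ δ, C.quotBefore (Prod.fst ∘ Λ) δ ⊆ C.quotBefore (Prod.fst ∘ Λ) β :=
    fun β hβ p hp γ hγ => hp γ (hγ.trans_le hβ)
  have hheightle : ∀ β ≤ δ, heightBefore (Prod.fst ∘ Λ) β ≤ heightBefore (Prod.fst ∘ Λ) δ :=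
    fun β hβ => le_of_forall_lt fun ξ hξ => by
      obtain ⟨γ, hγ, h⟩ := lt_heightBefore.1 hξ
      exact lt_heightBefore.2 ⟨γ, hγ.trans_le hβ, h⟩
  set Q := C.quotBefore (Prod.fst ∘ Λ) δ with hQdef
  set η := heightBefore (Prod.fst ∘ Λ) δ with hηdef
  have hgQ : m.elt ∈ Q := (hquot δ le_rfl).subset hm.1
  obtain ⟨θ, hθ, hgθ⟩ := exists_dom_bound le_rfl m.elt
  obtain ⟨ζ, hζκ, hηζ, hgζ⟩ : ∃ ζ < (succ ℵ₀).ord, η < ζ ∧ C.dom m.elt ⊆ Iio ζ :=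
    ⟨Order.succ (max η θ), (Cardinal.isSuccLimit_ord (Order.le_succ _)).succ_lt (max_lt hηκ hθ),
      Order.lt_succ_iff.2 (le_max_left _ _),
      hgθ.trans (Iio_subset_Iio ((le_max_right _ _).trans (Order.le_succ _)))⟩
  have hζω : ζ + ω < (succ ℵ₀).ord := by
    refine Ordinal.isPrincipal_add_ord (Order.le_succ _) hζκ ?_
    rw [Cardinal.lt_ord, Ordinal.card_omega0]
    exact Order.lt_succ _
  have hcount := countable_Iio_of_lt hζω
  let 𝔇 : Set (SystemFun.{u, v} P) := m.systems ∪ ⋃ β ∈ Iio δ, (Λ β).2.systems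
  have h𝔇c : 𝔇.Countable := hm.countable_systems.union
    ((countable_Iio_of_lt hδ).biUnion fun β hβ => (hΛ β hβ).legal.countable_systems)
  have h𝔇 : ∀ D ∈ 𝔇, C.DenseIn η Q D ∧ ∃ β ≤ δ, C.IsDensitySystem
      (heightBefore (Prod.fst ∘ Λ) β) (C.idealBefore (Prod.fst ∘ Λ) β) D := by
    rintro D (hD | hD)
    · exact ⟨denseIn_of_isDensitySystem hC hst hδ hreg hdec (hm.2.2 D hD), δ, le_rfl, hm.2.2 D hD⟩
    · obtain ⟨β, hβ, hD'⟩ := mem_iUnion₂.1 hD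
      exact ⟨hdense β hβ D hD', β, (mem_Iio.1 hβ).le, (hΛ β hβ).legal.2.2 D hD'⟩
  let S : Set (Set P ⊕ (SystemFun.{u, v} P × P × Set Ordinal.{u})) :=
    Sum.inl '' {X | X.Finite ∧ X ⊆ {p | C.dom p ⊆ Iio (ζ + ω)}} ∪
    Sum.inr '' (𝔇 ×ˢ ({p | C.dom p ⊆ Iio (ζ + ω)} ×ˢ {x | x.Finite ∧ x ⊆ Iio (ζ + ω)}))
  have hS : S.Countable :=
    ((Set.countable_ofPred_finite_subset (countable_setOf_dom hcount)).image _).union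
      ((h𝔇c.prod ((countable_setOf_dom hcount).prod
        (Set.countable_ofPred_finite_subset hcount))).image _)
  -- The sequence receives only the restriction to ζ of the solution s; this is what puts s into the
  -- quotient by the new ideal.
  let T : Set P ⊕ (SystemFun.{u, v} P × P × Set Ordinal.{u}) → P → P → Prop := fun τ p p' =>
    match τ with
    | .inl X => (∃ s ∈ Q, s ∈ upperBounds X ∧ C.dom s ⊆ Iio ζ ∪ (⋃ p ∈ X, C.dom p) ∧
        p' = C.restr s ζ) ∨ ¬ ∃ x ∈ upperBounds X, p' ≤ x
    | .inr (D, a, x) => C.restr a ζ ≤ p → ∃ s ∈ Q, a ≤ s ∧ p' = C.restr s ζ ∧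
        ∃ w : Set Ordinal.{u}, IsSmall (ℵ₀ : Cardinal.{u}) w ∧ x ⊆ w ∧
          w ⊆ Iio ζ ∪ (C.dom a ∪ x) ∧ C.dom s ⊆ w ∧ s ∈ D x w
  obtain ⟨p, hpm, hp0, hpQ, hpT⟩ := exists_seq_of_tasks hS (Q ∩ C.below ζ) T ⟨hgQ, hgζ⟩ (by
    rintro τ (⟨X, ⟨hX, hXd⟩, rfl⟩ | ⟨⟨D, a, x⟩, ⟨hD, had, hx, hxd⟩, rfl⟩) p ⟨hp, hpd⟩
    · rcases exists_decide_above hC hst hδ hreg hdec hp (isSmall_aleph0.2 hX) with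
        ⟨s, hs, hsX, hps, hsd⟩ | ⟨p', hp', hpp', hpd', hn⟩
      · refine ⟨C.restr s ζ, ⟨hlow (hC.restr_le _ _) hs, hC.dom_restr_subset _ _⟩,
          hC.le_restr_iff.2 ⟨hps, hpd⟩, Or.inl ⟨s, hs, hsX, hsd.trans ?_, rfl⟩⟩
        refine union_subset ((Iio_subset_Iio hηζ.le).trans subset_union_left) ?_
        exact union_subset_union_left _ hpd
      · exact ⟨p', ⟨hp', hpd'.trans (union_subset (Iio_subset_Iio hηζ.le) hpd)⟩, hpp', Or.inr hn⟩
    · by_cases hap : C.restr a ζ ≤ p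
      · have haQ : a ∈ Q := by
          rw [hQdef, mem_quotBefore_iff hC, ← hηdef, ← hC.restr_restr hηζ.le]
          exact hlow ((hC.restr_le _ _).trans hap) hp
        obtain ⟨r, hr, har, hpr, hrd⟩ := hnice.amalgam a haQ p hp ζ hζκ hηζ.le hap hpd
        obtain ⟨s, hs, hrs, w, hw, hxw, hwd, hsw, hsD⟩ := (h𝔇 D hD).1 r hr x (isSmall_aleph0.2 hx)
          (hxd.trans (Iio_subset_Iio hζω.le))
        refine ⟨C.restr s ζ, ⟨hlow (hC.restr_le _ _) hs, hC.dom_restr_subset _ _⟩,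
          hC.le_restr_iff.2 ⟨hpr.trans hrs, hpd⟩, fun _ => ⟨s, hs, har.trans hrs, rfl, w, hw, hxw,
            hwd.trans ?_, hsw, hsD⟩⟩
        rw [hrd]
        refine union_subset ((Iio_subset_Iio hηζ.le).trans subset_union_left)
          (union_subset (union_subset ?_ ?_) ?_)
        · exact subset_union_left.trans subset_union_right
        · exact hpd.trans subset_union_left
        · exact subset_union_right.trans subset_union_right
      · exact ⟨p, ⟨hp, hpd⟩, le_rfl, fun h => absurd h hap⟩)
  have hlow' : ∀ n, ∀ q ≤ p n, q ∈ Q := fun n q hq => hlow hq (hpQ n).1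
  let M : MoveII.{u, v} P := ⟨ζ, {q | ∃ n, q ≤ p n}⟩
  have hMQ : C.quotOf M ⊆ Q := by
    rintro q ⟨n, hn⟩
    rw [hQdef, mem_quotBefore_iff hC, ← hηdef, ← hC.restr_restr hηζ.le]
    exact hlow' n _ ((hC.restr_le _ _).trans hn)
  have hstage : C.IsStage (Prod.fst ∘ Λ) δ M := by
    refine ⟨hζκ, fun β hβ => (hηle β hβ).trans_lt hηζ, hηζ.pos, ?_, ?_, ?_, ?_, ?_⟩
    · rintro q ⟨n, hn⟩
      exact (hC.dom_mono _ _ hn).trans (hpQ n).2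
    · rintro a b hab ⟨n, hn⟩
      exact ⟨n, hab.trans hn⟩
    · intro X hX hXs
      choose! n hn using hX
      obtain ⟨N, hN⟩ := ((isSmall_aleph0.1 hXs).image n).bddAbove
      exact ⟨p N, ⟨N, le_rfl⟩, fun q hq => (hn hq).trans (hpm (hN ⟨q, hq, rfl⟩))⟩
    -- The task {q} puts q into the new ideal: the alternative, a condition of the sequence
    -- incompatible with q, is impossible in the quotient.
    · intro β hβ q hq
      have hqQ : q ∈ Q := mem_quotBefore_of_mem hC hst hβ hq
      have hqη : C.dom q ⊆ Iio η := ((hst β hβ).subset hq).trans (Iio_subset_Iio (hηle β hβ))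
      obtain ⟨n, -, h | h⟩ := hpT (.inl {q}) (Or.inl ⟨_, ⟨finite_singleton _, by
        rw [singleton_subset_iff]
        exact hqη.trans (Iio_subset_Iio (hηζ.le.trans le_self_add))⟩, rfl⟩) 0
      · obtain ⟨s, _, hsX, _, hps⟩ := h
        exact ⟨n + 1, hps ▸ hC.le_restr_iff.2 ⟨hsX rfl, hqη.trans (Iio_subset_Iio hηζ.le)⟩⟩
      · exfalso
        have hδ0 : δ ≠ 0 := by rintro rfl; simp at hβ
        obtain ⟨x, hx, h1⟩ := exists_compatible hC hst hδ hδ0 hreg (hpQ (n + 1)).1 (X := {q})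
          (isSmall_of_finite le_rfl (finite_singleton _)) (by rintro _ rfl; exact hqQ)
          (by rintro _ rfl; exact hqη)
        exact h ⟨x, hx, h1⟩
    · rintro q ⟨n, hn⟩ β hβ
      exact hlow' n q hn β hβ
  have hMdense : ∀ D ∈ 𝔇, C.DenseIn M.height (C.quotOf M) D := by
    intro D hD
    obtain ⟨_, β, hβ, hDs⟩ := h𝔇 D hD
    refine denseIn_of_below hC hζκ ((hheightle β hβ).trans hηζ.le) hDs
      (hMQ.trans ((hquotle β hβ).trans (hquot β hβ).ge)) fun a ha had x hx hxd => ?_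
    obtain ⟨n, hn⟩ := ha
    obtain ⟨k, hk, h⟩ := hpT (.inr (D, a, x)) (Or.inr ⟨(D, a, x), ⟨hD, had, hx, hxd⟩, rfl⟩) n
    obtain ⟨s, hs, has, hps, h⟩ := h (hn.trans (hpm hk))
    exact ⟨s, ⟨k + 1, hps.ge⟩, has, h⟩
  refine ⟨(M, m), rfl, hstage, ⟨0, hp0.ge⟩, hm, ?_, fun D hD => hMdense D (Or.inl hD),
    fun β hβ D hD => hMdense D (Or.inr (mem_biUnion hβ hD))⟩
  refine decidesBounds_of_below hC hζκ fun X hX hXd => ?_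
  obtain ⟨n, -, h | h⟩ := hpT (.inl X) (Or.inl ⟨X, ⟨hX, hXd⟩, rfl⟩) 0
  · obtain ⟨s, hs, hsX, hsd, hps⟩ := h
    exact Or.inl ⟨s, ⟨n + 1, hps.ge⟩, hsX, hsd⟩
  · exact Or.inr ⟨p (n + 1), ⟨n + 1, hC.restr_le _ _⟩, (hpQ (n + 1)).2, h⟩

theorem exists_isWinningII_aleph0 (hC : C.IsUniform) :
    ∃ σ : StrategyII.{u, v} P, C.IsWinningII σ := by
  obtain ⟨b, _⟩ := hC.exists_bot aleph0_pos
  have : Nonempty P := ⟨b⟩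
  have : Nonempty (MoveII.{u, v} P × MoveI.{u, v} P) := ⟨⟨0, ∅⟩, ⟨b, ∅⟩⟩
  exact exists_isWinningII hC isRegular_aleph0 Prod.snd Prod.fst C.CountableLevel
    (fun δ Λ Λ' l h hl => hl.congr h) (fun δ Λ l hl => ⟨hl.stage, hl.elt_mem⟩)
    (fun δ hδ Λ hΛ => decides_of_countableLevel hC hδ hΛ)
    (fun δ hδ Λ hΛ m hm => exists_countableLevel hC hδ hΛ hm)

end Coding

/-! ### Guessing relations by Dl. -/

/-- A form of the guessing principle for sequences of binary relations. -/
theorem DlPrinciple.exists_guess_relations {κ : Cardinal.{u}} (hDl : DlPrinciple κ)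
    (hκ : κ.IsRegular) (hω : ℵ₀ < κ) :
    ∃ ℛ : Ordinal.{u} → Set (ℕ → Ordinal.{u} → Ordinal.{u} → Prop),
      (∀ i < κ.ord, IsSmall κ (ℛ i)) ∧
      ∀ R : ℕ → Ordinal.{u} → Ordinal.{u} → Prop, ∀ p, Club κ p →
        ∃ i < κ.ord, IsSuccLimit i ∧ p i ∧
          ∃ R' ∈ ℛ i, ∀ n, ∀ j < i, ∀ k < i, R' n j k ↔ R n j k := by
  obtain ⟨𝒜, h𝒜, hg⟩ := hDl
  -- Sequences of relations on κ become subsets of κ through an injection π of ω × κ × κ into κ.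
  -- When i is closed under π, the trace of the code on i determines the relations on i.
  let Y : Set (ℕ × Ordinal.{u} × Ordinal.{u}) :=
    ⋃ a ∈ Iio κ.ord, ⋃ b ∈ Iio κ.ord, range fun n : ℕ => (n, a, b)
  have hYmem : ∀ n a b, (n, a, b) ∈ Y ↔ a < κ.ord ∧ b < κ.ord := fun n a b => by
    simp [Y, eq_comm]
  have hIio : IsSmall (Order.succ κ) (Iio κ.ord) :=
    isSmall_Iio (Cardinal.ord_lt_ord.2 (Order.lt_succ κ))
  have hreg := Cardinal.isRegular_succ hω.le
  obtain ⟨π, hπ, hπκ⟩ := exists_injOn_of_mk_le (κ := κ) (s := Y) (isSmall_succ.1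
    (hIio.biUnion hreg fun a _ => hIio.biUnion hreg fun b _ =>
      isSmall_of_countable (hω.trans (Order.lt_succ κ)) (countable_range _)))
  have hclub : Club κ fun i => ∀ j < i, ∃ k < i, ∀ n, ∀ a ≤ j, ∀ b ≤ j, π (n, a, b) < k := by
    refine Club.of_exists fun j hj => ?_
    have hj' : IsSmall κ (Iic j) := by
      rw [← Order.Iio_succ]
      exact isSmall_Iio ((Cardinal.isSuccLimit_ord hκ.aleph0_le).succ_lt hj)
    obtain ⟨k, hk, h⟩ := (hj'.biUnion hκ (f := fun a => ⋃ b ∈ Iic j, range fun n : ℕ => (n, a, b))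
      fun a _ => hj'.biUnion hκ fun b _ => isSmall_of_countable hω (countable_range _)).exists_bound
        hκ π (by
          rintro ⟨n, a, b⟩ h
          simp only [mem_iUnion, mem_range, Prod.mk.injEq, mem_Iic] at h
          obtain ⟨a', ha', b', hb', n', rfl, rfl, rfl⟩ := h
          exact hπκ _ ((hYmem _ _ _).2 ⟨ha'.trans_lt hj, hb'.trans_lt hj⟩))
    refine ⟨k, hk, fun n a ha b hb => h _ ?_⟩
    simp only [mem_iUnion, mem_range, Prod.mk.injEq, mem_Iic]
    exact ⟨a, ha, b, hb, n, rfl, rfl, rfl⟩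
  refine ⟨fun i => (fun (a : Set Ordinal.{u}) n j k => π (n, j, k) ∈ a) '' 𝒜 i, fun i hi =>
    IsSmall.image (by unfold IsSmall; rw [Cardinal.lift_id'.{u, u + 1}]; exact (h𝒜 i hi).2) _, fun R p hp => ?_⟩
  let A : Set Ordinal.{u} := π '' {y ∈ Y | R y.1 y.2.1 y.2.2}
  obtain ⟨⟨i, hi⟩, hiS, hil, hpi, hc⟩ := (hp.and hclub).exists_of_isStationary hκ hω (hg A (by
    rintro _ ⟨y, ⟨hy, _⟩, rfl⟩
    exact hπκ y hy))
  refine ⟨i, hi, hil, hpi, _, ⟨_, hiS, rfl⟩, fun n j hj k hk => ?_⟩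
  have hY : (n, j, k) ∈ Y := (hYmem _ _ _).2 ⟨hj.trans hi, hk.trans hi⟩
  constructor
  · rintro ⟨⟨y, ⟨hy, hR⟩, h⟩, _⟩
    rw [hπ hy hY h] at hR
    exact hR
  · intro h
    obtain ⟨b, hb, h2⟩ := hc (max j k) (max_lt hj hk)
    exact ⟨⟨_, ⟨hY, h⟩, rfl⟩,
      (h2 n j (le_max_left _ _) k (le_max_right _ _)).trans hb⟩

/-! ### Blueprints and their collapses to scenarios. -/

/-- A bounded copy of a small piece of the game: conditions with domain below `top`, whose part
below `node` corresponds to the ideals played so far. -/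
structure Scenario (P : Type v) : Type (max (u + 1) v) where
  top : Ordinal.{u}
  node : Ordinal.{u}
  base : P
  targets : Set P
  small : Set Ordinal.{u}
  index : Ordinal.{u}

/-- A sequence of length `κ` whose initial segments are to be guessed by scenarios. -/
structure Blueprint (P : Type v) : Type (max (u + 1) v) where
  enum : Ordinal.{u} → Ordinal.{u}
  bound : Ordinal.{u}
  node : Ordinal.{u}
  cond : Ordinal.{u} → P
  target : Ordinal.{u} → P
  small : Set Ordinal.{u}
  index : Ordinal.{u}

variable {κ : Cardinal.{u}} {P : Type v} [PartialOrder P]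

/-- A scenario in which all the objects are below `top`, an ordinal below `κ`. -/
structure Scenario.Valid (C : Coding κ P) (sc : Scenario.{u, v} P) : Prop where
  node_le : sc.node ≤ sc.top
  top_lt : sc.top < κ.ord
  dom_base : C.dom sc.base ⊆ Iio sc.node
  isSmall_targets : IsSmall κ sc.targets
  dom_target : ∀ p ∈ sc.targets, C.dom p ⊆ Iio sc.top
  small_subset : sc.small ⊆ Iio sc.top

namespace Blueprint

/-- The map that sends the order type of the first `i` points to these points. -/
noncomputable def expand (d : Blueprint.{u, v} P) (i : Ordinal.{u}) : Ordinal.{u} → Ordinal.{u} :=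
  shift (d.enum '' Iio i) d.bound

/-- The relations that determine the scenarios of a blueprint. -/
def fact (C : Coding κ P) (d : Blueprint.{u, v} P) : ℕ → Ordinal.{u} → Ordinal.{u} → Prop
  | 0, j, k => d.enum j < d.enum k
  | 1, j, _ => d.enum j < d.node
  | 2, j, k => C.code (d.cond j) = k
  | 3, j, k => d.enum k ∈ C.dom (d.cond j)
  | 4, j, k => C.code (d.target j) = k
  | 5, j, k => d.enum k ∈ C.dom (d.target j)
  | 6, j, _ => d.enum j ∈ d.small
  | _, j, _ => d.index = j

/-- The first `i` points of the blueprint are closed under the operations of the blueprint. -/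
structure Closed (C : Coding κ P) (d : Blueprint.{u, v} P) (i : Ordinal.{u}) : Prop where
  lt : i < κ.ord
  enum_lt : ∀ j < i, d.enum j < d.bound
  bound_lt : d.bound < (succ κ).ord
  node_le : d.node ≤ d.bound
  mono : MonotoneOn d.cond (Iio i)
  dom_cond : ∀ j < i, C.dom (d.cond j) ⊆ d.enum '' Iio i
  dom_cond_lt : ∀ j < i, C.dom (d.cond j) ⊆ Iio d.node
  code_cond : ∀ j < i, C.code (d.cond j) < i
  dom_target : ∀ j < i, C.dom (d.target j) ⊆ d.enum '' Iio i
  code_target : ∀ j < i, C.code (d.target j) < i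
  small_subset : d.small ⊆ d.enum '' Iio i
  index_lt : d.index < i

/-- The scenario `sc` is the collapse of the first `i` points of the blueprint. -/
structure Realizes (C : Coding κ P) (d : Blueprint.{u, v} P) (i : Ordinal.{u})
    (sc : Scenario.{u, v} P) : Prop where
  top_eq : sc.top = shiftPos (d.enum '' Iio i) d.bound d.bound
  node_eq : sc.node = shiftPos (d.enum '' Iio i) d.bound d.node
  isLUB_base : IsLUB (d.cond '' Iio i) (C.map (d.expand i) sc.base)
  map_targets : C.map (d.expand i) '' sc.targets = d.target '' Iio i
  map_small : d.expand i '' sc.small = d.small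
  index_eq : sc.index = d.index

variable {C : Coding κ P} {d d' : Blueprint.{u, v} P} {i : Ordinal.{u}}

theorem Closed.isShift (h : d.Closed C i) (hκ : ℵ₀ ≤ κ) : IsShift κ (d.expand i) :=
  isShift_shift hκ _ h.bound_lt

theorem Closed.image_subset (h : d.Closed C i) : d.enum '' Iio i ⊆ Iio d.bound := by
  rintro _ ⟨j, hj, rfl⟩; exact h.enum_lt j hj

theorem image_subset_range_expand : d.enum '' Iio i ⊆ range (d.expand i) := by
  unfold expand
  rw [range_shift]; exact subset_union_left

theorem Closed.image_Iio_top (h : d.Closed C i) :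
    d.expand i '' Iio (shiftPos (d.enum '' Iio i) d.bound d.bound) = d.enum '' Iio i := by
  unfold expand
  rw [image_shift_Iio_shiftPos le_rfl, inter_eq_self_of_subset_left h.image_subset]

theorem exists_realizes (hC : C.IsUniform) (hκ : κ.IsRegular) (h : d.Closed C i) :
    ∃ sc, d.Realizes C i sc := by
  have hh := h.isShift hκ.aleph0_le
  obtain ⟨q, hq, hqd, _⟩ := hC.exists_isLUB_on (isSmall_Iio h.lt) h.mono
  obtain ⟨b, rfl⟩ := hC.exists_map_eq hh (q := q) (by
    rw [hqd]
    exact (iUnion₂_subset fun j hj => h.dom_cond j hj).trans image_subset_range_expand)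
  refine ⟨⟨_, _, b, C.map (d.expand i) ⁻¹' (d.target '' Iio i), d.expand i ⁻¹' d.small, d.index⟩,
    rfl, rfl, hq, ?_, ?_, rfl⟩
  · refine image_preimage_eq_of_subset ?_
    rintro _ ⟨j, hj, rfl⟩
    exact hC.exists_map_eq hh ((h.dom_target j hj).trans image_subset_range_expand)
  · exact image_preimage_eq_of_subset (h.small_subset.trans image_subset_range_expand)

theorem Realizes.valid (hC : C.IsUniform) (hκ : κ.IsRegular) (h : d.Closed C i)
    {sc : Scenario.{u, v} P} (hs : d.Realizes C i sc) : sc.Valid C := by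
  have hh := h.isShift hκ.aleph0_le
  have hsm : IsSmall κ (Iio i) := isSmall_Iio h.lt
  have htop : ∀ ξ, d.expand i ξ ∈ d.enum '' Iio i → ξ < sc.top := fun ξ hξ => by
    rw [hs.top_eq, lt_shiftPos]
    exact h.image_subset hξ
  refine ⟨?_, ?_, fun ξ hξ => ?_, ?_, fun p hp ξ hξ => ?_, fun ξ hξ => ?_⟩
  · rw [hs.node_eq, hs.top_eq]
    exact le_of_forall_lt fun ξ hξ => lt_shiftPos.2 ((lt_shiftPos.1 hξ).trans_le h.node_le)
  · rw [hs.top_eq]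
    exact shiftPos_lt le_rfl (hsm.image _)
  · obtain ⟨q, hq, hqd, _⟩ := hC.exists_isLUB_on hsm h.mono
    have h1 : d.expand i ξ ∈ C.dom q := by
      rw [hq.unique hs.isLUB_base, hC.dom_map hh]; exact mem_image_of_mem _ hξ
    rw [hqd] at h1
    obtain ⟨j, hj, h2⟩ := mem_iUnion₂.1 h1
    rw [hs.node_eq, mem_Iio, lt_shiftPos]
    exact h.dom_cond_lt j hj h2
  · have : Nonempty P := ⟨sc.base⟩
    have h1 : sc.targets ⊆ Function.invFun (C.map (d.expand i)) '' (d.target '' Iio i) := by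
      intro p hp
      refine ⟨C.map (d.expand i) p, ?_, Function.leftInverse_invFun (hC.map_injective hh) p⟩
      rw [← hs.map_targets]; exact mem_image_of_mem _ hp
    exact ((hsm.image d.target).image _).mono h1
  · have h1 : C.map (d.expand i) p ∈ d.target '' Iio i := by
      rw [← hs.map_targets]; exact mem_image_of_mem _ hp
    obtain ⟨j, hj, h2⟩ := h1
    refine htop ξ (h.dom_target j hj ?_)
    rw [h2, hC.dom_map hh]; exact mem_image_of_mem _ hξ
  · refine htop ξ (h.small_subset ?_)
    rw [← hs.map_small]; exact mem_image_of_mem _ hξ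

/-- Two blueprints with the same facts about their first `i` points have corresponding points at
the same positions. -/
theorem exists_position (h : d.Closed C i) (h' : d'.Closed C i)
    (hf : ∀ j < i, ∀ k < i, d.enum j < d.enum k ↔ d'.enum j < d'.enum k) :
    ∃ k : Ordinal.{u} → Ordinal.{u}, (∀ j < i, d.expand i (k j) = d.enum j ∧
        d'.expand i (k j) = d'.enum j) ∧
      ∀ ξ, d.expand i ξ < d.bound → ∃ j < i, ξ = k j := by
  have h1 : ∀ j < i, ∃ ξ, d.expand i ξ = d.enum j := fun j hj =>
    image_subset_range_expand (mem_image_of_mem _ hj)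
  have h2 : ∀ j < i, ∃ ξ, d'.expand i ξ = d'.enum j := fun j hj =>
    image_subset_range_expand (mem_image_of_mem _ hj)
  choose! k hk using h1
  choose! k' hk' using h2
  have hm : StrictMono (d.expand i) := shift_strictMono _ _
  have hm' : StrictMono (d'.expand i) := shift_strictMono _ _
  have hmem : ∀ {d : Blueprint.{u, v} P}, ∀ ξ, d.expand i ξ < d.bound → ∃ j < i, d.enum j = d.expand i ξ :=
      fun {d} ξ hξ => by
    have : d.expand i ξ ∈ d.enum '' Iio i ∪ Ici d.bound := by
      rw [← range_shift]; exact mem_range_self _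
    exact this.resolve_right fun h2 => absurd h2 (not_le.2 hξ)
  -- Induction on the position: the points below the j-th one are the same indices in both
  -- blueprints, and by induction they occupy the same positions.
  have hkk : ∀ ξ, ∀ j < i, k j = ξ → k' j = ξ := by
    intro ξ
    induction ξ using WellFoundedLT.induction with
    | ind ξ ih =>
      rintro j hj rfl
      refine eq_of_forall_lt_iff fun η => ⟨fun hη => ?_, fun hη => ?_⟩
      · have h3 := hm' hη
        rw [hk' j hj] at h3
        obtain ⟨l, hl, h4⟩ := hmem η (h3.trans (h'.enum_lt j hj))
        have h5 := (hf l hl j hj).2 (h4 ▸ h3)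
        have h6 : k l < k j := hm.lt_iff_lt.1 (by rwa [hk l hl, hk j hj])
        have h7 := ih _ h6 l hl rfl
        have h8 : k' l = η := hm'.injective ((hk' l hl).trans h4)
        rw [← h8, h7]; exact h6
      · have h3 := hm hη
        rw [hk j hj] at h3
        obtain ⟨l, hl, h4⟩ := hmem η (h3.trans (h.enum_lt j hj))
        have h6 : k l = η := hm.injective ((hk l hl).trans h4)
        have h7 := ih η hη l hl h6
        have h5 := (hf l hl j hj).1 (h4 ▸ h3)
        rw [← h7]
        exact hm'.lt_iff_lt.1 (by rwa [hk' l hl, hk' j hj])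
  refine ⟨k, fun j hj => ⟨hk j hj, ?_⟩, fun ξ hξ => ?_⟩
  · rw [← hkk _ j hj rfl]; exact hk' j hj
  · obtain ⟨j, hj, h3⟩ := hmem ξ hξ
    exact ⟨j, hj, hm.injective (h3.symm.trans (hk j hj).symm)⟩

/-- A condition is determined by its code and its domain, so the collapse depends only on the facts
about indices below i. Hence one scenario serves all blueprints with the same facts. -/
theorem Realizes.of_fact_iff (hC : C.IsUniform) (hκ : κ.IsRegular) (h : d.Closed C i)
    (h' : d'.Closed C i) (hl : IsSuccLimit i)
    (hf : ∀ n, ∀ j < i, ∀ k < i, d.fact C n j k ↔ d'.fact C n j k)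
    {sc : Scenario.{u, v} P} (hs : d.Realizes C i sc) : d'.Realizes C i sc := by
  have hh := h.isShift hκ.aleph0_le
  have hh' := h'.isShift hκ.aleph0_le
  obtain ⟨k, hk, hk2⟩ := exists_position h h' (hf 0)
  obtain ⟨k', hk', hk2'⟩ := exists_position h' h fun j hj k hk => (hf 0 j hj k hk).symm
  -- Facts 1, 6 and 7 ignore their second argument; 0 serves as one below i.
  have hi0 : (0 : Ordinal) < i := hl.bot_lt
  -- the positions of the points of a subset
  have himg : ∀ {s : Set Ordinal.{u}} {A A' : Set Ordinal.{u}}, A ⊆ d.enum '' Iio i →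
      A' ⊆ d'.enum '' Iio i → (∀ j < i, d.enum j ∈ A ↔ d'.enum j ∈ A') →
      d.expand i '' s = A → d'.expand i '' s = A' := by
    rintro s A A' hA hA' hiff rfl
    ext ξ
    constructor
    · rintro ⟨η, hη, rfl⟩
      have h1 : d.expand i η ∈ d.expand i '' s := mem_image_of_mem _ hη
      obtain ⟨j, hj, rfl⟩ := hk2 η (h.image_subset (hA h1))
      rw [(hk j hj).1] at h1
      rw [(hk j hj).2]
      exact (hiff j hj).1 h1
    · intro hξ
      obtain ⟨j, hj, rfl⟩ := hA' hξ
      obtain ⟨η, hη, h1⟩ := (hiff j hj).2 hξ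
      rw [← (hk j hj).1] at h1
      exact ⟨η, hη, by rw [hh.strictMono.injective h1, (hk j hj).2]⟩
  have hcond : ∀ {p p' c : P}, C.dom p ⊆ d.enum '' Iio i → C.dom p' ⊆ d'.enum '' Iio i →
      C.code p = C.code p' → (∀ j < i, d.enum j ∈ C.dom p ↔ d'.enum j ∈ C.dom p') →
      C.map (d.expand i) c = p → C.map (d'.expand i) c = p' := by
    rintro p p' c hp hp' hcode hdom rfl
    refine hC.map_eq hh' ⟨by rw [← hcode, hC.code_map hh], ?_⟩
    exact (himg hp hp' hdom (hC.dom_map hh c).symm).symm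
  have hcode : ∀ {p p' : P}, C.code p < i → (∀ k < i, C.code p = k ↔ C.code p' = k) →
      C.code p = C.code p' := fun {p p'} hp hiff => ((hiff _ hp).1 rfl).symm
  have hc1 : ∀ j < i, ∃ c, C.map (d.expand i) c = d.cond j := fun j hj =>
    hC.exists_map_eq hh ((h.dom_cond j hj).trans image_subset_range_expand)
  have : Nonempty P := ⟨sc.base⟩
  choose! c hc using hc1
  have hc' : ∀ j < i, C.map (d'.expand i) (c j) = d'.cond j := fun j hj =>
    hcond (h.dom_cond j hj) (h'.dom_cond j hj) (hcode (h.code_cond j hj) (hf 2 j hj))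
      (fun k hk => hf 3 j hj k hk) (hc j hj)
  have hpos : ∀ ξ, d.expand i ξ < d.bound ↔ d'.expand i ξ < d'.bound := by
    intro ξ
    constructor <;> intro hξ
    · obtain ⟨j, hj, rfl⟩ := hk2 ξ hξ
      rw [(hk j hj).2]; exact h'.enum_lt j hj
    · obtain ⟨j, hj, rfl⟩ := hk2' ξ hξ
      rw [(hk' j hj).2]; exact h.enum_lt j hj
  have hnode : ∀ ξ, d.expand i ξ < d.node ↔ d'.expand i ξ < d'.node := by
    intro ξ
    constructor <;> intro hξ
    · obtain ⟨j, hj, rfl⟩ := hk2 ξ (hξ.trans_le h.node_le)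
      rw [(hk j hj).1] at hξ
      rw [(hk j hj).2]
      exact (hf 1 j hj 0 hi0).1 hξ
    · obtain ⟨j, hj, rfl⟩ := hk2' ξ (hξ.trans_le h'.node_le)
      rw [(hk' j hj).1] at hξ
      rw [(hk' j hj).2]
      exact (hf 1 j hj 0 hi0).2 hξ
  refine ⟨?_, ?_, ?_, ?_, ?_, ?_⟩
  · rw [hs.top_eq]
    exact eq_of_forall_lt_iff fun ξ => by rw [lt_shiftPos, lt_shiftPos]; exact hpos ξ
  · rw [hs.node_eq]
    exact eq_of_forall_lt_iff fun ξ => by rw [lt_shiftPos, lt_shiftPos]; exact hnode ξ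
  -- The base is the least upper bound of the collapsed conditions c j, and both expansions preserve
  -- that bound.
  · have hcm : MonotoneOn c (Iio i) := fun a ha b hb hab => by
      rw [← hC.map_le_map_iff hh, hc a ha, hc b hb]; exact h.mono ha hb hab
    obtain ⟨b, hb, _⟩ := hC.exists_isLUB_on (isSmall_Iio h.lt) hcm
    have h1 := hC.map_isLUB_on hh (isSmall_Iio h.lt) hcm hb
    have h2 := hC.map_isLUB_on hh' (isSmall_Iio h.lt) hcm hb
    have e1 : (fun j => C.map (d.expand i) (c j)) '' Iio i = d.cond '' Iio i :=
      image_congr fun j hj => hc j (mem_Iio.1 hj)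
    have e2 : (fun j => C.map (d'.expand i) (c j)) '' Iio i = d'.cond '' Iio i :=
      image_congr fun j hj => hc' j (mem_Iio.1 hj)
    rw [e1] at h1
    rw [e2] at h2
    rwa [← hC.map_injective hh (h1.unique hs.isLUB_base)]
  · have ht : ∀ j < i, ∀ c, C.map (d.expand i) c = d.target j ↔
        C.map (d'.expand i) c = d'.target j := fun j hj c => by
      have h0 : C.map (d.expand i) c = d.target j →
        C.map (d'.expand i) c = d'.target j := hcond (h.dom_target j hj) (h'.dom_target j hj)
          (hcode (h.code_target j hj) (hf 4 j hj)) (fun k hk => hf 5 j hj k hk)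
      refine ⟨h0, fun h3 => ?_⟩
      obtain ⟨c', h4⟩ : ∃ c', C.map (d.expand i) c' = d.target j :=
        hC.exists_map_eq hh ((h.dom_target j hj).trans image_subset_range_expand)
      have h5 := hcond (h.dom_target j hj) (h'.dom_target j hj)
        (hcode (h.code_target j hj) (hf 4 j hj)) (fun k hk => hf 5 j hj k hk) h4
      rwa [hC.map_injective hh' (h3.trans h5.symm)]
    ext p
    constructor
    · rintro ⟨c, hc, rfl⟩
      obtain ⟨j, hj, h1⟩ := hs.map_targets.subset (mem_image_of_mem _ hc)
      exact ⟨j, hj, ((ht j hj c).1 h1.symm).symm⟩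
    · rintro ⟨j, hj, rfl⟩
      obtain ⟨c, hc, h1⟩ := hs.map_targets.superset (mem_image_of_mem _ hj)
      exact ⟨c, hc, (ht j hj c).1 h1⟩
  · exact himg h.small_subset h'.small_subset (fun j hj => hf 6 j hj 0 hi0) hs.map_small
  · rw [hs.index_eq]
    exact ((hf 7 _ h.index_lt 0 hi0).1 rfl).symm

end Blueprint

/-- Fewer than `κ` scenarios for each `i` suffice to guess all blueprints. -/
theorem exists_guess_scenarios (hDl : DlPrinciple κ) (hκ : κ.IsRegular) (hω : ℵ₀ < κ)
    {C : Coding κ P} (hC : C.IsUniform) :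
    ∃ 𝒮 : Ordinal.{u} → Set (Scenario.{u, v} P),
      (∀ i < κ.ord, IsSmall κ (𝒮 i)) ∧ (∀ i < κ.ord, ∀ sc ∈ 𝒮 i, sc.Valid C) ∧
      ∀ d : Blueprint.{u, v} P, ∀ p, Club κ p → Club κ (d.Closed C) →
        ∃ i < κ.ord, IsSuccLimit i ∧ p i ∧ d.Closed C i ∧ ∃ sc ∈ 𝒮 i, d.Realizes C i sc := by
  obtain ⟨ℛ, hℛ, hg⟩ := hDl.exists_guess_relations hκ hω
  obtain ⟨b, _⟩ := hC.exists_bot hκ.pos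
  have : Nonempty (Scenario.{u, v} P) := ⟨⟨0, 0, b, ∅, ∅, 0⟩⟩
  -- Each guessed sequence of relations gets one scenario, realized by some blueprint with these
  -- facts if there is one; any other such blueprint realizes it as well.
  let Φ : Ordinal.{u} → (ℕ → Ordinal.{u} → Ordinal.{u} → Prop) → Scenario.{u, v} P → Prop :=
    fun i R sc => ∃ d : Blueprint.{u, v} P, d.Closed C i ∧
      (∀ n, ∀ j < i, ∀ k < i, R n j k ↔ d.fact C n j k) ∧ d.Realizes C i sc
  refine ⟨fun i => (fun R => Classical.epsilon (Φ i R)) '' ℛ i ∩ {sc | sc.Valid C},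
    fun i hi => ((hℛ i hi).image _).mono inter_subset_left, fun i _ sc hsc => hsc.2,
    fun d p hp hd => ?_⟩
  obtain ⟨i, hi, hil, ⟨hpi, hdi⟩, R, hR, hiff⟩ := hg (d.fact C) _ (hp.and hd)
  obtain ⟨sc, hsc⟩ := d.exists_realizes hC hκ hdi
  obtain ⟨d', hd', hf', hs'⟩ := Classical.epsilon_spec (p := Φ i R) ⟨sc, d, hdi, hiff, hsc⟩
  refine ⟨i, hi, hil, hpi, hdi, _, ⟨⟨R, hR, rfl⟩, hs'.valid hC hκ hd'⟩, ?_⟩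
  exact hs'.of_fact_iff hC hκ hd' hdi hil fun n j hj k hk =>
    (hf' n j hj k hk).symm.trans (hiff n j hj k hk)

/-! ### The tree structure on scenarios. -/

variable {κ : Cardinal.{u}} {P : Type v} [PartialOrder P]

/-- The ordinal at which two scenarios separate. -/
noncomputable def Scenario.gap (C : Coding κ P) (a b : Scenario.{u, v} P) : Ordinal.{u} :=
  sSup {γ | γ ≤ a.node ∧ γ ≤ b.node ∧ C.restr a.base γ = C.restr b.base γ}

namespace Scenario

variable {C : Coding κ P} {a b c : Scenario.{u, v} P} {z : Ordinal.{u}}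

theorem gap_comm : gap C a b = gap C b a := by
  unfold gap
  congr 1
  ext γ
  exact ⟨fun ⟨h1, h2, h3⟩ => ⟨h2, h1, h3.symm⟩, fun ⟨h1, h2, h3⟩ => ⟨h2, h1, h3.symm⟩⟩

theorem le_gap (ha : z ≤ a.node) (hb : z ≤ b.node) (h : C.restr a.base z = C.restr b.base z) :
    z ≤ gap C a b :=
  le_csSup ⟨a.node, fun _ hγ => hγ.1⟩ ⟨ha, hb, h⟩

theorem gap_le_node : gap C a b ≤ a.node :=
  csSup_le' fun _ hγ => hγ.1

/-- The supremum in `gap` is attained, since a restriction to it is determined by the restrictions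
to cofinally many γ, where the two bases agree. -/
theorem restr_gap (hC : C.IsUniform) (hn : a.node < (succ κ).ord) (ha : z ≤ a.node)
    (hb : z ≤ b.node) (h : C.restr a.base z = C.restr b.base z) :
    C.restr a.base (gap C a b) = C.restr b.base (gap C a b) := by
  have key : ∀ a b : Scenario.{u, v} P, gap C a b < (succ κ).ord → z ≤ a.node → z ≤ b.node →
      C.restr a.base z = C.restr b.base z →
      C.restr a.base (gap C a b) ≤ C.restr b.base (gap C a b) := by
    intro a b hg ha hb h
    refine hC.le_restr_iff.2 ⟨?_, hC.dom_restr_subset _ _⟩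
    refine hC.le_of_restr_le (B := {γ | γ ≤ a.node ∧ γ ≤ b.node ∧
      C.restr a.base γ = C.restr b.base γ}) ⟨z, ha, hb, h⟩ hg
      (fun γ hγ => le_gap hγ.1 hγ.2.1 hγ.2.2) (fun ξ hξ => ?_) fun γ hγ => ?_
    · exact exists_lt_of_lt_csSup ⟨z, ha, hb, h⟩ (hC.dom_restr_subset _ _ hξ)
    · rw [hC.restr_restr (le_gap hγ.1 hγ.2.1 hγ.2.2), hγ.2.2]
      exact hC.restr_le _ _
  have hg : gap C a b < (succ κ).ord := gap_le_node.trans_lt hn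
  refine le_antisymm (key a b hg ha hb h) ?_
  rw [gap_comm] at hg ⊢
  exact key b a hg hb ha h.symm

theorem min_gap_le (hC : C.IsUniform) (hna : a.node < (succ κ).ord) (hnb : b.node < (succ κ).ord)
    (ha : z ≤ a.node) (hb : z ≤ b.node) (hc : z ≤ c.node)
    (hab : C.restr a.base z = C.restr b.base z) (hbc : C.restr b.base z = C.restr c.base z) :
    min (gap C a b) (gap C b c) ≤ gap C a c := by
  refine le_gap ((min_le_left _ _).trans gap_le_node)
    ((min_le_right _ _).trans (gap_comm.trans_le gap_le_node)) ?_
  rw [← hC.restr_restr (min_le_left (gap C a b) (gap C b c)), restr_gap hC hna ha hb hab,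
    hC.restr_restr (min_le_left _ _), ← hC.restr_restr (min_le_right (gap C a b) (gap C b c)),
    restr_gap hC hnb hb hc hbc, hC.restr_restr (min_le_right _ _)]

end Scenario

/-! ### Levels, approximations and the invariant for uncountable κ. -/

/-- A stage of the construction of player II: the moves of both players, an increasing sequence of
length `κ` that generates the ideal, and for each `i < κ` a condition for each scenario. -/
structure Level (P : Type v) : Type (max (u + 1) v) extends MoveII.{u, v} P where
  move : MoveI.{u, v} P
  seq : Ordinal.{u} → P
  fam : Ordinal.{u} → Scenario.{u, v} P → P

/-- The upper bound of the first `i` conditions of a level. -/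
noncomputable def Level.before [Nonempty P] (l : Level.{u, v} P) (i : Ordinal.{u}) : P :=
  lub (l.seq '' Iio i)

/-- An enumeration of the systems of a legal move by ordinals below `κ`. -/
noncomputable def MoveI.index (κ : Cardinal.{u}) {P : Type v} (m : MoveI.{u, v} P) :
    SystemFun.{u, v} P → Ordinal.{u} :=
  Classical.epsilon fun f => InjOn f m.systems ∧ ∀ D ∈ m.systems, f D < κ.ord

theorem Coding.LegalI.index_spec {C : Coding κ P} {y : Ordinal.{u} → MoveII.{u, v} P}
    {δ : Ordinal.{u}} {m : MoveI.{u, v} P} (hm : C.LegalI y δ m) :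
    InjOn (m.index κ) m.systems ∧ ∀ D ∈ m.systems, m.index κ D < κ.ord := by
  have : Nonempty (SystemFun.{u, v} P) := ⟨fun _ _ => ∅⟩
  refine Classical.epsilon_spec (p := fun f : SystemFun.{u, v} P → Ordinal.{u} =>
    InjOn f m.systems ∧ ∀ D ∈ m.systems, f D < κ.ord) (exists_injOn_of_mk_le ?_)
  rw [Cardinal.lift_id'.{u, max (u + 1) v}]
  exact hm.2.1

/-- The parameters of the construction for uncountable `κ`: an enumeration of each ordinal below
`κ⁺` in length `κ`, and scenarios that guess all blueprints. -/
structure Guide (C : Coding κ P) where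
  isUniform : C.IsUniform
  isRegular : κ.IsRegular
  aleph0_lt : ℵ₀ < κ
  enum : Ordinal.{u} → Ordinal.{u} → Ordinal.{u}
  surjOn_enum : ∀ θ < (succ κ).ord, SurjOn (enum θ) (Iio κ.ord) (Iio θ)
  scenarios : Ordinal.{u} → Set (Scenario.{u, v} P)
  isSmall_scenarios : ∀ i < κ.ord, IsSmall κ (scenarios i)
  valid : ∀ i < κ.ord, ∀ sc ∈ scenarios i, sc.Valid C
  exists_guess : ∀ d : Blueprint.{u, v} P, ∀ p, Club κ p → Club κ (d.Closed C) →
    ∃ i < κ.ord, IsSuccLimit i ∧ p i ∧ d.Closed C i ∧ ∃ sc ∈ scenarios i, d.Realizes C i sc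

namespace Guide

variable {C : Coding κ P} (S : Guide.{u, v} C)

/-- The first `i` elements of `θ`. -/
def part (θ i : Ordinal.{u}) : Set Ordinal.{u} := S.enum θ '' Iio i ∩ Iio θ

variable [Nonempty P]

/-- The set `w` and the condition `r` extend the approximations of size `i` to the
stages before `β`. -/
structure Fits (Λ : Ordinal.{u} → Level.{u, v} P) (i β : Ordinal.{u}) (w : Set Ordinal.{u})
    (r : P) : Prop where
  inter : ∀ γ ∈ S.part β i, S.part (Λ γ).height i = w ∩ Iio (Λ γ).height
  index : ∀ γ ∈ S.part β i, S.part γ i = S.part β i ∩ Iio γ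
  restr_eq : ∀ γ ∈ S.part β i, C.restr r (Λ γ).height = (Λ γ).before i
  cofinal : ∀ ξ ∈ w, ∀ γ < β, ξ < (Λ γ).height → ∃ γ' ∈ S.part β i, ξ < (Λ γ').height
  zero : β ≠ 0 → 0 ∈ S.part β i

/-- The approximations of size `i` to the stages up to `β` are compatible with each other, if stage
`β` has height `ζ` and its first `i` conditions have the least upper bound `r`. -/
def Good (Λ : Ordinal.{u} → Level.{u, v} P) (i β ζ : Ordinal.{u}) (r : P) : Prop :=
  S.Fits Λ i β (S.part ζ i) r ∧
    ∀ γ ∈ S.part β i, S.Fits Λ i γ (S.part (Λ γ).height i) ((Λ γ).before i)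

/-- The scenarios that are considered at a stage of height `ζ` if the first `i` conditions of that
stage have the least upper bound `r`. -/
def guesses (i ζ : Ordinal.{u}) (r : P) : Set (Scenario.{u, v} P) :=
  {sc | sc ∈ S.scenarios i ∧ shiftPos (S.part ζ i) ζ ζ ≤ sc.node ∧
    C.restr (C.map (shift (S.part ζ i) ζ) sc.base) ζ = r}

/-- The requirements on the conditions chosen at stage `δ` for the scenarios. -/
structure IsFamily (Λ : Ordinal.{u} → Level.{u, v} P) (δ i : Ordinal.{u}) (m : MoveI.{u, v} P)
    (ζ : Ordinal.{u}) (r t : P) (F : Scenario.{u, v} P → P) : Prop where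
  restr_le : ∀ a ∈ S.guesses i ζ r, C.restr (C.map (shift (S.part ζ i) ζ) (F a)) ζ ≤ t
  dom_subset : ∀ a ∈ S.guesses i ζ r, C.dom (F a) ⊆ Iio a.top
  coherent : ∀ a ∈ S.guesses i ζ r, ∀ b ∈ S.guesses i ζ r,
    C.restr (F a) (a.gap C b) = C.restr (F b) (a.gap C b)
  fam_le : ∀ β ∈ S.part δ i, ∀ a ∈ S.guesses i ζ r, (Λ β).fam i a ≤ F a
  base_le : δ = 0 → ∀ a ∈ S.guesses i ζ r, a.base ≤ F a
  decides : δ = 0 → ∀ a ∈ S.guesses i ζ r,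
    F a ∈ upperBounds a.targets ∨ ¬ ∃ x ∈ upperBounds a.targets, C.restr (F a) a.node ≤ x
  mem_system : ∀ a ∈ S.guesses i ζ r, ∀ D ∈ m.systems, m.index κ D = a.index →
    C.map (shift (S.part ζ i) ζ) (F a) ∈
      D (shift (S.part ζ i) ζ '' a.small) (shift (S.part ζ i) ζ '' Iio a.top)

/-- The properties maintained by player II when `κ` is uncountable. -/
structure IsLevel (Λ : Ordinal.{u} → Level.{u, v} P) (δ : Ordinal.{u}) (l : Level.{u, v} P) :
    Prop where
  stage : C.IsStage (Level.toMoveII ∘ Λ) δ l.toMoveII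
  elt_mem : l.move.elt ∈ l.ideal
  legal : C.LegalI (Level.toMoveII ∘ Λ) δ l.move
  mem_ideal : ∀ q, q ∈ l.ideal ↔ ∃ i < κ.ord, q ≤ l.seq i
  mono : MonotoneOn l.seq (Iio κ.ord)
  seq_le : ∀ i < κ.ord, ∀ β ∈ S.part δ i, (Λ β).seq i ≤ l.seq i
  isFamily : ∀ i < κ.ord, IsSuccLimit i → S.Good Λ i δ l.height (l.before i) →
    S.IsFamily Λ δ i l.move l.height (l.before i) (l.seq i) (l.fam i)

variable {S} {Λ Λ' : Ordinal.{u} → Level.{u, v} P} {δ i : Ordinal.{u}}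

theorem Fits.congr {β : Ordinal.{u}} {w : Set Ordinal.{u}} {r : P} (h : ∀ γ < β, Λ γ = Λ' γ)
    (hF : S.Fits Λ i β w r) : S.Fits Λ' i β w r := by
  have hp : ∀ γ ∈ S.part β i, γ < β := fun γ hγ => hγ.2
  refine ⟨fun γ hγ => ?_, hF.index, fun γ hγ => ?_, fun ξ hξ γ hγ h1 => ?_, hF.zero⟩
  · rw [← h γ (hp γ hγ)]; exact hF.inter γ hγ
  · rw [← h γ (hp γ hγ)]; exact hF.restr_eq γ hγ
  · rw [← h γ hγ] at h1
    obtain ⟨γ', hγ', h2⟩ := hF.cofinal ξ hξ γ hγ h1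
    exact ⟨γ', hγ', by rwa [← h γ' (hp γ' hγ')]⟩

theorem Good.congr {ζ : Ordinal.{u}} {r : P} (h : ∀ γ < δ, Λ γ = Λ' γ)
    (hG : S.Good Λ i δ ζ r) : S.Good Λ' i δ ζ r := by
  refine ⟨hG.1.congr h, fun γ hγ => ?_⟩
  have hγδ : γ < δ := hγ.2
  rw [← h γ hγδ]
  exact (hG.2 γ hγ).congr fun γ' hγ' => h γ' (hγ'.trans hγδ)

theorem IsLevel.congr {l : Level.{u, v} P} (h : ∀ γ < δ, Λ γ = Λ' γ) (hl : S.IsLevel Λ δ l) :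
    S.IsLevel Λ' δ l := by
  have h' : ∀ β < δ, (Level.toMoveII ∘ Λ) β = (Level.toMoveII ∘ Λ') β := fun β hβ =>
    congrArg Level.toMoveII (h β hβ)
  refine ⟨Coding.isStage_congr h' hl.stage, hl.elt_mem, Coding.legalI_congr h' hl.legal,
    hl.mem_ideal, hl.mono, fun i hi β hβ => ?_, fun i hi hil hG => ?_⟩
  · rw [← h β hβ.2]; exact hl.seq_le i hi β hβ
  · have h1 := hl.isFamily i hi hil (hG.congr fun γ hγ => (h γ hγ).symm)
    refine ⟨h1.restr_le, h1.dom_subset, h1.coherent, fun β hβ => ?_, h1.base_le, h1.decides,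
      h1.mem_system⟩
    rw [← h β hβ.2]; exact h1.fam_le β hβ

end Guide

/-! ### The approximations fit together club often. -/

variable {κ : Cardinal.{u}}

/-- Two enumerations have the same initial segments below `θ` club often. -/
theorem club_image_inter_eq {e e' : Ordinal.{u} → Ordinal.{u}} {θ : Ordinal.{u}}
    (he : Iio θ ⊆ e '' Iio κ.ord) (he' : Iio θ ⊆ e' '' Iio κ.ord) :
    Club κ fun i => e' '' Iio i ∩ Iio θ = e '' Iio i ∩ Iio θ := by
  have key : ∀ {e e' : Ordinal.{u} → Ordinal.{u}}, Iio θ ⊆ e '' Iio κ.ord →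
      Club κ fun i => e' '' Iio i ∩ Iio θ ⊆ e '' Iio i ∩ Iio θ := by
    intro e e' he
    refine (Club.of_exists (R := fun j k => e' j < θ → e' j = e k) fun j hj => ?_).mono
      fun i _ _ h => ?_
    · by_cases h : e' j < θ
      · obtain ⟨k, hk, h1⟩ := he h
        exact ⟨k, hk, fun _ => h1.symm⟩
      · exact ⟨j, hj, fun h1 => absurd h1 h⟩
    · rintro _ ⟨⟨j, hj, rfl⟩, h1⟩
      obtain ⟨k, hk, h2⟩ := h j hj
      exact ⟨⟨k, hk, (h2 h1).symm⟩, h1⟩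
  exact ((key he).and (key he')).mono fun i _ _ h => h.1.antisymm h.2

variable {P : Type v} [PartialOrder P]

namespace Guide

variable {C : Coding κ P} {S : Guide.{u, v} C} {i : Ordinal.{u}}

theorem part_subset (θ i : Ordinal.{u}) : S.part θ i ⊆ Iio θ := inter_subset_right

theorem isSmall_part {θ : Ordinal.{u}} (hi : i < κ.ord) : IsSmall κ (S.part θ i) :=
  ((isSmall_Iio hi).image _).mono inter_subset_left

theorem part_mono {θ j : Ordinal.{u}} (h : j ≤ i) : S.part θ j ⊆ S.part θ i :=
  inter_subset_inter_left _ (image_mono (Iio_subset_Iio h))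

theorem exists_mem_part {θ ξ : Ordinal.{u}} (hθ : θ < (succ κ).ord) (h : ξ < θ) :
    ∃ j < κ.ord, ξ ∈ S.part θ j := by
  obtain ⟨j, hj, h1⟩ := S.surjOn_enum θ hθ h
  exact ⟨Order.succ j, (Cardinal.isSuccLimit_ord S.isRegular.aleph0_le).succ_lt hj,
    ⟨j, Order.lt_succ j, h1⟩, h⟩

/-- A diagonal intersection along the enumeration of θ in length κ. -/
theorem club_forall_mem_part {θ : Ordinal.{u}} {p : Ordinal.{u} → Ordinal.{u} → Prop}
    (h : ∀ γ < θ, Club κ (p γ)) : Club κ fun i => ∀ γ ∈ S.part θ i, p γ i := by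
  refine (Club.diag S.isRegular (p := fun j i => S.enum θ j < θ → p (S.enum θ j) i)
    fun j hj => ?_).mono fun i _ _ hi => ?_
  · by_cases h1 : S.enum θ j < θ
    · exact (h _ h1).mono fun i _ _ h2 _ => h2
    · exact Club.of_forall fun i _ _ h2 => absurd h2 h1
  · rintro _ ⟨⟨j, hj, rfl⟩, h1⟩
    exact hi j hj h1

variable [Nonempty P] {Λ : Ordinal.{u} → Level.{u, v} P} {δ : Ordinal.{u}}

theorem isLUB_before {l : Level.{u, v} P} (hl : S.IsLevel Λ δ l) (hi : i < κ.ord) :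
    IsLUB (l.seq '' Iio i) (l.before i) := by
  obtain ⟨q, hq, _⟩ := S.isUniform.exists_isLUB_on (isSmall_Iio hi)
    (hl.mono.mono (Iio_subset_Iio hi.le))
  rw [Level.before, lub_eq hq]
  exact hq

/-- An increasing sequence of conditions in the quotient that dominates the sequences of the earlier
stages extends the approximations to these stages club often. -/
theorem club_fits (hδ : δ < (succ κ).ord) (hΛ : ∀ β < δ, S.IsLevel Λ β (Λ β))
    {e : Ordinal.{u} → Ordinal.{u}} {θ : Ordinal.{u}} (hθ : ∀ β < δ, (Λ β).height ≤ θ)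
    (he : ∀ β < δ, Iio (Λ β).height ⊆ e '' Iio κ.ord) {q : Ordinal.{u} → P}
    (hq : MonotoneOn q (Iio κ.ord))
    (hqQ : ∀ j < κ.ord, q j ∈ C.quotBefore (Level.toMoveII ∘ Λ) δ)
    (hqs : ∀ j < κ.ord, ∀ β ∈ S.part δ j, (Λ β).seq j ≤ q j) :
    Club κ fun i => S.Fits Λ i δ (e '' Iio i ∩ Iio θ) (lub (q '' Iio i)) := by
  have hC := S.isUniform
  have hlim := Cardinal.isSuccLimit_ord S.isRegular.aleph0_le
  have h1 : Club κ fun i => ∀ γ ∈ S.part δ i,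
      S.part (Λ γ).height i = (e '' Iio i ∩ Iio θ) ∩ Iio (Λ γ).height :=
    club_forall_mem_part fun γ hγ => (club_image_inter_eq (he γ hγ) (S.surjOn_enum _
      (hΛ γ hγ).stage.height_lt)).mono fun i _ _ h => by
        rw [inter_assoc, inter_eq_self_of_subset_right (Iio_subset_Iio (hθ γ hγ))]
        exact h
  have h2 : Club κ fun i => ∀ γ ∈ S.part δ i, S.part γ i = S.part δ i ∩ Iio γ :=
    club_forall_mem_part fun γ hγ => (club_image_inter_eq (e := S.enum δ) (e' := S.enum γ) (θ := γ)
      (fun ξ hξ => S.surjOn_enum δ hδ (lt_trans hξ hγ))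
      (S.surjOn_enum γ (hγ.trans hδ))).mono fun i _ _ h => by
        change S.enum γ '' Iio i ∩ Iio γ = (S.enum δ '' Iio i ∩ Iio δ) ∩ Iio γ
        rw [inter_assoc, inter_eq_self_of_subset_right (Iio_subset_Iio hγ.le)]
        exact h
  -- Restrictions of q and the generating sequence of γ are cofinal in each other: the former lie in
  -- the ideal of γ, and q dominates the latter once γ has been enumerated.
  have h3 : Club κ fun i => ∀ γ ∈ S.part δ i,
      C.restr (lub (q '' Iio i)) (Λ γ).height = (Λ γ).before i := by
    refine club_forall_mem_part fun γ hγ => ?_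
    refine ((Club.of_exists (R := fun j k => C.restr (q j) (Λ γ).height ≤ (Λ γ).seq k)
      fun j hj => ?_).and (Club.of_exists (R := fun j k => (Λ γ).seq j ≤ q k)
      fun j hj => ?_)).mono fun i hi _ h => ?_
    · exact ((hΛ γ hγ).mem_ideal _).1 (hqQ j hj γ hγ)
    · obtain ⟨k, hk, hγk⟩ := exists_mem_part (S := S) hδ hγ
      refine ⟨max j k, max_lt hj hk, ((hΛ γ hγ).mono hj (mem_Iio.2 (max_lt hj hk))
        (le_max_left _ _)).trans (hqs _ (max_lt hj hk) γ (part_mono (le_max_right _ _) hγk))⟩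
    · obtain ⟨x, hx, _, hxr⟩ := hC.exists_isLUB_on (isSmall_Iio hi) (hq.mono (Iio_subset_Iio hi.le))
      have hb := isLUB_before (hΛ γ hγ) hi
      rw [lub_eq hx]
      apply le_antisymm
      · refine (hxr _).2 ?_
        rintro _ ⟨j, hj, rfl⟩
        obtain ⟨k, hk, h2⟩ := h.1 j hj
        exact h2.trans (hb.1 (mem_image_of_mem _ hk))
      · refine hb.2 ?_
        rintro _ ⟨j, hj, rfl⟩
        obtain ⟨k, hk, h2⟩ := h.2 j hj
        refine hC.le_restr_iff.2 ⟨h2.trans (hx.1 (mem_image_of_mem _ hk)), ?_⟩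
        exact (hΛ γ hγ).stage.subset (((hΛ γ hγ).mem_ideal _).2
          ⟨j, lt_trans hj hi, le_rfl⟩)
  have h4 : Club κ fun i => ∀ j < i, ∃ k < i, ∀ γ < δ, e j < (Λ γ).height →
      S.enum δ k < δ ∧ e j < (Λ (S.enum δ k)).height := by
    refine Club.of_exists fun j hj => ?_
    by_cases h : ∃ γ < δ, e j < (Λ γ).height
    · obtain ⟨γ, hγ, h5⟩ := h
      obtain ⟨k, hk, rfl⟩ := S.surjOn_enum δ hδ hγ
      exact ⟨k, hk, fun _ _ _ => ⟨hγ, h5⟩⟩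
    · exact ⟨j, hj, fun γ hγ h5 => absurd ⟨γ, hγ, h5⟩ h⟩
  have h5 : Club κ fun i => δ ≠ 0 → 0 ∈ S.part δ i := by
    by_cases h : δ = 0
    · exact Club.of_forall fun _ _ _ h' => absurd h h'
    · obtain ⟨k, hk, hk'⟩ := exists_mem_part (S := S) hδ (pos_iff_ne_zero.2 h)
      exact (Club.gt hk).mono fun i _ _ hi _ => part_mono hi.le hk'
  refine (((h1.and h2).and (h3.and h4)).and h5).mono fun i _ _ h => ⟨h.1.1.1, h.1.1.2, h.1.2.1, ?_,
    h.2⟩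
  rintro _ ⟨⟨j, hj, rfl⟩, _⟩ γ hγ h6
  obtain ⟨k, hk, h7⟩ := h.1.2.2 j hj
  obtain ⟨h8, h9⟩ := h7 γ hγ h6
  exact ⟨_, ⟨⟨k, hk, rfl⟩, h8⟩, h9⟩

/-- The generating sequence of a level is itself a dominating sequence in the quotient. -/
theorem club_fits_level (hδ : δ < (succ κ).ord) (hΛ : ∀ β ≤ δ, S.IsLevel Λ β (Λ β)) :
    Club κ fun i => S.Fits Λ i δ (S.part (Λ δ).height i) ((Λ δ).before i) := by
  have hl := hΛ δ le_rfl
  have hst : ∀ β < δ, C.IsStage (Level.toMoveII ∘ Λ) β ((Level.toMoveII ∘ Λ) β) :=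
    fun β hβ => (hΛ β hβ.le).stage
  refine club_fits hδ (fun β hβ => hΛ β hβ.le) (fun β hβ => (hl.stage.lt_height β hβ).le)
    (fun β hβ => ?_) hl.mono (fun j hj => ?_) hl.seq_le
  · exact (Iio_subset_Iio (hl.stage.lt_height β hβ).le).trans
      (S.surjOn_enum _ hl.stage.height_lt)
  · exact hl.stage.restr_mem _ ((hl.mem_ideal _).2 ⟨j, hj, le_rfl⟩)

/-- The approximations to the stages below `δ` are good club often. -/
theorem club_good (hδ : δ < (succ κ).ord) (hΛ : ∀ β < δ, S.IsLevel Λ β (Λ β)) :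
    Club κ fun i => ∀ β ∈ S.part δ i, S.Fits Λ i β (S.part (Λ β).height i) ((Λ β).before i) :=
  club_forall_mem_part fun _ hβ => club_fits_level (hβ.trans hδ) fun γ hγ => hΛ γ (hγ.trans_lt hβ)

end Guide

/-! ### Passing the chosen conditions on to later stages. -/

variable {κ : Cardinal.{u}} {P : Type v} [PartialOrder P]

namespace Coding

variable {C : Coding κ P}

theorem IsUniform.map_shift_restr (hC : C.IsUniform) (hκ : ℵ₀ ≤ κ) (w : Set Ordinal.{u})
    {θ : Ordinal.{u}} (hθ : θ < (succ κ).ord) (γ : Ordinal.{u}) (p : P) :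
    C.map (shift w θ) (C.restr p (shiftPos w θ γ)) = C.restr (C.map (shift w θ) p) γ :=
  hC.map_restr (isShift_shift hκ w hθ) fun _ _ => lt_shiftPos

/-- The images of a condition under two enumerations that agree below `γ` agree below `γ`. -/
theorem IsUniform.restr_map_shift_eq (hC : C.IsUniform) (hκ : ℵ₀ ≤ κ) {w w' : Set Ordinal.{u}}
    {θ θ' γ : Ordinal.{u}} (hθκ : θ < (succ κ).ord) (hθκ' : θ' < (succ κ).ord) (hθ : γ ≤ θ)
    (hθ' : γ ≤ θ') (h : w ∩ Iio γ = w' ∩ Iio γ) (p : P) :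
    C.restr (C.map (shift w θ) p) γ = C.restr (C.map (shift w' θ') p) γ := by
  rw [← hC.map_shift_restr hκ w hθκ, ← hC.map_shift_restr hκ w' hθκ',
    shiftPos_eq_of_inter_eq hθ hθ' h]
  refine hC.map_congr (isShift_shift hκ w hθκ) (isShift_shift hκ w' hθκ') fun ξ hξ => ?_
  rw [← shiftPos_eq_of_inter_eq hθ hθ' h] at hξ
  exact (shift_eq_of_inter_eq hθ hθ' h (lt_shiftPos.1 (hC.dom_restr_subset _ _ hξ))).symm

end Coding

namespace Guide

variable {C : Coding κ P} {S : Guide.{u, v} C} [Nonempty P]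
  {Λ : Ordinal.{u} → Level.{u, v} P} {δ i : Ordinal.{u}}

theorem Fits.inter_eq {w : Set Ordinal.{u}} {r : P} (hF : S.Fits Λ i δ w r) {β : Ordinal.{u}}
    (hβ : β ∈ S.part δ i) :
    w ∩ Iio (Λ β).height = S.part (Λ β).height i ∩ Iio (Λ β).height := by
  rw [hF.inter β hβ, inter_assoc, inter_self]

theorem Fits.good {w : Set Ordinal.{u}} {r : P} (hF : S.Fits Λ i δ w r)
    (hG : ∀ β ∈ S.part δ i, S.Fits Λ i β (S.part (Λ β).height i) ((Λ β).before i))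
    {β : Ordinal.{u}} (hβ : β ∈ S.part δ i) : S.Good Λ i β (Λ β).height ((Λ β).before i) :=
  ⟨hG β hβ, fun γ hγ => hG γ ((hF.index β hβ).subset hγ).1⟩

/-- A scenario that extends the approximations to the earlier stages is considered at these
stages. -/
theorem Fits.mem_guesses (hΛ : ∀ β < δ, S.IsLevel Λ β (Λ β))
    {w : Set Ordinal.{u}} {θ : Ordinal.{u}} {r : P} (hθκ : θ < (succ κ).ord)
    (hθ : ∀ β < δ, (Λ β).height ≤ θ) (hF : S.Fits Λ i δ w r) {a : Scenario.{u, v} P}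
    (ha : a ∈ S.scenarios i) (hn : ∀ β < δ, shiftPos w θ (Λ β).height ≤ a.node)
    (hb : ∀ β < δ, C.restr (C.map (shift w θ) a.base) (Λ β).height = C.restr r (Λ β).height)
    {β : Ordinal.{u}} (hβ : β ∈ S.part δ i) :
    a ∈ S.guesses i (Λ β).height ((Λ β).before i) := by
  have hβδ : β < δ := hβ.2
  have hκ := S.isRegular.aleph0_le
  refine ⟨ha, ?_, ?_⟩
  · rw [← shiftPos_eq_of_inter_eq (hθ β hβδ) le_rfl (hF.inter_eq hβ)]
    exact hn β hβδ
  · rw [← S.isUniform.restr_map_shift_eq hκ hθκ (hΛ β hβδ).stage.height_lt (hθ β hβδ) le_rfl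
      (hF.inter_eq hβ), hb β hβδ, hF.restr_eq β hβ]

/-- The conditions chosen for a scenario at the earlier stages have a least upper bound. -/
theorem exists_isLUB_fam (hδ : δ < (succ κ).ord) (hδ0 : δ ≠ 0)
    (hΛ : ∀ β < δ, S.IsLevel Λ β (Λ β)) (hi : i < κ.ord) (hil : IsSuccLimit i)
    {w : Set Ordinal.{u}} {θ : Ordinal.{u}} {r : P} (hθκ : θ < (succ κ).ord)
    (hθ : ∀ β < δ, (Λ β).height ≤ θ) (hF : S.Fits Λ i δ w r)
    (hG : ∀ β ∈ S.part δ i, S.Fits Λ i β (S.part (Λ β).height i) ((Λ β).before i))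
    {a : Scenario.{u, v} P} (ha : a ∈ S.scenarios i)
    (hn : ∀ β < δ, shiftPos w θ (Λ β).height ≤ a.node)
    (hb : ∀ β < δ, C.restr (C.map (shift w θ) a.base) (Λ β).height = C.restr r (Λ β).height) :
    ∃ f, (∀ α, IsLUB ((fun β => C.restr ((Λ β).fam i a) α) '' S.part δ i) (C.restr f α)) ∧
      (∀ β ∈ S.part δ i, (Λ β).fam i a ≤ f) ∧ C.dom f ⊆ Iio a.top ∧
      C.map (shift w θ) f ∈ C.quotBefore (Level.toMoveII ∘ Λ) δ ∧ a.base ≤ f := by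
  have hC := S.isUniform
  have hκ := S.isRegular.aleph0_le
  have hst : ∀ β < δ, C.IsStage (Level.toMoveII ∘ Λ) β ((Level.toMoveII ∘ Λ) β) :=
    fun β hβ => (hΛ β hβ).stage
  have hB := isSmall_part (S := S) (θ := δ) hi
  have hBδ : ∀ β ∈ S.part δ i, β < δ := fun β hβ => hβ.2
  have hh := isShift_shift hκ w hθκ
  have hmem := fun β hβ => hF.mem_guesses hΛ hθκ hθ ha hn hb (β := β) hβ
  have hfam : ∀ β ∈ S.part δ i, S.IsFamily Λ β i (Λ β).move (Λ β).height ((Λ β).before i)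
      ((Λ β).seq i) ((Λ β).fam i) := fun β hβ =>
    (hΛ β (hBδ β hβ)).isFamily i hi hil (hF.good hG hβ)
  -- By `Fits.index` the part of c is an initial segment of the part of δ, so stage c did extend the
  -- condition of stage b.
  have hmono : MonotoneOn (fun β => (Λ β).fam i a) (S.part δ i) := by
    intro b hb c hc hbc
    rcases hbc.eq_or_lt with rfl | hlt
    · exact le_rfl
    · exact (hfam c hc).fam_le b ((hF.index c hc).superset ⟨hb, hlt⟩) a (hmem c hc)
  have hle : ∀ β ∈ S.part δ i,
      C.restr (C.map (shift w θ) ((Λ β).fam i a)) (Λ β).height ∈ (Λ β).ideal := by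
    intro β hβ
    rw [hC.restr_map_shift_eq hκ hθκ (hst β (hBδ β hβ)).height_lt (hθ β (hBδ β hβ)) le_rfl
      (hF.inter_eq hβ)]
    exact ((hΛ β (hBδ β hβ)).mem_ideal _).2 ⟨i, hi, (hfam β hβ).restr_le a (hmem β hβ)⟩
  obtain ⟨f, hf, hfd, hfr⟩ := hC.exists_isLUB_on hB hmono
  have hle' : ∀ β ∈ S.part δ i, (Λ β).fam i a ≤ f := fun β hβ => hf.1 (mem_image_of_mem _ hβ)
  refine ⟨f, hfr, hle', ?_, ?_, ?_⟩
  · rw [hfd]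
    exact iUnion₂_subset fun β hβ => (hfam β hβ).dom_subset a (hmem β hβ)
  -- It is enough to test the stages in `part δ i`: by `Fits.cofinal` their heights bound all
  -- relevant points of w, hence of the domain.
  · refine Coding.mem_quotBefore_of_cofinal hC hst hδ hκ (B := S.part δ i) (part_subset _ _)
      ⟨0, hF.zero hδ0⟩ hB (fun ξ hξ h => ?_) fun β hβ => ?_
    · obtain ⟨γ, hγ, hξγ⟩ := Coding.lt_heightBefore.1 h
      rw [hC.dom_map hh] at hξ
      obtain ⟨η, hη, rfl⟩ := hξ
      have : shift w θ η ∈ w ∪ Ici θ := by rw [← range_shift]; exact mem_range_self _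
      exact hF.cofinal _ (this.resolve_right fun h2 =>
        absurd (h2.trans_lt hξγ) (not_lt.2 (hθ γ hγ))) γ hγ hξγ
    · obtain ⟨q, hq, _, hqr⟩ := hC.exists_isLUB_on hB
        (p := fun β => C.map (shift w θ) ((Λ β).fam i a))
        fun b hb c hc hbc => hC.map_mono hh (hmono hb hc hbc)
      rw [(hC.map_isLUB_on hh hB hmono hf).unique hq]
      refine (hst β (hBδ β hβ)).lub_mem (hB.image _) ?_ (hqr _)
      rintro _ ⟨c, hc, rfl⟩
      -- Conditions of stages up to β lie below that of β; those of later stages restrict into the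
      -- ideal of β because later ideals project to it.
      rcases le_or_gt c β with h | h
      · exact (hst β (hBδ β hβ)).isLowerSet
          (hC.restr_mono (hC.map_mono hh (hmono hc hβ h))) (hle β hβ)
      · have h1 : C.restr (C.restr _ (Λ c).height) (Λ β).height ∈ (Λ β).ideal :=
          (hst c (hBδ c hc)).restr_mem _ (hle c hc) β h
        have h2 : (Λ β).height < (Λ c).height := (hst c (hBδ c hc)).lt_height β h
        rwa [hC.restr_restr h2.le] at h1
  -- Stage 0 went above the base, and the later conditions lie above that of stage 0.
  · have h0 := hF.zero hδ0
    exact ((hfam 0 h0).base_le rfl a (hmem 0 h0)).trans (hle' 0 h0)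

end Guide

/-! ### Choosing coherent conditions for all scenarios at once. -/

variable {κ : Cardinal.{u}} {P : Type v} [PartialOrder P]

/-- Pulling back along an enumeration preserves the properties of a quotient. -/
theorem Coding.IsNice.preimage_map {C : Coding κ P} (hC : C.IsUniform) {η ζ z : Ordinal.{u}}
    {Q : Set P} (hQ : C.IsNice η Q) (hηζ : η ≤ ζ) {h : Ordinal.{u} → Ordinal.{u}}
    (hh : IsShift κ h) (hz : h z = ζ) : C.IsNice z (C.map h ⁻¹' Q) := by
  refine ⟨fun a b hab ha => hQ.isLowerSet (hC.map_mono hh hab) ha,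
    fun ι _ _ hι p hp hpQ q hq => hQ.lub_mem ι hι _ (fun a b hab => hC.map_mono hh (hp hab)) hpQ _
      (hC.map_isLUB hh hι hp hq), fun f hf q hq γ hγ hzγ hle hd => ?_⟩
  obtain ⟨r, hr, h1, h2, h3⟩ := hQ.amalgam _ hf _ hq (h γ) (hh.map_lt γ hγ)
    (hηζ.trans (hz ▸ hh.strictMono.monotone hzγ))
    (by
      rw [← hC.map_restr hh (γ := γ) fun ξ _ => hh.strictMono.lt_iff_lt.symm]
      exact hC.map_mono hh hle)
    (by
      rw [hC.dom_map hh]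
      rintro _ ⟨ξ, hξ, rfl⟩
      exact hh.strictMono (hd hξ))
  obtain ⟨x, rfl⟩ := hC.exists_map_eq hh (q := r) (by
    rw [h3, hC.dom_map hh, hC.dom_map hh, ← image_union]
    exact image_subset_range _ _)
  refine ⟨x, hr, (hC.map_le_map_iff hh).1 h1, (hC.map_le_map_iff hh).1 h2, ?_⟩
  rw [hC.dom_map hh, hC.dom_map hh, hC.dom_map hh, ← image_union] at h3
  exact hh.strictMono.injective.image_injective h3

namespace Guide

variable {C : Coding κ P} {S : Guide.{u, v} C} {i ζ : Ordinal.{u}} {r : P}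

/-- The scenarios considered at a stage share the approximation r below ζ; this is the common root
of the tree. -/
theorem restr_base_eq (hζ : ζ < (succ κ).ord) {a b : Scenario.{u, v} P}
    (ha : a ∈ S.guesses i ζ r) (hb : b ∈ S.guesses i ζ r) :
    C.restr a.base (shiftPos (S.part ζ i) ζ ζ) = C.restr b.base (shiftPos (S.part ζ i) ζ ζ) := by
  have hκ := S.isRegular.aleph0_le
  apply S.isUniform.map_injective (isShift_shift hκ (S.part ζ i) hζ)
  rw [S.isUniform.map_shift_restr hκ _ hζ, S.isUniform.map_shift_restr hκ _ hζ, ha.2.2, hb.2.2]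

/-- The tree of the scenarios that are considered at a stage. -/
noncomputable def branching (hζ : ζ < (succ κ).ord) (hi : i < κ.ord) :
    Coding.Branching κ (shiftPos (S.part ζ i) ζ ζ) (S.guesses i ζ r) where
  gap a b := a.1.gap C b.1
  node a := a.1.node
  top a := a.1.top
  symm a b := Scenario.gap_comm
  ultra a b c := by
    have hn : ∀ a : S.guesses i ζ r, a.1.node < (succ κ).ord := fun a =>
      ((S.valid i hi _ a.2.1).node_le.trans_lt (S.valid i hi _ a.2.1).top_lt).trans
        (Cardinal.ord_lt_ord.2 (Order.lt_succ κ))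
    exact Scenario.min_gap_le S.isUniform (hn a) (hn b) a.2.2.1 b.2.2.1 c.2.2.1
      (restr_base_eq hζ a.2 b.2) (restr_base_eq hζ b.2 c.2)
  gap_le a b := Scenario.gap_le_node
  le_gap a b := Scenario.le_gap a.2.2.1 b.2.2.1 (restr_base_eq hζ a.2 b.2)
  node_le a := (S.valid i hi _ a.2.1).node_le
  top_lt a := (S.valid i hi _ a.2.1).top_lt.trans (Cardinal.ord_lt_ord.2 (Order.lt_succ κ))

end Guide

variable {κ : Cardinal.{u}} {P : Type v} [PartialOrder P]

namespace Guide

variable {C : Coding κ P} {S : Guide.{u, v} C} {i ζ : Ordinal.{u}} {r : P}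

theorem isSmall_univ_guesses (hi : i < κ.ord) :
    IsSmall κ (Set.univ : Set (S.guesses i ζ r)) := by
  have := (S.isSmall_scenarios i hi).mono (s := S.guesses i ζ r) fun a ha => ha.1
  unfold IsSmall at *
  rwa [mk_univ]

variable [Nonempty P] {Λ : Ordinal.{u} → Level.{u, v} P} {δ : Ordinal.{u}}

/-- Coherent conditions that lie above the conditions chosen at the earlier stages. -/
theorem exists_coherent_initial (hδ : δ < (succ κ).ord) (hΛ : ∀ β < δ, S.IsLevel Λ β (Λ β))
    (hdec : C.DecidesBounds (heightBefore (Level.toMoveII ∘ Λ) δ)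
      (C.quotBefore (Level.toMoveII ∘ Λ) δ))
    (hζκ : ζ < (succ κ).ord) (hζ : heightBefore (Level.toMoveII ∘ Λ) δ ≤ ζ)
    (hi : i < κ.ord) (hil : IsSuccLimit i) (hG : S.Good Λ i δ ζ r) :
    ∃ f : S.guesses i ζ r → P, (branching hζκ hi).Coherent C
        (C.map (shift (S.part ζ i) ζ) ⁻¹' C.quotBefore (Level.toMoveII ∘ Λ) δ) f Set.univ ∧
      (∀ β ∈ S.part δ i, ∀ a, (Λ β).fam i a.1 ≤ f a) ∧ (∀ a, a.1.base ≤ f a) ∧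
      (δ = 0 → ∀ a, f a ∈ upperBounds a.1.targets ∨
        ¬ ∃ x ∈ upperBounds a.1.targets, C.restr (f a) a.1.node ≤ x) := by
  have hC := S.isUniform
  have hκ := S.isRegular.aleph0_le
  have hst : ∀ β < δ, C.IsStage (Level.toMoveII ∘ Λ) β ((Level.toMoveII ∘ Λ) β) :=
    fun β hβ => (hΛ β hβ).stage
  have hΛζ : ∀ β < δ, (Λ β).height ≤ ζ := fun β hβ =>
    (Coding.le_heightBefore (y := Level.toMoveII ∘ Λ) hβ).trans hζ
  have hv : ∀ a : S.guesses i ζ r, a.1.Valid C := fun a => S.valid i hi _ a.2.1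
  have hnκ : ∀ a : S.guesses i ζ r, a.1.node < (succ κ).ord := fun a =>
    ((hv a).node_le.trans_lt (hv a).top_lt).trans (Cardinal.ord_lt_ord.2 (Order.lt_succ κ))
  -- At stage 0 the quotient is all of P, and the boundedness of the targets is decided there once
  -- and for all. Later stages take least upper bounds of what was chosen before.
  rcases eq_or_ne δ 0 with rfl | hδ0
  · have hnice := (Coding.isNice_quotBefore hC hst hδ S.isRegular hdec).preimage_map hC hζ
      (isShift_shift hκ (S.part ζ i) hζκ) (shift_shiftPos _ _)
    have hQ : C.map (shift (S.part ζ i) ζ) ⁻¹' C.quotBefore (Level.toMoveII ∘ Λ) 0 = Set.univ := by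
      rw [Coding.quotBefore_zero, preimage_univ]
    obtain ⟨F, hF, hF'⟩ := Coding.Branching.exists_coherent_mem
      (T := branching hζκ hi) (f := fun a => a.1.base) hC hnice S.aleph0_lt
      (isSmall_univ_guesses (S := S) (ζ := ζ) (r := r) hi)
      (fun a => {g | g ∈ upperBounds a.1.targets ∨
        ¬ ∃ x ∈ upperBounds a.1.targets, C.restr g a.1.node ≤ x})
      ⟨fun a _ => ⟨hQ ▸ mem_univ _, (hv a).dom_base.trans (Iio_subset_Iio (hv a).node_le)⟩,
        fun a _ b _ => Scenario.restr_gap hC (hnκ a) a.2.2.1 b.2.2.1 (restr_base_eq hζκ a.2 b.2)⟩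
      (by
        rintro a p (hp | hp) q - hpq
        · exact Or.inl fun x hx => (hp hx).trans hpq
        · exact Or.inr fun ⟨x, hx, hx'⟩ => hp ⟨x, hx, (hC.restr_mono hpq).trans hx'⟩)
      (by
        intro a q hq γ hzγ hγ hqd hle
        obtain ⟨k, hk, h1, h2, h3⟩ := hnice.amalgam _ (hQ ▸ mem_univ a.1.base) q hq γ
          (hγ.trans_lt (hnκ a)) hzγ hle hqd
        have hkd : C.dom k ⊆ Iio a.1.node := by
          rw [h3]
          exact union_subset (hv a).dom_base (hqd.trans (Iio_subset_Iio hγ))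
        have hkt : C.dom k ⊆ Iio a.1.top := hkd.trans (Iio_subset_Iio (hv a).node_le)
        -- Since k has its domain below the node, it equals its restriction: either k extends to a
        -- bound of the targets, or k already excludes one.
        by_cases hx : ∃ x ∈ upperBounds a.1.targets, C.restr k a.1.node ≤ x
        · rw [hC.restr_eq_self hkd] at hx
          obtain ⟨x, hx, hkx⟩ := hx
          obtain ⟨x', _, hx', hxd⟩ := hC.interpolation_small S.isRegular
            (X := {k} ∪ a.1.targets) ((isSmall_of_finite hκ (finite_singleton _)).union hκ
              (hv a).isSmall_targets) (y := x) (by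
                rintro p (rfl | hp)
                · exact hkx
                · exact hx hp)
          have hkx' : k ≤ x' := hx' (Or.inl rfl)
          refine ⟨x', Or.inl fun p hp => hx' (Or.inr hp), ⟨hQ ▸ mem_univ _, ?_⟩, h1.trans hkx',
            h2.trans hkx'⟩
          rw [hxd]
          refine iUnion₂_subset fun p hp => ?_
          rcases hp with rfl | hp
          · exact hkt
          · exact (hv a).dom_target p hp
        · exact ⟨k, Or.inr hx, ⟨hk, hkt⟩, h1, h2⟩)
    exact ⟨F, hF, fun β hβ => absurd hβ.2 (by simp), fun a => (hF' a).1, fun _ a => (hF' a).2⟩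
  · have hnode : ∀ a : S.guesses i ζ r, ∀ β < δ,
        shiftPos (S.part ζ i) ζ (Λ β).height ≤ a.1.node := fun a β hβ =>
      (le_of_forall_lt fun ξ hξ =>
        lt_shiftPos.2 ((lt_shiftPos.1 hξ).trans_le (hΛζ β hβ))).trans a.2.2.1
    have hbase : ∀ a : S.guesses i ζ r, ∀ β < δ,
        C.restr (C.map (shift (S.part ζ i) ζ) a.1.base) (Λ β).height = C.restr r (Λ β).height :=
      fun a β hβ => (hC.restr_restr (hΛζ β hβ)).symm.trans
        (congrArg (fun x => C.restr x (Λ β).height) a.2.2.2)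
    choose f hf1 hf2 hf3 hf4 hf5 using fun a : S.guesses i ζ r =>
      exists_isLUB_fam hδ hδ0 hΛ hi hil hζκ hΛζ hG.1 hG.2 a.2.1 (hnode a) (hbase a)
    refine ⟨f, ⟨fun a _ => ⟨hf4 a, hf3 a⟩, fun a _ b _ => ?_⟩, fun β hβ a => hf2 a β hβ, hf5,
      fun h => absurd h hδ0⟩
    -- Restriction commutes with these least upper bounds, so coherence at the earlier stages gives
    -- coherence of the limits.
    have heq : (fun β => C.restr ((Λ β).fam i a.1) (a.1.gap C b.1)) '' S.part δ i =
        (fun β => C.restr ((Λ β).fam i b.1) (a.1.gap C b.1)) '' S.part δ i :=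
      image_congr fun β hβ =>
        ((hΛ β hβ.2).isFamily i hi hil (hG.1.good hG.2 hβ)).coherent _
          (hG.1.mem_guesses hΛ hζκ hΛζ a.2.1 (hnode a) (hbase a) hβ) _
          (hG.1.mem_guesses hΛ hζκ hΛζ b.2.1 (hnode b) (hbase b) hβ)
    exact (hf1 a _).unique (heq ▸ hf1 b _)

/-- The family inherited from the earlier stages is extended into the systems named by the
scenarios; its common part below ζ is what the generating sequence has to absorb. -/
theorem exists_isFamily (hδ : δ < (succ κ).ord) (hΛ : ∀ β < δ, S.IsLevel Λ β (Λ β))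
    (hdec : C.DecidesBounds (heightBefore (Level.toMoveII ∘ Λ) δ)
      (C.quotBefore (Level.toMoveII ∘ Λ) δ))
    {m : MoveI.{u, v} P} (hm : C.LegalI (Level.toMoveII ∘ Λ) δ m)
    (hζκ : ζ < (succ κ).ord) (hζ : heightBefore (Level.toMoveII ∘ Λ) δ ≤ ζ)
    (hi : i < κ.ord) (hil : IsSuccLimit i) (hG : S.Good Λ i δ ζ r)
    (hr : r ∈ C.quotBefore (Level.toMoveII ∘ Λ) δ) (hrd : C.dom r ⊆ Iio ζ) :
    ∃ F, ∃ t ∈ C.quotBefore (Level.toMoveII ∘ Λ) δ, C.dom t ⊆ Iio ζ ∧ r ≤ t ∧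
      S.IsFamily Λ δ i m ζ r t F := by
  classical
  have hC := S.isUniform
  have hκ := S.isRegular.aleph0_le
  have hst : ∀ β < δ, C.IsStage (Level.toMoveII ∘ Λ) β ((Level.toMoveII ∘ Λ) β) :=
    fun β hβ => (hΛ β hβ).stage
  have hh := isShift_shift hκ (S.part ζ i) hζκ
  have hnice := (Coding.isNice_quotBefore hC hst hδ S.isRegular hdec).preimage_map hC hζ
    hh (shift_shiftPos _ _)
  have hquot := Coding.genericQuotient_idealBefore hC hst hδ S.isRegular hdec
  have hv : ∀ a : S.guesses i ζ r, a.1.Valid C := fun a => S.valid i hi _ a.2.1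
  have hnκ : ∀ a : S.guesses i ζ r, a.1.node < (succ κ).ord := fun a =>
    ((hv a).node_le.trans_lt (hv a).top_lt).trans (Cardinal.ord_lt_ord.2 (Order.lt_succ κ))
  obtain ⟨f, hf, hf1, hf2, hf3⟩ := exists_coherent_initial hδ hΛ hdec hζκ hζ hi hil hG
  have hwm : ∀ a : S.guesses i ζ r, shift (S.part ζ i) ζ '' Iio a.1.top ∈
      SmallSubsets κ (Iio (succ κ).ord) := fun a => by
    refine ⟨?_, isSmall_ordinal.1 ((isSmall_Iio (hv a).top_lt).image _)⟩
    rintro _ ⟨ξ, hξ, rfl⟩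
    exact hh.map_lt ξ (lt_trans hξ ((hv a).top_lt.trans (Cardinal.ord_lt_ord.2 (Order.lt_succ κ))))
  have hum : ∀ a : S.guesses i ζ r, shift (S.part ζ i) ζ '' a.1.small ⊆
      shift (S.part ζ i) ζ '' Iio a.1.top := fun a => image_mono (hv a).small_subset
  obtain ⟨F, hF, hF'⟩ := Coding.Branching.exists_coherent_mem (T := branching hζκ hi) hC hnice
    S.aleph0_lt (isSmall_univ_guesses (S := S) (ζ := ζ) (r := r) hi)
    (fun a => {g | ∀ D ∈ m.systems, m.index κ D = a.1.index →
      C.map (shift (S.part ζ i) ζ) g ∈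
        D (shift (S.part ζ i) ζ '' a.1.small) (shift (S.part ζ i) ζ '' Iio a.1.top)}) hf
    (by
      intro a p hp q hq hpq D hD hDi
      have h1 := hp D hD hDi
      refine (hm.2.2 D hD).upward _ (hwm a) _ (hum a) _ ((hm.2.2 D hD).subset _ (hwm a) _ (hum a)
        h1).1 _ ?_ h1 (hC.map_mono hh hpq) ?_
      · rw [hquot]; exact hq.1
      · rw [hC.dom_map hh]; exact image_mono hq.2)
    (by
      intro a q hq γ hzγ hγ hqd hle
      have hγt : γ ≤ a.1.top := hγ.trans (hv a).node_le
      obtain ⟨k, hk, h1, h2, h3⟩ := hnice.amalgam _ (hf.1 a (mem_univ a)).1 q hq γ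
        (hγ.trans_lt (hnκ a)) hzγ hle hqd
      have hkt : C.dom k ⊆ Iio a.1.top := by
        rw [h3]
        exact union_subset (hf.1 a (mem_univ a)).2 (hqd.trans (Iio_subset_Iio hγt))
      by_cases hD : ∃ D ∈ m.systems, m.index κ D = a.1.index
      · obtain ⟨D, hD, hDi⟩ := hD
        obtain ⟨s, hs, hks⟩ := (hm.2.2 D hD).dense _ (hwm a) _ (hum a)
          (C.map (shift (S.part ζ i) ζ) k) (hquot ▸ hk) (by
            rw [hC.dom_map hh]; exact image_mono hkt)
        have hs' := (hm.2.2 D hD).subset _ (hwm a) _ (hum a) hs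
        obtain ⟨g, rfl⟩ := hC.exists_map_eq hh (q := s) (hs'.2.trans (image_subset_range _ _))
        have hkg : k ≤ g := (hC.map_le_map_iff hh).1 hks
        refine ⟨g, fun D' hD' hDi' => ?_, ⟨?_, ?_⟩, h1.trans hkg, h2.trans hkg⟩
        -- Indices are injective on the systems of the move, so a scenario names at most one of
        -- them.
        · rwa [hm.index_spec.1 hD' hD (hDi'.trans hDi.symm)]
        · rw [hquot] at hs'
          exact hs'.1
        · have := hs'.2
          rw [hC.dom_map hh] at this
          exact (image_subset_image_iff hh.strictMono.injective).1 this
      · exact ⟨k, fun D hD' hDi => absurd ⟨D, hD', hDi⟩ hD, ⟨hk, hkt⟩, h1, h2⟩)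
  -- All branches agree up to the root, so the expansions of all F a have the same restriction to ζ.
  have hrestr : ∀ a b : S.guesses i ζ r, C.restr (C.map (shift (S.part ζ i) ζ) (F a)) ζ =
      C.restr (C.map (shift (S.part ζ i) ζ) (F b)) ζ := by
    intro a b
    rw [← hC.map_shift_restr hκ _ hζκ, ← hC.map_shift_restr hκ _ hζκ]
    have h1 := (branching hζκ hi).le_gap a b
    rw [← hC.restr_restr (p := F a) h1, hF.2 a (mem_univ a) b (mem_univ b), hC.restr_restr h1]
  obtain ⟨t, ht, htd, hrt, htF⟩ : ∃ t ∈ C.quotBefore (Level.toMoveII ∘ Λ) δ, C.dom t ⊆ Iio ζ ∧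
      r ≤ t ∧ ∀ a : S.guesses i ζ r, C.restr (C.map (shift (S.part ζ i) ζ) (F a)) ζ ≤ t := by
    rcases isEmpty_or_nonempty (S.guesses i ζ r) with hE | ⟨⟨a⟩⟩
    · exact ⟨r, hr, hrd, le_rfl, fun a => isEmptyElim a⟩
    · refine ⟨_, Coding.isLowerSet_quotBefore hC hst (hC.restr_le _ _) (hF.1 a (mem_univ a)).1,
        hC.dom_restr_subset _ _, ?_, fun b => (hrestr b a).le⟩
      conv_lhs => rw [← a.2.2.2]
      exact hC.restr_mono (hC.map_mono hh ((hf2 a).trans (hF' a).1))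
  refine ⟨fun a => if h : a ∈ S.guesses i ζ r then F ⟨a, h⟩ else a.base, t, ht, htd, hrt, ?_⟩
  refine ⟨fun a ha => ?_, fun a ha => ?_, fun a ha b hb => ?_, fun β hβ a ha => ?_,
    fun _ a ha => ?_, fun h a ha => ?_, fun a ha => ?_⟩
  · simp only [dif_pos ha]
    exact htF ⟨a, ha⟩
  · simp only [dif_pos ha]
    exact (hF.1 ⟨a, ha⟩ (mem_univ _)).2
  · simp only [dif_pos ha, dif_pos hb]
    exact hF.2 ⟨a, ha⟩ (mem_univ _) ⟨b, hb⟩ (mem_univ _)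
  · simp only [dif_pos ha]
    exact (hf1 β hβ ⟨a, ha⟩).trans (hF' _).1
  · simp only [dif_pos ha]
    exact (hf2 ⟨a, ha⟩).trans (hF' _).1
  · simp only [dif_pos ha]
    have hle := (hF' ⟨a, ha⟩).1
    rcases hf3 h ⟨a, ha⟩ with h1 | h1
    · exact Or.inl fun x hx => (h1 hx).trans hle
    · exact Or.inr fun ⟨x, hx, h2⟩ => h1 ⟨x, hx, (hC.restr_mono hle).trans h2⟩
  · simp only [dif_pos ha]
    exact (hF' ⟨a, ha⟩).2

end Guide

/-! ### Building one level. -/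

variable {κ : Cardinal.{u}} {P : Type v} [PartialOrder P]

namespace Guide

variable {C : Coding κ P} {S : Guide.{u, v} C}
  {Λ : Ordinal.{u} → Level.{u, v} P} {δ i ζ : Ordinal.{u}} {r : P}

theorem IsFamily.mono {m : MoveI.{u, v} P} {t t' : P} {F : Scenario.{u, v} P → P}
    (hF : S.IsFamily Λ δ i m ζ r t F) (h : t ≤ t') : S.IsFamily Λ δ i m ζ r t' F :=
  ⟨fun a ha => (hF.restr_le a ha).trans h, hF.dom_subset, hF.coherent, hF.fam_le, hF.base_le,
    hF.decides, hF.mem_system⟩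

variable [Nonempty P]

/-- A condition of the quotient can be extended to lie above small subsets of the ideals played
so far. -/
theorem exists_extension (hδ : δ < (succ κ).ord) (hΛ : ∀ β < δ, S.IsLevel Λ β (Λ β))
    (hdec : C.DecidesBounds (heightBefore (Level.toMoveII ∘ Λ) δ)
      (C.quotBefore (Level.toMoveII ∘ Λ) δ))
    (hζ : heightBefore (Level.toMoveII ∘ Λ) δ ≤ ζ) {t : P}
    (ht : t ∈ C.quotBefore (Level.toMoveII ∘ Λ) δ) (htd : C.dom t ⊆ Iio ζ) (hi : i < κ.ord) :
    ∃ x ∈ C.quotBefore (Level.toMoveII ∘ Λ) δ, C.dom x ⊆ Iio ζ ∧ t ≤ x ∧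
      ∀ β ∈ S.part δ i, (Λ β).seq i ≤ x := by
  have hC := S.isUniform
  have hκ := S.isRegular.aleph0_le
  have hst : ∀ β < δ, C.IsStage (Level.toMoveII ∘ Λ) β ((Level.toMoveII ∘ Λ) β) :=
    fun β hβ => (hΛ β hβ).stage
  rcases eq_or_ne δ 0 with rfl | hδ0
  · exact ⟨t, ht, htd, le_rfl, fun β hβ => absurd hβ.2 (by simp)⟩
  have hmem : ∀ β ∈ S.part δ i, (Λ β).seq i ∈ (Λ β).ideal := fun β hβ =>
    ((hΛ β hβ.2).mem_ideal _).2 ⟨i, hi, le_rfl⟩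
  obtain ⟨q, hq, hqd, hqX⟩ := Coding.directed_quotBefore hC hst hδ hδ0 S.isRegular
    (X := {C.restr t (heightBefore (Level.toMoveII ∘ Λ) δ)} ∪
      (fun β => (Λ β).seq i) '' S.part δ i)
    ((isSmall_of_finite hκ (finite_singleton _)).union hκ ((isSmall_part hi).image _))
    (by
      rintro p (rfl | ⟨β, hβ, rfl⟩)
      · exact (Coding.mem_quotBefore_iff hC).1 ht
      · exact Coding.mem_quotBefore_of_mem hC hst hβ.2 (hmem β hβ))
    (by
      rintro p (rfl | ⟨β, hβ, rfl⟩)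
      · exact hC.dom_restr_subset _ _
      · exact ((hst β hβ.2).subset (hmem β hβ)).trans
          (Iio_subset_Iio (Coding.le_heightBefore (y := Level.toMoveII ∘ Λ) hβ.2)))
  obtain ⟨x, hx, h1, h2, h3⟩ := (Coding.isNice_quotBefore hC hst hδ S.isRegular hdec).amalgam
    t ht q hq _ (Coding.heightBefore_lt hκ hδ hst) le_rfl (hqX (Or.inl rfl)) hqd
  refine ⟨x, hx, ?_, h1, fun β hβ => (hqX (Or.inr ⟨β, hβ, rfl⟩)).trans h2⟩
  rw [h3]
  exact union_subset htd (hqd.trans (Iio_subset_Iio hζ))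

/-- A recursion of length κ in the quotient, with domains below ζ. At good limit steps the sequence
absorbs the family for the scenarios, and every step dominates the generating sequences of the
stages enumerated so far, so that the earlier ideals are included. -/
theorem exists_isLevel (hδ : δ < (succ κ).ord) (hΛ : ∀ β < δ, S.IsLevel Λ β (Λ β))
    (hdec : C.DecidesBounds (heightBefore (Level.toMoveII ∘ Λ) δ)
      (C.quotBefore (Level.toMoveII ∘ Λ) δ))
    {m : MoveI.{u, v} P} (hm : C.LegalI (Level.toMoveII ∘ Λ) δ m) :
    ∃ l : Level.{u, v} P, l.move = m ∧ S.IsLevel Λ δ l := by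
  have hC := S.isUniform
  have hκ := S.isRegular.aleph0_le
  have hst : ∀ β < δ, C.IsStage (Level.toMoveII ∘ Λ) β ((Level.toMoveII ∘ Λ) β) :=
    fun β hβ => (hΛ β hβ).stage
  have hquot := Coding.genericQuotient_idealBefore hC hst hδ S.isRegular hdec
  have hnice := Coding.isNice_quotBefore hC hst hδ S.isRegular hdec
  have hlow := Coding.isLowerSet_quotBefore hC hst
  have helt : m.elt ∈ C.quotBefore (Level.toMoveII ∘ Λ) δ := hquot.subset hm.1
  obtain ⟨θ, hθ, hgθ⟩ := Coding.exists_dom_bound hκ m.elt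
  obtain ⟨ζ, hζκ, hηζ, hgζ⟩ : ∃ ζ < (succ κ).ord,
      heightBefore (Level.toMoveII ∘ Λ) δ < ζ ∧ C.dom m.elt ⊆ Iio ζ :=
    ⟨Order.succ (max (heightBefore (Level.toMoveII ∘ Λ) δ) θ),
      (Cardinal.isSuccLimit_ord (hκ.trans (Order.le_succ _))).succ_lt
        (max_lt (Coding.heightBefore_lt hκ hδ hst) hθ),
      Order.lt_succ_iff.2 (le_max_left _ _),
      hgθ.trans (Iio_subset_Iio ((le_max_right _ _).trans (Order.le_succ _)))⟩
  obtain ⟨s, hs⟩ := exists_ordinal_sequence κ.ord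
    (fun i (s : Ordinal.{u} → P × (Scenario.{u, v} P → P)) x =>
      (x.1 ∈ C.quotBefore (Level.toMoveII ∘ Λ) δ ∧ C.dom x.1 ⊆ Iio ζ ∧ m.elt ≤ x.1 ∧
        ∀ β ∈ S.part δ i, (Λ β).seq i ≤ x.1) ∧ (∀ j < i, (s j).1 ≤ x.1) ∧
      (IsSuccLimit i → S.Good Λ i δ ζ (lub ((fun j => (s j).1) '' Iio i)) →
        S.IsFamily Λ δ i m ζ (lub ((fun j => (s j).1) '' Iio i)) x.1 x.2))
    (by
      rintro i - s s' x h ⟨h1, h2, h3⟩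
      have h4 : (fun j => (s j).1) '' Iio i = (fun j => (s' j).1) '' Iio i :=
        image_congr fun j hj => congrArg Prod.fst (h j hj)
      rw [h4] at h3
      exact ⟨h1, fun j hj => h j hj ▸ h2 j hj, h3⟩)
    (by
      intro i hi s hs
      suffices ∃ t ∈ C.quotBefore (Level.toMoveII ∘ Λ) δ, C.dom t ⊆ Iio ζ ∧ m.elt ≤ t ∧
          (∀ j < i, (s j).1 ≤ t) ∧ ∃ F, (IsSuccLimit i →
            S.Good Λ i δ ζ (lub ((fun j => (s j).1) '' Iio i)) →
              S.IsFamily Λ δ i m ζ (lub ((fun j => (s j).1) '' Iio i)) t F) by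
        -- The family is chosen before the condition is raised above the earlier sequences; t enters
        -- `IsFamily` only as an upper bound.
        obtain ⟨t, ht, htd, hgt, hst', F, hF⟩ := this
        obtain ⟨x, hx, hxd, htx, hxs⟩ := exists_extension (S := S) hδ hΛ hdec hηζ.le ht htd hi
        exact ⟨(x, F), ⟨hx, hxd, hgt.trans htx, hxs⟩, fun j hj => (hst' j hj).trans htx,
          fun h1 h2 => (hF h1 h2).mono htx⟩
      rcases eq_or_ne i 0 with rfl | hi0
      · exact ⟨m.elt, helt, hgζ, le_rfl, fun j hj => absurd hj (by simp), fun _ => m.elt,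
          fun h => absurd h (by simp)⟩
      have hpos : 0 < i := pos_iff_ne_zero.2 hi0
      have hmono : MonotoneOn (fun j => (s j).1) (Iio i) := fun a _ b hb hab => by
        rcases hab.eq_or_lt with rfl | h
        · exact le_rfl
        · exact (hs b hb).2.1 a h
      obtain ⟨r, hr, hrd, _⟩ := hC.exists_isLUB_on (isSmall_Iio hi) hmono
      rw [lub_eq hr]
      have hrQ := hnice.lub_mem_on (isSmall_Iio hi) hmono (fun j hj => (hs j hj).1.1) hr
      have hrζ : C.dom r ⊆ Iio ζ := by
        rw [hrd]; exact iUnion₂_subset fun j hj => (hs j hj).1.2.1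
      have hrs : ∀ j < i, (s j).1 ≤ r := fun j hj => hr.1 ⟨j, hj, rfl⟩
      have hgr := ((hs 0 hpos).1.2.2.1).trans (hrs 0 hpos)
      by_cases h : IsSuccLimit i ∧ S.Good Λ i δ ζ r
      · obtain ⟨F, t, ht, htd, hrt, hF⟩ :=
          exists_isFamily hδ hΛ hdec hm hζκ hηζ.le hi h.1 h.2 hrQ hrζ
        exact ⟨t, ht, htd, hgr.trans hrt, fun j hj => (hrs j hj).trans hrt, F, fun _ _ => hF⟩
      · exact ⟨r, hrQ, hrζ, hgr, hrs, fun _ => r, fun h1 h2 => absurd ⟨h1, h2⟩ h⟩)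
  have hmono : MonotoneOn (fun j => (s j).1) (Iio κ.ord) := fun a _ b hb hab => by
    rcases hab.eq_or_lt with rfl | h
    · exact le_rfl
    · exact (hs b hb).2.1 a h
  refine ⟨⟨⟨ζ, {q | ∃ i < κ.ord, q ≤ (s i).1}⟩, m, fun i => (s i).1, fun i => (s i).2⟩, rfl,
    ⟨hζκ, fun β hβ => (Coding.le_heightBefore hβ).trans_lt hηζ, hηζ.pos, ?_, ?_, ?_, ?_, ?_⟩,
    ?_, hm, fun q => Iff.rfl, hmono, fun i hi => (hs i hi).1.2.2.2,
    fun i hi hil hG => (hs i hi).2.2 hil hG⟩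
  · rintro q ⟨i, hi, hq⟩
    exact (hC.dom_mono _ _ hq).trans (hs i hi).1.2.1
  · rintro a b hab ⟨i, hi, hq⟩
    exact ⟨i, hi, hab.trans hq⟩
  · intro X hX hXs
    choose! n hn hn' using hX
    obtain ⟨b, hb, h⟩ := hXs.exists_bound S.isRegular n fun q hq => hn hq
    exact ⟨(s b).1, ⟨b, hb, le_rfl⟩, fun q hq => (hn' hq).trans (hmono (hn hq) hb (h q hq).le)⟩
  · intro β hβ q hq
    obtain ⟨j, hj, hqj⟩ := ((hΛ β hβ).mem_ideal q).1 hq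
    obtain ⟨k, hk, hβk⟩ := exists_mem_part (S := S) hδ hβ
    have hjk := max_lt hj hk
    exact ⟨_, hjk, hqj.trans (((hΛ β hβ).mono hj (mem_Iio.2 hjk) (le_max_left _ _)).trans
      ((hs _ hjk).1.2.2.2 β (part_mono (le_max_right _ _) hβk)))⟩
  · rintro q ⟨i, hi, hq⟩ β hβ
    exact hlow hq (hs i hi).1.1 β hβ
  · have h0 : (0 : Ordinal.{u}) < κ.ord := (Cardinal.isSuccLimit_ord hκ).bot_lt
    exact ⟨0, h0, (hs 0 h0).1.2.2.1⟩

end Guide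

/-! ### Correct guesses settle the quotient at every stage. -/

variable {κ : Cardinal.{u}} {P : Type v} [PartialOrder P]

/-- A surjection onto a nonempty set can be chosen with values in that set. -/
theorem exists_surjOn_forall_mem {α : Type v} {s : Set α} (hne : s.Nonempty)
    (hs : IsSmall (Order.succ κ) s) :
    ∃ f : Ordinal.{u} → α, (∀ j, f j ∈ s) ∧ SurjOn f (Iio κ.ord) s := by
  classical
  obtain ⟨a, ha⟩ := hne
  have : Nonempty α := ⟨a⟩
  obtain ⟨f, hf⟩ := exists_surjOn_of_mk_le (isSmall_succ.1 hs)
  refine ⟨fun j => if f j ∈ s then f j else a, fun j => ?_, fun b hb => ?_⟩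
  · dsimp only
    split_ifs with h
    · exact h
    · exact ha
  · obtain ⟨j, hj, rfl⟩ := hf hb
    exact ⟨j, hj, if_pos hb⟩

theorem IsSmall.exists_subset_image {α : Type v} {s : Set α} (hκ : κ.IsRegular) (hs : IsSmall κ s)
    {f : Ordinal.{u} → α} (hf : s ⊆ f '' Iio κ.ord) : ∃ k < κ.ord, s ⊆ f '' Iio k := by
  have hf' : ∀ a ∈ s, ∃ j, j ∈ Iio κ.ord ∧ f j = a := fun a ha => hf ha
  choose! g hg hg' using hf'
  obtain ⟨k, hk, h⟩ := hs.exists_bound hκ g hg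
  exact ⟨k, hk, fun a ha => ⟨g a, h a ha, hg' a ha⟩⟩

namespace Guide

variable {C : Coding κ P}

/-- A blueprint has club many closed initial segments. -/
theorem club_closed {d : Blueprint.{u, v} P} (hκ : κ.IsRegular)
    (henum : ∀ j, d.enum j < d.bound) (hbound : d.bound < (succ κ).ord) (hnode : d.node ≤ d.bound)
    (hmono : MonotoneOn d.cond (Iio κ.ord))
    (hcond : ∀ j < κ.ord, C.dom (d.cond j) ⊆ d.enum '' Iio κ.ord)
    (hcond_lt : ∀ j < κ.ord, C.dom (d.cond j) ⊆ Iio d.node)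
    (htarget : ∀ j < κ.ord, C.dom (d.target j) ⊆ d.enum '' Iio κ.ord)
    (hsmall : IsSmall κ d.small) (hsub : d.small ⊆ d.enum '' Iio κ.ord)
    (hindex : d.index < κ.ord) : Club κ (d.Closed C) := by
  have h1 : ∀ p : Ordinal.{u} → P, (∀ j < κ.ord, C.dom (p j) ⊆ d.enum '' Iio κ.ord) →
      Club κ fun i => ∀ j < i, ∃ k < i, C.dom (p j) ⊆ d.enum '' Iio k := fun p hp =>
    Club.of_exists fun j hj => (Coding.isSmall_dom (p j)).exists_subset_image hκ (hp j hj)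
  have h2 : ∀ p : Ordinal.{u} → P, Club κ fun i => ∀ j < i, ∃ k < i, C.code (p j) ≤ k := fun p =>
    Club.of_exists fun j _ => ⟨_, C.code_lt (p j), le_rfl⟩
  obtain ⟨k, hk, hk'⟩ := hsmall.exists_subset_image hκ hsub
  refine ((((h1 _ hcond).and (h2 d.cond)).and ((h1 _ htarget).and (h2 d.target))).and
    ((Club.gt hk).and (Club.gt hindex))).mono fun i hi _ h => ?_
  have h3 : ∀ {A : Set Ordinal.{u}}, (∃ k < i, A ⊆ d.enum '' Iio k) → A ⊆ d.enum '' Iio i :=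
    fun ⟨k, hk, h⟩ => h.trans (image_mono (Iio_subset_Iio hk.le))
  have h4 : ∀ {a : Ordinal.{u}}, (∃ k < i, a ≤ k) → a < i := fun ⟨k, hk, h⟩ => h.trans_lt hk
  exact ⟨hi, fun j _ => henum j, hbound, hnode, hmono.mono (Iio_subset_Iio hi.le),
    fun j hj => h3 (h.1.1.1 j hj), fun j hj => hcond_lt j (hj.trans hi),
    fun j hj => h4 (h.1.1.2 j hj), fun j hj => h3 (h.1.2.1 j hj), fun j hj => h4 (h.1.2.2 j hj),
    h3 ⟨k, h.2.1, hk'⟩, h.2.2⟩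

variable {S : Guide.{u, v} C} [Nonempty P]
  {Λ : Ordinal.{u} → Level.{u, v} P} {δ : Ordinal.{u}}

/-- The sequence of conditions of a blueprint. -/
theorem exists_dominating_sequence (hδ : δ < (succ κ).ord) (hδ0 : δ ≠ 0)
    (hΛ : ∀ β < δ, S.IsLevel Λ β (Λ β)) {r : P}
    (hr : r ∈ C.quotBefore (Level.toMoveII ∘ Λ) δ)
    (hrd : C.dom r ⊆ Iio (heightBefore (Level.toMoveII ∘ Λ) δ)) :
    ∃ q : Ordinal.{u} → P, MonotoneOn q (Iio κ.ord) ∧ ∀ j < κ.ord,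
      q j ∈ C.quotBefore (Level.toMoveII ∘ Λ) δ ∧
      C.dom (q j) ⊆ Iio (heightBefore (Level.toMoveII ∘ Λ) δ) ∧ r ≤ q j ∧
      ∀ β ∈ S.part δ j, (Λ β).seq j ≤ q j := by
  have hκ := S.isRegular.aleph0_le
  have hst : ∀ β < δ, C.IsStage (Level.toMoveII ∘ Λ) β ((Level.toMoveII ∘ Λ) β) :=
    fun β hβ => (hΛ β hβ).stage
  obtain ⟨q, hq⟩ := exists_ordinal_sequence κ.ord (fun j (s : Ordinal.{u} → P) x =>
      (x ∈ C.quotBefore (Level.toMoveII ∘ Λ) δ ∧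
      C.dom x ⊆ Iio (heightBefore (Level.toMoveII ∘ Λ) δ) ∧ r ≤ x ∧
      ∀ β ∈ S.part δ j, (Λ β).seq j ≤ x) ∧ ∀ k < j, s k ≤ x)
    (by
      rintro j - s s' x h ⟨h1, h2⟩
      exact ⟨h1, fun k hk => h k hk ▸ h2 k hk⟩)
    (by
      intro j hj s hs
      have hmem : ∀ β ∈ S.part δ j, (Λ β).seq j ∈ (Λ β).ideal := fun β hβ =>
        ((hΛ β hβ.2).mem_ideal _).2 ⟨j, hj, le_rfl⟩
      obtain ⟨x, hx, hxd, hxX⟩ := Coding.directed_quotBefore S.isUniform hst hδ hδ0 S.isRegular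
        (X := ({r} ∪ s '' Iio j) ∪ (fun β => (Λ β).seq j) '' S.part δ j)
        (((isSmall_of_finite hκ (finite_singleton _)).union hκ ((isSmall_Iio hj).image _)).union hκ
          ((isSmall_part hj).image _))
        (by
          rintro p ((rfl | ⟨k, hk, rfl⟩) | ⟨β, hβ, rfl⟩)
          · exact hr
          · exact (hs k hk).1.1
          · exact Coding.mem_quotBefore_of_mem S.isUniform hst hβ.2 (hmem β hβ))
        (by
          rintro p ((rfl | ⟨k, hk, rfl⟩) | ⟨β, hβ, rfl⟩)
          · exact hrd
          · exact (hs k hk).1.2.1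
          · exact ((hst β hβ.2).subset (hmem β hβ)).trans
              (Iio_subset_Iio (Coding.le_heightBefore (y := Level.toMoveII ∘ Λ) hβ.2)))
      exact ⟨x, ⟨hx, hxd, hxX (Or.inl (Or.inl rfl)), fun β hβ => hxX (Or.inr ⟨β, hβ, rfl⟩)⟩,
        fun k hk => hxX (Or.inl (Or.inr ⟨k, hk, rfl⟩))⟩)
  refine ⟨q, fun a _ b hb hab => ?_, fun j hj => (hq j hj).1⟩
  rcases hab.eq_or_lt with rfl | h
  · exact le_rfl
  · exact (hq b hb).2 a h

/-- The conditions that were chosen for a correctly guessed scenario yield a condition in the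
quotient. -/
theorem exists_of_guess (hδ : δ < (succ κ).ord) (hδ0 : δ ≠ 0)
    (hΛ : ∀ β < δ, S.IsLevel Λ β (Λ β)) {X : Set P} (hX : IsSmall κ X) (hXne : X.Nonempty)
    {x : Set Ordinal.{u}} (hx : IsSmall κ x) (hxκ : x ⊆ Iio (succ κ).ord) {ξ : Ordinal.{u}}
    (hξ : ξ < κ.ord) {r : P} (hr : r ∈ C.quotBefore (Level.toMoveII ∘ Λ) δ)
    (hrd : C.dom r ⊆ Iio (heightBefore (Level.toMoveII ∘ Λ) δ)) {β : Ordinal.{u}} (hβ : β < δ) :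
    ∃ s ∈ C.quotBefore (Level.toMoveII ∘ Λ) δ, ∃ w : Set Ordinal.{u}, IsSmall κ w ∧ x ⊆ w ∧
      w ⊆ Iio (heightBefore (Level.toMoveII ∘ Λ) δ) ∪ ((⋃ p ∈ X, C.dom p) ∪ x) ∧ C.dom s ⊆ w ∧
      r ≤ s ∧ (s ∈ upperBounds X ∨ ¬ ∃ y ∈ upperBounds X,
        C.restr s (heightBefore (Level.toMoveII ∘ Λ) δ) ≤ y) ∧
      (genericQuotient (C.idealBefore (Level.toMoveII ∘ Λ) β) =
        C.quotBefore (Level.toMoveII ∘ Λ) β →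
        ∀ D ∈ (Λ β).move.systems, (Λ β).move.index κ D = ξ → s ∈ D x w) := by
  have hC := S.isUniform
  have hκ := S.isRegular.aleph0_le
  have hκ' := hκ.trans (Order.le_succ κ)
  have hst : ∀ β < δ, C.IsStage (Level.toMoveII ∘ Λ) β ((Level.toMoveII ∘ Λ) β) :=
    fun β hβ => (hΛ β hβ).stage
  have hηκ := Coding.heightBefore_lt hκ hδ hst
  have hleη : ∀ β < δ, (Λ β).height ≤ heightBefore (Level.toMoveII ∘ Λ) δ := fun β hβ =>
    Coding.le_heightBefore (y := Level.toMoveII ∘ Λ) hβ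
  set η := heightBefore (Level.toMoveII ∘ Λ) δ with hηdef
  have h0δ : 0 < δ := pos_iff_ne_zero.2 hδ0
  have hAs : IsSmall κ ((⋃ p ∈ X, C.dom p) ∪ x) :=
    (hX.biUnion S.isRegular fun p _ => Coding.isSmall_dom p).union hκ hx
  have hAκ : (⋃ p ∈ X, C.dom p) ∪ x ⊆ Iio (succ κ).ord :=
    union_subset (iUnion₂_subset fun p _ => (C.dom_mem p).1) hxκ
  -- All values of e stay in this set, so the set w of the first i points satisfies the required
  -- inclusion.
  obtain ⟨e, he, he'⟩ := exists_surjOn_forall_mem (κ := κ)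
    (s := Iio η ∪ ((⋃ p ∈ X, C.dom p) ∪ x))
    ⟨0, Or.inl ((hst 0 h0δ).pos.trans_le (hleη 0 h0δ))⟩
    ((isSmall_Iio hηκ).union hκ' hAs.succ)
  obtain ⟨b, hb, hAb⟩ := hAs.succ.exists_bound (Cardinal.isRegular_succ hκ) id fun ξ hξ => hAκ hξ
  obtain ⟨g, hg, hg'⟩ := exists_surjOn_forall_mem (κ := κ) hXne hX.succ
  obtain ⟨q, hq, hq'⟩ := exists_dominating_sequence (S := S) hδ hδ0 hΛ hr hrd
  -- The ordinal max b η plays the part of the height of a stage with generating sequence q; as q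
  -- dominates the earlier sequences, `club_fits` applies to it.
  let d : Blueprint.{u, v} P := ⟨e, max b η, η, q, g, x, ξ⟩
  have hθκ : max b η < (succ κ).ord := max_lt hb hηκ
  have hde : ∀ j, e j < max b η := fun j => by
    rcases he j with h | h
    · exact lt_of_lt_of_le h (le_max_right _ _)
    · exact (hAb _ h).trans_le (le_max_left _ _)
  have hclosed : Club κ (d.Closed C) := club_closed S.isRegular hde hθκ (le_max_right _ _) hq
    (fun j hj => ((hq' j hj).2.1.trans subset_union_left).trans he') (fun j hj => (hq' j hj).2.1)
    (fun j _ => ((subset_biUnion_of_mem (u := C.dom) (hg j)).trans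
      (subset_union_left.trans subset_union_right)).trans he') hx
    ((subset_union_right.trans subset_union_right).trans he') hξ
  have hfits := club_fits (S := S) hδ hΛ (e := e) (θ := max b η)
    (fun β hβ => (hleη β hβ).trans (le_max_right _ _))
    (fun β hβ => ((Iio_subset_Iio (hleη β hβ)).trans subset_union_left).trans he') hq
    (fun j hj => (hq' j hj).1) (fun j hj => (hq' j hj).2.2.2)
  obtain ⟨kX, hkX, hkX'⟩ := hX.exists_subset_image S.isRegular hg'
  obtain ⟨kβ, hkβ, hkβ'⟩ := exists_mem_part (S := S) hδ hβ
  -- A correct guess at an i where the approximations fit, g has exhausted `X`, and β has been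
  -- enumerated.
  obtain ⟨i, hi, hil, ⟨⟨hF, hG⟩, hiX, hiβ⟩, hcl, a, ha, hreal⟩ := S.exists_guess d _
    ((hfits.and (club_good hδ hΛ)).and ((Club.gt hkX).and (Club.gt hkβ))) hclosed
  have hw : e '' Iio i ∩ Iio (max b η) = e '' Iio i := inter_eq_self_of_subset_left hcl.image_subset
  rw [hw] at hF
  have hv := S.valid i hi a ha
  have hh : IsShift κ (shift (e '' Iio i) (max b η)) := isShift_shift hκ _ hθκ
  have hbase : C.map (shift (e '' Iio i) (max b η)) a.base = lub (q '' Iio i) :=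
    (lub_eq hreal.isLUB_base).symm
  have hnode : ∀ ξ, ξ < a.node ↔ shift (e '' Iio i) (max b η) ξ < η := fun ξ => by
    rw [hreal.node_eq]; exact lt_shiftPos
  have hn : ∀ β < δ, shiftPos (e '' Iio i) (max b η) (Λ β).height ≤ a.node := fun β hβ =>
    le_of_forall_lt fun ξ hξ => (hnode ξ).2 ((lt_shiftPos.1 hξ).trans_le (hleη β hβ))
  have hθ : ∀ β < δ, (Λ β).height ≤ max b η := fun β hβ => (hleη β hβ).trans (le_max_right _ _)
  have hb' : ∀ β < δ, C.restr (C.map (shift (e '' Iio i) (max b η)) a.base) (Λ β).height =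
      C.restr (lub (q '' Iio i)) (Λ β).height := fun β _ => by rw [hbase]
  have hmem := fun β hβ => hF.mem_guesses hΛ hθκ hθ ha hn hb' (β := β) hβ
  have hfam : ∀ β ∈ S.part δ i, S.IsFamily Λ β i (Λ β).move (Λ β).height ((Λ β).before i)
      ((Λ β).seq i) ((Λ β).fam i) := fun β hβ =>
    (hΛ β hβ.2).isFamily i hi hil (hF.good hG hβ)
  obtain ⟨f, _, hf1, hf2, hf3, hf4⟩ :=
    exists_isLUB_fam hδ hδ0 hΛ hi hil hθκ hθ hF hG ha hn hb'
  have hX' : C.map (shift (e '' Iio i) (max b η)) '' a.targets = X := by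
    refine hreal.map_targets.trans (Subset.antisymm ?_ ?_)
    · rintro _ ⟨j, _, rfl⟩; exact hg j
    · exact hkX'.trans (image_mono (Iio_subset_Iio hiX.le))
  have hx' : shift (e '' Iio i) (max b η) '' a.small = x := hreal.map_small
  have hi0 : 0 < i := hil.bot_lt
  have h0 := hF.zero hδ0
  refine ⟨C.map (shift (e '' Iio i) (max b η)) f, hf3,
    shift (e '' Iio i) (max b η) '' Iio a.top, (isSmall_Iio hv.top_lt).image _, ?_, ?_, ?_, ?_, ?_,
    ?_⟩
  · rw [← hx']; exact image_mono hv.small_subset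
  · have : shift (e '' Iio i) (max b η) '' Iio a.top = e '' Iio i := by
      rw [hreal.top_eq]; exact hcl.image_Iio_top
    rw [this]
    rintro _ ⟨j, _, rfl⟩
    exact he j
  · rw [hC.dom_map hh]; exact image_mono hf2
  · exact (hq' 0 (hi0.trans hi)).2.2.1.trans ((hreal.isLUB_base.1 ⟨0, hi0, rfl⟩).trans
      (hC.map_mono hh hf4))
  -- The decision made at stage 0 about the collapse of `X` becomes one about `X`. In the negative
  -- case, a bound of `X` is interpolated into the range of the expansion and pulled back.
  · rcases (hfam 0 h0).decides rfl a (hmem 0 h0) with h1 | h1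
    · left
      rw [← hX']
      rintro _ ⟨c, hc, rfl⟩
      exact hC.map_mono hh ((h1 hc).trans (hf1 0 h0))
    · right
      rintro ⟨y, hy, hty⟩
      obtain ⟨y', _, hyX, hyd⟩ := hC.interpolation_small S.isRegular
        (X := {C.restr (C.map (shift (e '' Iio i) (max b η)) f) η} ∪ X)
        ((isSmall_of_finite hκ (finite_singleton _)).union hκ hX) (y := y) (by
          rintro p (rfl | hp)
          · exact hty
          · exact hy hp)
      obtain ⟨z, rfl⟩ := hC.exists_map_eq hh (q := y') (by
        rw [hyd]
        refine iUnion₂_subset fun p hp => ?_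
        rcases hp with rfl | hp
        · rw [hC.dom_restr, hC.dom_map hh]
          exact inter_subset_left.trans (image_subset_range _ _)
        · rw [← hX'] at hp
          obtain ⟨c, _, rfl⟩ := hp
          rw [hC.dom_map hh]
          exact image_subset_range _ _)
      refine h1 ⟨z, fun c hc => (hC.map_le_map_iff hh).1 (hyX (Or.inr ?_)),
        (hC.map_le_map_iff hh).1 ?_⟩
      · rw [← hX']; exact mem_image_of_mem _ hc
      · rw [hC.map_restr hh (γ' := η) fun ξ _ => hnode ξ]
        exact (hC.restr_mono (hC.map_mono hh (hf1 0 h0))).trans (hyX (Or.inl rfl))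
  · intro hquot D hD hDξ
    have hβi : β ∈ S.part δ i := part_mono hiβ.le hkβ'
    have hsys := (hΛ β hβ).legal.2.2 D hD
    have hhβ := isShift_shift hκ (S.part (Λ β).height i) (hst β hβ).height_lt
    have h1 := (hfam β hβi).mem_system a (hmem β hβi) D hD (hDξ.trans hreal.index_eq.symm)
    have htop : Iio a.top ⊆ Iio (succ κ).ord :=
      Iio_subset_Iio (hv.top_lt.trans (Cardinal.ord_lt_ord.2 (Order.lt_succ κ))).le
    have hmemS : ∀ {h : Ordinal.{u} → Ordinal.{u}}, IsShift κ h →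
        h '' Iio a.top ∈ SmallSubsets κ (Iio (succ κ).ord) := fun {h} hh => by
      refine ⟨?_, isSmall_ordinal.1 ((isSmall_Iio hv.top_lt).image _)⟩
      rintro _ ⟨ξ, hξ, rfl⟩
      exact hh.map_lt ξ (htop hξ)
    have hαle : heightBefore (Level.toMoveII ∘ Λ) β ≤ (Λ β).height :=
      le_of_forall_lt fun ξ hξ => by
        obtain ⟨γ, hγ, h⟩ := Coding.lt_heightBefore.1 hξ
        exact h.trans ((hst β hβ).lt_height γ hγ)
    have hinter := hF.inter_eq hβi
    -- Stage β expanded the scenario by its own enumeration. It agrees with that of the blueprint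
    -- below ζ_β, hence below ζ_{<β}, so uniformity transfers the membership.
    have h2 := (hC.mem_system_iff hhβ hh hsys (isSmall_Iio hv.top_lt) htop hv.small_subset (by
      ext ζ
      constructor
      · rintro ⟨⟨ξ, hξ, rfl⟩, h2⟩
        have := shift_eq_of_inter_eq le_rfl (hθ β hβ) hinter.symm (lt_of_lt_of_le h2 hαle)
        exact ⟨⟨ξ, hξ, this⟩, h2⟩
      · rintro ⟨⟨ξ, hξ, rfl⟩, h2⟩
        have := shift_eq_of_inter_eq (hθ β hβ) le_rfl hinter (lt_of_lt_of_le h2 hαle)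
        exact ⟨⟨ξ, hξ, this⟩, h2⟩)
      (hsys.subset _ (hmemS hhβ) _ (image_mono hv.small_subset) h1).1
      ((hfam β hβi).dom_subset a (hmem β hβi))).1 h1
    rw [← hx']
    refine hsys.upward _ (hmemS hh) _ (image_mono hv.small_subset) _
      (hsys.subset _ (hmemS hh) _ (image_mono hv.small_subset) h2).1 _ ?_ h2
      (hC.map_mono hh (hf1 β hβi)) ?_
    · rw [hquot]
      exact fun γ hγ => hf3 γ (hγ.trans hβ)
    · rw [hC.dom_map hh]; exact image_mono hf2

theorem decidesBounds (hδ : δ < (succ κ).ord) (hΛ : ∀ β < δ, S.IsLevel Λ β (Λ β)) :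
    C.DecidesBounds (heightBefore (Level.toMoveII ∘ Λ) δ)
      (C.quotBefore (Level.toMoveII ∘ Λ) δ) := by
  have hC := S.isUniform
  have hst : ∀ β < δ, C.IsStage (Level.toMoveII ∘ Λ) β ((Level.toMoveII ∘ Λ) β) :=
    fun β hβ => (hΛ β hβ).stage
  rcases eq_or_ne δ 0 with rfl | hδ0
  · exact Coding.decidesBounds_zero hC S.isRegular
  intro X hX
  obtain ⟨r, hr, hrd, _⟩ := Coding.directed_quotBefore hC hst hδ hδ0 S.isRegular (X := ∅)
    (isSmall_of_finite S.isRegular.aleph0_le finite_empty) (empty_subset _) (by simp)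
  -- The targets of a blueprint are enumerated by a total function, so the empty set is treated
  -- separately.
  rcases X.eq_empty_or_nonempty with rfl | hne
  · exact Or.inl ⟨r, hr, by simp, hrd.trans subset_union_left⟩
  obtain ⟨s, hs, w, -, -, hwd, hsw, -, h | h, -⟩ := exists_of_guess hδ hδ0 hΛ hX hne (x := ∅)
    (isSmall_of_finite S.isRegular.aleph0_le finite_empty) (empty_subset _)
    (Cardinal.isSuccLimit_ord S.isRegular.aleph0_le).bot_lt hr hrd (pos_iff_ne_zero.2 hδ0)
  · rw [union_empty] at hwd
    exact Or.inl ⟨s, hs, h, hsw.trans hwd⟩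
  · exact Or.inr ⟨_, Coding.isLowerSet_quotBefore hC hst (hC.restr_le _ _) hs,
      hC.dom_restr_subset _ _, h⟩

theorem denseIn (hδ : δ < (succ κ).ord) (hΛ : ∀ β < δ, S.IsLevel Λ β (Λ β)) {β : Ordinal.{u}}
    (hβ : β < δ) {D : SystemFun.{u, v} P} (hD : D ∈ (Λ β).move.systems) :
    C.DenseIn (heightBefore (Level.toMoveII ∘ Λ) δ) (C.quotBefore (Level.toMoveII ∘ Λ) δ) D := by
  have hC := S.isUniform
  have hκ := S.isRegular.aleph0_le
  have hst : ∀ β < δ, C.IsStage (Level.toMoveII ∘ Λ) β ((Level.toMoveII ∘ Λ) β) :=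
    fun β hβ => (hΛ β hβ).stage
  have hδ0 : δ ≠ 0 := by rintro rfl; simp at hβ
  intro a ha x hx hxκ
  obtain ⟨s, hs, w, hw, hxw, hwd, hsw, hrs, h, hsD⟩ := exists_of_guess hδ hδ0 hΛ (X := {a})
    (isSmall_of_finite hκ (finite_singleton _)) (singleton_nonempty _) hx hxκ
    ((hΛ β hβ).legal.index_spec.2 D hD) ((Coding.mem_quotBefore_iff hC).1 ha)
    (hC.dom_restr_subset _ _) hβ
  -- The guess was made with `X` = {a} and with the low part of a as starting condition r.
  have has : a ≤ s := by
    rcases h with h | h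
    · exact h rfl
    -- The low part of s extends that of a, so the two have a common bound by amalgamation, and s
    -- cannot have excluded a.
    · exfalso
      obtain ⟨y, h1, h2, _⟩ := hC.amalgam (p := a) (Coding.heightBefore_lt hκ hδ hst)
        (hC.le_restr_iff.2 ⟨hrs, hC.dom_restr_subset _ _⟩) (hC.dom_restr_subset _ _)
      exact h ⟨y, by rintro _ rfl; exact h1, h2⟩
  rw [biUnion_singleton] at hwd
  refine ⟨s, hs, has, w, hw, hxw, hwd, hsw, hsD ?_ D hD rfl⟩
  exact Coding.genericQuotient_idealBefore hC (fun γ hγ => hst γ (hγ.trans hβ)) (hβ.trans hδ)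
    S.isRegular (decidesBounds (hβ.trans hδ) fun γ hγ => hΛ γ (hγ.trans hβ))

end Guide

/-! ### Conclusion. -/

theorem Guide.exists_isWinningII {C : Coding κ P} (S : Guide.{u, v} C) :
    ∃ σ : StrategyII.{u, v} P, C.IsWinningII σ := by
  obtain ⟨b, _⟩ := S.isUniform.exists_bot S.isRegular.pos
  have : Nonempty P := ⟨b⟩
  have : Nonempty (Level.{u, v} P) := ⟨⟨⟨0, ∅⟩, ⟨b, ∅⟩, fun _ => b, fun _ _ => b⟩⟩
  exact Coding.exists_isWinningII S.isUniform S.isRegular Level.move Level.toMoveII S.IsLevel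
    (fun δ Λ Λ' l h hl => hl.congr h) (fun δ Λ l hl => ⟨hl.stage, hl.elt_mem⟩)
    (fun δ hδ Λ hΛ => ⟨Guide.decidesBounds hδ hΛ, fun β hβ D hD => Guide.denseIn hδ hΛ hβ hD⟩)
    (fun δ hδ Λ hΛ m hm => Guide.exists_isLevel hδ hΛ (Guide.decidesBounds hδ hΛ) hm)

theorem Coding.IsUniform.nonempty_guide (hDl : DlPrinciple κ) (hκ : κ.IsRegular) (hω : ℵ₀ < κ)
    {C : Coding κ P} (hC : C.IsUniform) : Nonempty (Guide.{u, v} C) := by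
  obtain ⟨𝒮, h1, h2, h3⟩ := exists_guess_scenarios hDl hκ hω hC
  have hex : ∀ θ < (succ κ).ord, ∃ f : Ordinal.{u} → Ordinal.{u},
      SurjOn f (Iio κ.ord) (Iio θ) := fun θ hθ =>
    exists_surjOn_of_mk_le (isSmall_succ.1 (isSmall_Iio hθ))
  choose! e he using hex
  exact ⟨⟨hC, hκ, hω, e, he, 𝒮, h1, h2, h3⟩⟩

/-- If cf κ < κ, then κ^{cf κ} ≤ κ^{<κ} = κ, against König's theorem. -/
theorem isRegular_of_powerlt_eq {κ : Cardinal.{u}} (hκ : ℵ₀ ≤ κ) (h : κ ^< κ = κ) :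
    κ.IsRegular := by
  refine ⟨hκ, not_lt.1 fun hlt => ?_⟩
  have h1 := Cardinal.le_powerlt κ hlt
  rw [h] at h1
  exact absurd (Cardinal.lt_power_cof_ord hκ) (not_lt.2 h1)

theorem theorem1p8 (κ : Cardinal.{u}) (hinf : ℵ₀ ≤ κ) (hpow : κ ^< κ = κ)
    (hDl : DlPrinciple κ) (P : Type v) [PartialOrder P] (C : Coding κ P) (hC : C.IsUniform) :
    ∃ σ : StrategyII.{u, v} P, C.IsWinningII σ := by
  rcases hinf.eq_or_lt with rfl | hω
  · exact Coding.exists_isWinningII_aleph0 hC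
  · obtain ⟨S⟩ := hC.nonempty_guide hDl (isRegular_of_powerlt_eq hinf hpow) hω
    exact S.exists_isWinningII
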